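/- **Setting.** Let $Q(s)=\sqrt{1+s^2}-1$. Let $0<\overline\alpha<\underline\beta$ and let $F\in C^5(0,\infty)$ satisfy $F''>0$ on $(0,\overline\alpha)\cup(\underline\beta,\infty)$, $F''<0$ on $(\overline\alpha,\underline\beta)$, $F'(0)<F'(\underline\beta)$ and $F'(\infty)>F'(\overline\alpha)$, where $F'(0)=\lim_{z\to0^+}F'(z)\in[-\infty,\infty)$ and $F'(\infty)=\lim_{z\to\infty}F'(z)\in(-\infty,\infty]$. Put $\Phi_\sigma(z)=F(z)-\sigma z$ for $z>0$. The numbers $0<\alpha_0<\beta_0$ and $\sigma_0$ are those determined by $$F(\beta_0)-F(\alpha_0)=\sigma_0(\beta_0-\alpha_0),\qquad \sigma_0=F'(\alpha_0)=F'(\beta_0),$$ and the Maxwell point is $\Delta_0=(\sigma_0,b_0)$ with $b_0=\Phi_{\sigma_0}(\alpha_0)=\Phi_{\sigma_0}(\beta_0)$. For $\varepsilon>0$ and $r\in\mathbb R$ consider the problem $$Q''(\varepsilon z')z''=F'(z)-\sigma\ \text{ in }(-\varepsilon^{-1},\varepsilon^{-1}),\qquad z'(\pm\varepsilon^{-1})=0,\qquad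 \int_{-\varepsilon^{-1}}^{\varepsilon^{-1}}z\,dx=2r\varepsilon^{-1}\tag{1}$$ for a positive function $z\in C^1([-\varepsilon^{-1},\varepsilon^{-1}])\cap C^2((-\varepsilon^{-1},\varepsilon^{-1}))$ and a constant $\sigma\in\mathbb R$ (a Lagrange multiplier). A *simple solution* is a strictly increasing solution of (1). The pair corresponding to it is $\Delta=(\sigma,b)$, where $b$ is the constant in the first integral $$P_\varepsilon(z')=\Phi_\sigma(z)-b,\qquad P_\varepsilon(s)=\int_0^sQ''(\varepsilon u)u\,du .$$ A pair $\Delta=(\sigma,b)$ is *admissible* if $\Phi_\sigma$ has three critical points $0<\alpha_\sigma<\zeta_\sigma<\beta_\sigma$ and $\max\{\Phi_\sigma(\alpha_\sigma),\Phi_\sigma(\beta_\sigma)\}<b<\Phi_\sigma(\zeta_\sigma)$. In that case $z_1(\Delta)<z_2(\Delta)$ denote the positive numbers with $\Phi_\sigma(z_1)=\Phi_\sigma(z_2)=b$ and $\Phi_\sigma>b$ on $(z_1,z_2)$. **Theorem 3.1.** For every $\delta\in(0,(\beta_0-\alpha_0)/2)$ there are $\varepsilon_\delta>0$, a neighborhood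 $\mathcal N_\delta$ of $\Delta_0$ in $\mathbb R^2$, and constants $C>0$ and $K$, all independent of $\varepsilon$ and $r$, such that for all $\varepsilon\in(0,\varepsilon_\delta)$ and all $r\in[\alpha_0+\delta,\beta_0-\delta]$ the following hold. 1. Problem (1) has exactly one simple solution $z$ whose corresponding pair $\Delta(\varepsilon,r)$ lies in $\mathcal N_\delta$, and this pair is admissible. 2. One has $z(-\varepsilon^{-1})=z_1(\Delta(\varepsilon,r))$ and $z(\varepsilon^{-1})=z_2(\Delta(\varepsilon,r))$. 3. One has $$\|\Delta(\varepsilon,r)-\Delta_0\|\le Ke^{-C/\varepsilon},\qquad |z_1(\Delta(\varepsilon,r))-\alpha_0|\le Ke^{-C/\varepsilon},\qquad |z_2(\Delta(\varepsilon,r))-\beta_0|\le Ke^{-C/\varepsilon},$$ where $\|\cdot\|$ is the maximum norm on $\mathbb R^2$. -/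

import Mathlib

open Set Filter Topology

namespace Maxwell

noncomputable section

/-- The diffusion density `Q(s) = √(1 + s²) - 1`. -/
def Q (s : ℝ) : ℝ := Real.sqrt (1 + s ^ 2) - 1

/-- The second derivative `Q''`. -/
def Qdd (s : ℝ) : ℝ := deriv (deriv Q) s

/-- `P_ε(s) = ∫₀ˢ Q''(ε u) u du`. -/
def P (ε s : ℝ) : ℝ := ∫ u in (0 : ℝ)..s, Qdd (ε * u) * u

/-- The standing assumptions on the free energy `F`, a function on `(0, ∞)` (its values on
`(-∞, 0]` are irrelevant).  `F'(0)` and `F'(∞)` are the one-sided limits of `F'`, which may be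
infinite. -/
structure IsFreeEnergy (F : ℝ → ℝ) (αbar βbar : ℝ) : Prop where
  pos : 0 < αbar
  lt : αbar < βbar
  contDiffOn : ContDiffOn ℝ 5 F (Ioi 0)
  convex_left : ∀ z ∈ Ioo 0 αbar, 0 < deriv (deriv F) z
  concave_mid : ∀ z ∈ Ioo αbar βbar, deriv (deriv F) z < 0
  convex_right : ∀ z ∈ Ioi βbar, 0 < deriv (deriv F) z
  deriv_zero : ∃ L : EReal, Tendsto (fun z => ((deriv F z : ℝ) : EReal)) (𝓝[>] 0) (𝓝 L) ∧
    L < ((deriv F βbar : ℝ) : EReal)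
  deriv_infty : ∃ L : EReal, Tendsto (fun z => ((deriv F z : ℝ) : EReal)) atTop (𝓝 L) ∧
    ((deriv F αbar : ℝ) : EReal) < L

/-- The Gibbs function `Φ_σ(z) = F(z) - σ z`. -/
def Gibbs (F : ℝ → ℝ) (σ z : ℝ) : ℝ := F z - σ * z

/-- The equal area rule, which determines `α₀ < β₀` and `σ₀`. -/
structure IsMaxwell (F : ℝ → ℝ) (α₀ β₀ σ₀ : ℝ) : Prop where
  pos : 0 < α₀
  lt : α₀ < β₀
  equal_area : F β₀ - F α₀ = σ₀ * (β₀ - α₀)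
  left : deriv F α₀ = σ₀
  right : deriv F β₀ = σ₀

/-- The pair `Δ = (σ, b)` is admissible: `Φ_σ` has three critical points `α < ζ < β` in `(0, ∞)`
(for `F` as in `IsFreeEnergy` these are then all its critical points, and having them means that
`σ` lies strictly between `F'(βbar)` and `F'(αbar)`), and
`max {Φ_σ(α), Φ_σ(β)} < b < Φ_σ(ζ)`. -/
def IsAdmissible (F : ℝ → ℝ) (Δ : ℝ × ℝ) : Prop :=
  ∃ α ζ β : ℝ, 0 < α ∧ α < ζ ∧ ζ < β ∧
    deriv F α = Δ.1 ∧ deriv F ζ = Δ.1 ∧ deriv F β = Δ.1 ∧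
    max (Gibbs F Δ.1 α) (Gibbs F Δ.1 β) < Δ.2 ∧ Δ.2 < Gibbs F Δ.1 ζ

/-- `z₁ = z₁(Δ)` and `z₂ = z₂(Δ)`: the consecutive positive solutions `z₁ < z₂` of `Φ_σ = b`
with `Φ_σ > b` in between. -/
structure IsTurningPair (F : ℝ → ℝ) (Δ : ℝ × ℝ) (z₁ z₂ : ℝ) : Prop where
  pos : 0 < z₁
  lt : z₁ < z₂
  left : Gibbs F Δ.1 z₁ = Δ.2
  right : Gibbs F Δ.1 z₂ = Δ.2
  between : ∀ s ∈ Ioo z₁ z₂, Δ.2 < Gibbs F Δ.1 s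

/-- The closed interval `[-1/ε, 1/ε]`. -/
def dom (ε : ℝ) : Set ℝ := Icc (-ε⁻¹) ε⁻¹

/-- `z` is a positive classical solution on `[-1/ε, 1/ε]` of the Euler–Lagrange equation
`Q''(ε z') z'' = F'(z) - σ` with Neumann boundary conditions and mass constraint
`∫ z = 2 r / ε`.  Only the values of `z` on `[-1/ε, 1/ε]` matter. -/
structure IsSolution (F : ℝ → ℝ) (ε r σ : ℝ) (z : ℝ → ℝ) : Prop where
  pos : ∀ x ∈ dom ε, 0 < z x
  contDiffOn_closed : ContDiffOn ℝ 1 z (dom ε)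
  contDiffOn_open : ContDiffOn ℝ 2 z (Ioo (-ε⁻¹) ε⁻¹)
  ode : ∀ x ∈ Ioo (-ε⁻¹) ε⁻¹,
    Qdd (ε * deriv z x) * deriv (deriv z) x = deriv F (z x) - σ
  neumann_left : derivWithin z (dom ε) (-ε⁻¹) = 0
  neumann_right : derivWithin z (dom ε) ε⁻¹ = 0
  mass : ∫ x in (-ε⁻¹)..ε⁻¹, z x = 2 * r * ε⁻¹

/-- `z` is a simple (strictly increasing) solution with corresponding pair `Δ = (σ, b)`: `σ` is
its Lagrange multiplier, and `b` its constant of integration in `P_ε(z') = Φ_σ(z) - b`. -/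
structure IsSimpleSolution (F : ℝ → ℝ) (ε r : ℝ) (Δ : ℝ × ℝ) (z : ℝ → ℝ) : Prop where
  solution : IsSolution F ε r Δ.1 z
  strictMono : StrictMonoOn z (dom ε)
  first_integral : ∀ x ∈ Ioo (-ε⁻¹) ε⁻¹, P ε (deriv z x) = Gibbs F Δ.1 (z x) - Δ.2

end

end Maxwell

namespace Maxwell

noncomputable section

/-! Solving the first integral for the slope turns a simple solution into a point moving from z₁ to
z₂ with velocity `speed` of Φ_σ(z) − b. Everything is then decided by the time and the mass spent
between the two turning points. With L = z₂ − z₁ and z = z₁ + L sin²φ, the gap Φ_σ − b becomes (sin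
φ cos φ)² times `flux` (`gap_sin_sq`). This removes the singularity of dx = dz/z' at both turning
points, and dx = 2L · `slowness` dφ has a continuous coefficient. The length of the interval and the
mass constraint are together equivalent to two equations: the time weighted by cos²φ equals (z₂ −
r)/(L²ε), and the time weighted by sin²φ equals (r − z₁)/(L²ε).

The unknowns are the end slopes a = `slopeL` and b = `slopeR` of the gap. They vanish at the double
tangent, where their derivative with respect to (z₁, z₂) is diagonal with nonzero entries because
F''(α₀) and F''(β₀) are positive. Hence (a, b) are local coordinates for the turning points
(`IsMaxwell.exists_ofSlopes`). Near φ = 0 the flux behaves like cos²φ (a + A sin²φ) with A = (β₀ −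
α₀)²F''(α₀)/2, so the left time grows like k log(1/a) with k = 2^(-3/2) A^(-1/2). It is used in
derivative form: −a ∂_a `leftTime` is uniformly close to k (`exists_leftRate_close`). The weight
cos²φ suppresses the right end, so a change of b or of the profile alters the left time by at most a
multiple of that change times the total times (`IsProfile.abs_leftTime_sub_le`). The right time is
the mirror image.

In the variables −log a and −log b the system is therefore nearly linear and diagonal, with
right-hand sides of order 1/ε. Its solutions are of order 1/ε, where the coupling is only of order
e^(-c/ε)/ε. A Newton map with frozen diagonal derivative is a contraction, which gives a unique
solution (`exists_unique_of_times`). Then a and b are at most e^(-c/ε), and the exponential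
estimates follow from Lipschitz dependence of the turning points, and then of the pair, on (a, b).

It remains to pass between solutions and parameters. In one direction, a solution of the time
equations yields a simple solution (`IsFreeEnergy.exists_isSimpleSolution`). In the other, any
simple solution with pair near Δ₀ has end values close to α₀ and β₀
(`IsMaxwell.exists_nhds_turningPair`). Its end slopes are positive because an equilibrium is not
reached in finite time (`IsSimpleSolution.not_equilibrium`), it satisfies the time equations
(`IsSimpleSolution.times`), and it is determined by its end values (`IsSimpleSolution.eqOn`). -/

/-! ### The first integral in closed form, its inverse, and the reciprocal speed. -/

/-- The inverse of `P ε` on `[0, ∞)`: the slope at which the first integral takes the value `p`. -/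
def speed (ε p : ℝ) : ℝ := √(p * (2 - ε ^ 2 * p)) / (1 - ε ^ 2 * p)

/-- The normalised reciprocal of the speed. -/
def recip (κ q : ℝ) : ℝ := (1 - κ * q) / √(q * (2 - κ * q))

lemma hasDerivAt_sqrt_one_add_sq (s : ℝ) :
    HasDerivAt (fun s : ℝ => √(1 + s ^ 2)) (s / √(1 + s ^ 2)) s := by
  have h : HasDerivAt (fun s : ℝ => 1 + s ^ 2) (2 * s) s := by
    simpa using ((hasDerivAt_id s).pow 2).const_add 1
  convert h.sqrt (by positivity) using 1
  field_simp

lemma deriv_Q : deriv Q = fun s => s / √(1 + s ^ 2) := by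
  funext s
  exact ((hasDerivAt_sqrt_one_add_sq s).sub_const 1).deriv

lemma Qdd_eq (s : ℝ) : Qdd s = (√(1 + s ^ 2))⁻¹ ^ 3 := by
  have hp : 0 < √(1 + s ^ 2) := by positivity
  have hs : √(1 + s ^ 2) ^ 2 = 1 + s ^ 2 := Real.sq_sqrt (by positivity)
  unfold Qdd
  rw [deriv_Q]
  have h := ((hasDerivAt_id s).div (hasDerivAt_sqrt_one_add_sq s) hp.ne').deriv
  rw [show (fun s : ℝ => s / √(1 + s ^ 2)) = (id / fun s : ℝ => √(1 + s ^ 2)) from rfl, h]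
  simp only [id]
  field_simp
  rw [hs]; ring

lemma continuous_Qdd : Continuous Qdd := by
  have : Qdd = fun s => (√(1 + s ^ 2))⁻¹ ^ 3 := funext Qdd_eq
  rw [this]
  refine Continuous.pow (Continuous.inv₀ (by fun_prop) fun s => ?_) 3
  positivity

lemma hasDerivAt_P (ε s : ℝ) : HasDerivAt (P ε) (Qdd (ε * s) * s) s := by
  have hc : Continuous fun u => Qdd (ε * u) * u :=
    (continuous_Qdd.comp (by fun_prop)).mul continuous_id
  exact intervalIntegral.integral_hasDerivAt_right (hc.intervalIntegrable _ _)
    (hc.stronglyMeasurableAtFilter _ _) hc.continuousAt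

lemma P_eq {ε : ℝ} (hε : ε ≠ 0) (s : ℝ) :
    P ε s = (ε ^ 2)⁻¹ * (1 - (√(1 + (ε * s) ^ 2))⁻¹) := by
  have hd : ∀ u : ℝ, HasDerivAt (fun u => (ε ^ 2)⁻¹ * (1 - (√(1 + (ε * u) ^ 2))⁻¹))
      (Qdd (ε * u) * u) u := by
    intro u
    have hp : 0 < √(1 + (ε * u) ^ 2) := by positivity
    have h1 : HasDerivAt (fun u : ℝ => ε * u) ε u := by
      simpa using (hasDerivAt_id u).const_mul ε
    have h2 := ((hasDerivAt_sqrt_one_add_sq (ε * u)).comp u h1).inv hp.ne'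
    refine ((h2.const_sub 1).const_mul ((ε ^ 2)⁻¹)).congr_deriv ?_
    rw [Qdd_eq]
    simp only [Function.comp]
    field_simp
  have hc : Continuous fun u => Qdd (ε * u) * u :=
    (continuous_Qdd.comp (by fun_prop)).mul continuous_id
  have := intervalIntegral.integral_eq_sub_of_hasDerivAt (a := 0) (b := s)
    (fun u _ => hd u) (hc.intervalIntegrable _ _)
  rw [P, this]
  simp

lemma P_zero (ε : ℝ) : P ε 0 = 0 := by simp [P]

lemma P_speed {ε p : ℝ} (hε : ε ≠ 0) (hp : 0 ≤ p) (h : ε ^ 2 * p < 1) :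
    P ε (speed ε p) = p := by
  have h1 : 0 < 1 - ε ^ 2 * p := by linarith
  have h2 : 0 ≤ p * (2 - ε ^ 2 * p) := mul_nonneg hp (by linarith)
  have h3 : 1 + (ε * speed ε p) ^ 2 = ((1 - ε ^ 2 * p)⁻¹) ^ 2 := by
    rw [speed, mul_pow, div_pow, Real.sq_sqrt h2]
    field_simp
    ring
  rw [P_eq hε, h3, Real.sqrt_sq (by positivity)]
  field_simp
  ring

lemma one_sub_P_pos {ε : ℝ} (hε : ε ≠ 0) (s : ℝ) : 0 < 1 - ε ^ 2 * P ε s := by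
  rw [P_eq hε, ← mul_assoc, mul_inv_cancel₀ (by positivity)]
  simp only [one_mul, sub_sub_cancel]
  positivity

lemma P_nonneg {ε : ℝ} (hε : ε ≠ 0) (s : ℝ) : 0 ≤ P ε s := by
  rw [P_eq hε]
  refine mul_nonneg (by positivity) (sub_nonneg.2 (inv_le_one_of_one_le₀ ?_))
  rw [Real.one_le_sqrt]
  nlinarith [sq_nonneg (ε * s)]

/-- The slope in terms of the value of the first integral. -/
lemma P_mul_two_sub {ε : ℝ} (hε : ε ≠ 0) (s : ℝ) :
    P ε s * (2 - ε ^ 2 * P ε s) = (s * (1 - ε ^ 2 * P ε s)) ^ 2 := by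
  have hs : √(1 + (ε * s) ^ 2) ^ 2 = 1 + (ε * s) ^ 2 := Real.sq_sqrt (by positivity)
  have hp : 0 < √(1 + (ε * s) ^ 2) := by positivity
  rw [P_eq hε]
  generalize √(1 + (ε * s) ^ 2) = w at hs hp
  field_simp
  linear_combination hs

lemma speed_P {ε s : ℝ} (hε : ε ≠ 0) (hs : 0 ≤ s) : speed ε (P ε s) = s := by
  have h := one_sub_P_pos hε s
  rw [speed, P_mul_two_sub hε, Real.sqrt_sq (by positivity)]
  field_simp

/-- `P ε` saturates below 1/ε², so it controls s² only for bounded slopes; this is why S enters. The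
bound serves to show that equilibria are not reached in finite time. -/
lemma sq_le_of_P {ε s S : ℝ} (hε : ε ≠ 0) (hs : 0 ≤ s) (hS : s ≤ S) :
    s ^ 2 ≤ 2 * (1 + (ε * S) ^ 2) * P ε s := by
  have h1 := P_mul_two_sub hε s
  have h0 := P_nonneg hε s
  have h2 : (1 - ε ^ 2 * P ε s) ^ 2 * (1 + (ε * s) ^ 2) = 1 := by
    have hq : √(1 + (ε * s) ^ 2) ^ 2 = 1 + (ε * s) ^ 2 := Real.sq_sqrt (by positivity)
    have hp : 0 < √(1 + (ε * s) ^ 2) := by positivity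
    rw [P_eq hε, ← mul_assoc, mul_inv_cancel₀ (by positivity)]
    simp only [one_mul, sub_sub_cancel]
    generalize √(1 + (ε * s) ^ 2) = w at hq hp
    rw [← hq]
    field_simp
  have h3 : s ^ 2 = P ε s * (2 - ε ^ 2 * P ε s) * (1 + (ε * s) ^ 2) := by
    rw [h1]; linear_combination -(s ^ 2) * h2
  have h4 : (ε * s) ^ 2 ≤ (ε * S) ^ 2 := by
    rw [mul_pow, mul_pow]
    gcongr
  rw [h3]
  calc P ε s * (2 - ε ^ 2 * P ε s) * (1 + (ε * s) ^ 2)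
      ≤ P ε s * 2 * (1 + (ε * S) ^ 2) := by
        gcongr
        have : 0 ≤ ε ^ 2 * P ε s := by positivity
        linarith
    _ = _ := by ring

/-- The numerator collapses because (1 − κq)² + κ · q(2 − κq) = 1. -/
lemma hasDerivAt_recip {κ q : ℝ} (hq : 0 < q) (h : κ * q < 2) :
    HasDerivAt (recip κ) (-(√(q * (2 - κ * q)))⁻¹ ^ 3) q := by
  have hy : 0 < q * (2 - κ * q) := mul_pos hq (by linarith)
  have hs : √(q * (2 - κ * q)) ^ 2 = q * (2 - κ * q) := Real.sq_sqrt hy.le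
  have hp : 0 < √(q * (2 - κ * q)) := Real.sqrt_pos.2 hy
  have h1 : HasDerivAt (fun q : ℝ => κ * q) κ q := by
    simpa using (hasDerivAt_id q).const_mul κ
  have h2 : HasDerivAt (fun q : ℝ => q * (2 - κ * q)) (1 * (2 - κ * q) + q * (-κ)) q :=
    (hasDerivAt_id q).mul (h1.const_sub 2)
  have h3 := (h1.const_sub 1).div (h2.sqrt hy.ne') hp.ne'
  refine h3.congr_deriv ?_
  generalize √(q * (2 - κ * q)) = w at hs hp
  field_simp
  linear_combination (-2 * κ) * hs

/-- The choice κ = ε²m² lets the factor m, later sin φ cos φ, cancel exactly; what remains of dz/z'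
is regular at the turning points. -/
lemma recip_mul_speed {ε m q : ℝ} (hm : 0 < m) (hq : 0 < q) (h : ε ^ 2 * (m ^ 2 * q) < 1) :
    recip (ε ^ 2 * m ^ 2) q * speed ε (m ^ 2 * q) = m := by
  have hy : 0 < q * (2 - ε ^ 2 * m ^ 2 * q) := mul_pos hq (by linarith)
  have h1 : 0 < 1 - ε ^ 2 * m ^ 2 * q := by linarith
  have h2 : m ^ 2 * q * (2 - ε ^ 2 * (m ^ 2 * q)) = m ^ 2 * (q * (2 - ε ^ 2 * m ^ 2 * q)) := by
    ring
  rw [recip, speed, h2, Real.sqrt_mul (sq_nonneg m), Real.sqrt_sq hm.le, ← mul_assoc (ε ^ 2)]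
  have hp : 0 < √(q * (2 - ε ^ 2 * m ^ 2 * q)) := Real.sqrt_pos.2 hy
  field_simp

lemma recip_pos {κ q : ℝ} (hq : 0 < q) (h : κ * q < 1) : 0 < recip κ q :=
  div_pos (by linarith) (Real.sqrt_pos.2 (mul_pos hq (by linarith)))

lemma inv_sqrt_le_recip {κ q : ℝ} (hq : 0 < q) (hκ : 0 ≤ κ) (h : κ * q ≤ 1 / 2) :
    (√q)⁻¹ ≤ 4 * recip κ q := by
  have h0 : 0 ≤ κ * q := by positivity
  have h1 : 0 < √q := Real.sqrt_pos.2 hq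
  have h2 : √(q * (2 - κ * q)) ≤ 2 * √q := by
    rw [show 2 * √q = √(q * 4) by
      rw [Real.sqrt_mul hq.le, show (4 : ℝ) = 2 ^ 2 by norm_num, Real.sqrt_sq (by norm_num)]
      ring]
    apply Real.sqrt_le_sqrt
    gcongr
    linarith
  have h3 : 0 < √(q * (2 - κ * q)) := Real.sqrt_pos.2 (mul_pos hq (by linarith))
  rw [recip, mul_div_assoc', inv_eq_one_div, div_le_div_iff₀ h1 h3]
  nlinarith

lemma recip_le_inv_sqrt {κ q : ℝ} (hq : 0 < q) (hκ : 0 ≤ κ) (h : κ * q ≤ 1) :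
    recip κ q ≤ (√q)⁻¹ := by
  have h0 : 0 ≤ κ * q := by positivity
  have h2 : √q ≤ √(q * (2 - κ * q)) := Real.sqrt_le_sqrt (by nlinarith)
  rw [recip, inv_eq_one_div]
  exact div_le_div₀ zero_le_one (by linarith) (Real.sqrt_pos.2 hq) h2

/-- Mean value inequality: between q and q' one has κy ≤ 1, hence y(2 − κy) ≥ y, which bounds the
derivative of `recip κ`. -/
lemma abs_recip_sub_le {κ q q' : ℝ} (hκ : 0 ≤ κ) (hq : 0 < q) (hq' : 0 < q') (h : κ * q ≤ 1)
    (h' : κ * q' ≤ 1) :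
    |recip κ q - recip κ q'| ≤ |q - q'| * (√(min q q'))⁻¹ ^ 3 := by
  have hm : 0 < min q q' := lt_min hq hq'
  have hsub : uIcc q' q ⊆ {y | min q q' ≤ y ∧ κ * y ≤ 1} := by
    intro y hy
    rw [uIcc_comm] at hy
    refine ⟨hy.1, ?_⟩
    have : y ≤ max q q' := hy.2
    rcases le_max_iff.1 this with h1 | h1 <;> nlinarith
  have := (convex_uIcc q' q).norm_image_sub_le_of_norm_hasDerivWithin_le
    (f := recip κ) (f' := fun y => -(√(y * (2 - κ * y)))⁻¹ ^ 3) (C := (√(min q q'))⁻¹ ^ 3)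
    (fun y hy => (hasDerivAt_recip (hm.trans_le (hsub hy).1)
      (by have := (hsub hy).2; linarith)).hasDerivWithinAt)
    (fun y hy => ?_) left_mem_uIcc right_mem_uIcc
  · simpa only [Real.norm_eq_abs, mul_comm] using this
  · obtain ⟨h1, h2⟩ := hsub hy
    rw [norm_neg, Real.norm_eq_abs, abs_of_nonneg (by positivity)]
    have h3 : √(min q q') ≤ √(y * (2 - κ * y)) := by
      apply Real.sqrt_le_sqrt
      nlinarith
    have : 0 < √(min q q') := Real.sqrt_pos.2 hm
    gcongr

/-! ### Profiles and the weighted travel times. -/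

/-- A continuous function on `[0, 1]` comparable with `t (1 - t)`. -/
structure IsProfile (c C : ℝ) (n : ℝ → ℝ) : Prop where
  cont : ContinuousOn n (Icc 0 1)
  lower : ∀ t ∈ Icc (0 : ℝ) 1, c * (t * (1 - t)) ≤ n t
  upper : ∀ t ∈ Icc (0 : ℝ) 1, n t ≤ C * (t * (1 - t))

lemma IsProfile.reflect {c C : ℝ} {n : ℝ → ℝ} (h : IsProfile c C n) :
    IsProfile c C fun t => n (1 - t) := by
  have hm : MapsTo (fun t : ℝ => 1 - t) (Icc 0 1) (Icc 0 1) :=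
    fun t ht => ⟨by linarith [ht.2], by linarith [ht.1]⟩
  refine ⟨h.cont.comp (by fun_prop) hm, fun t ht => ?_, fun t ht => ?_⟩
  · have := h.lower _ (hm ht); ring_nf at this ⊢; linarith
  · have := h.upper _ (hm ht); ring_nf at this ⊢; linarith

/-- The gap of the Gibbs function at `t = sin² φ`, divided by `t (1 - t)`. -/
def flux (n : ℝ → ℝ) (a b φ : ℝ) : ℝ :=
  a * Real.cos φ ^ 2 + b * Real.sin φ ^ 2 + n (Real.sin φ ^ 2)

/-- The reciprocal of the normalised speed along a profile. -/
def slowness (ε : ℝ) (n : ℝ → ℝ) (a b φ : ℝ) : ℝ :=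
  recip (ε ^ 2 * (Real.sin φ * Real.cos φ) ^ 2) (flux n a b φ)

/-- The normalised time weighted towards the left end. -/
def leftTime (ε : ℝ) (n : ℝ → ℝ) (a b : ℝ) : ℝ :=
  ∫ φ in (0 : ℝ)..(Real.pi / 2), Real.cos φ ^ 2 * slowness ε n a b φ

/-- The normalised time weighted towards the right end. -/
def rightTime (ε : ℝ) (n : ℝ → ℝ) (a b : ℝ) : ℝ :=
  ∫ φ in (0 : ℝ)..(Real.pi / 2), Real.sin φ ^ 2 * slowness ε n a b φ

lemma flux_reflect (n : ℝ → ℝ) (a b φ : ℝ) :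
    flux (fun t => n (1 - t)) b a (Real.pi / 2 - φ) = flux n a b φ := by
  simp only [flux, Real.cos_pi_div_two_sub, Real.sin_pi_div_two_sub]
  rw [show 1 - Real.cos φ ^ 2 = Real.sin φ ^ 2 by linarith [Real.sin_sq_add_cos_sq φ]]
  ring

/-- The reflection φ ↦ π/2 − φ exchanges the two ends, so only left times need to be analysed. -/
lemma rightTime_eq (ε : ℝ) (n : ℝ → ℝ) (a b : ℝ) :
    rightTime ε n a b = leftTime ε (fun t => n (1 - t)) b a := by
  have := intervalIntegral.integral_comp_sub_left (a := 0) (b := Real.pi / 2)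
    (fun φ => Real.cos φ ^ 2 * slowness ε (fun t => n (1 - t)) b a φ) (Real.pi / 2)
  rw [sub_self, sub_zero] at this
  rw [leftTime, ← this, rightTime]
  simp only [slowness, flux_reflect, Real.cos_pi_div_two_sub, Real.sin_pi_div_two_sub]
  simp only [mul_comm]

section

variable {c C ε a b φ : ℝ} {n : ℝ → ℝ}

lemma sin_sq_mem (φ : ℝ) : Real.sin φ ^ 2 ∈ Icc (0 : ℝ) 1 :=
  ⟨sq_nonneg _, by nlinarith [Real.sin_sq_add_cos_sq φ, sq_nonneg (Real.cos φ)]⟩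

lemma one_sub_sin_sq (φ : ℝ) : 1 - Real.sin φ ^ 2 = Real.cos φ ^ 2 := by
  linarith [Real.sin_sq_add_cos_sq φ]

lemma IsProfile.lower_sin (h : IsProfile c C n) (φ : ℝ) :
    c * (Real.sin φ * Real.cos φ) ^ 2 ≤ n (Real.sin φ ^ 2) := by
  have := h.lower _ (sin_sq_mem φ)
  rwa [one_sub_sin_sq, ← mul_pow] at this

lemma IsProfile.upper_sin (h : IsProfile c C n) (φ : ℝ) :
    n (Real.sin φ ^ 2) ≤ C * (Real.sin φ * Real.cos φ) ^ 2 := by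
  have := h.upper _ (sin_sq_mem φ)
  rwa [one_sub_sin_sq, ← mul_pow] at this

lemma IsProfile.continuous_flux (h : IsProfile c C n) : Continuous (flux n a b) := by
  have h1 : Continuous fun φ => n (Real.sin φ ^ 2) :=
    h.cont.comp_continuous (by fun_prop) sin_sq_mem
  exact (by fun_prop :
    Continuous fun φ => a * Real.cos φ ^ 2 + b * Real.sin φ ^ 2).add h1

lemma IsProfile.flux_pos (h : IsProfile c C n) (hc : 0 < c) (ha : 0 < a) (hb : 0 < b) (φ : ℝ) :
    0 < flux n a b φ := by
  have h1 := h.lower_sin φ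
  have h2 : 0 ≤ c * (Real.sin φ * Real.cos φ) ^ 2 := by positivity
  have h3 := Real.sin_sq_add_cos_sq φ
  have : 0 < a * Real.cos φ ^ 2 + b * Real.sin φ ^ 2 := by
    rcases eq_or_ne (Real.cos φ) 0 with h0 | h0
    · rw [h0] at h3 ⊢
      have : Real.sin φ ^ 2 = 1 := by linarith
      rw [this]; simpa using hb
    · positivity
  unfold flux
  linarith

lemma sin_mul_cos_sq_le_one (φ : ℝ) : (Real.sin φ * Real.cos φ) ^ 2 ≤ 1 := by
  rw [mul_pow]
  exact mul_le_one₀ (Real.sin_sq_le_one φ) (sq_nonneg _) (Real.cos_sq_le_one φ)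

lemma IsProfile.flux_le (h : IsProfile c C n) (hC : 0 ≤ C) (ha : 0 ≤ a) (hb : 0 ≤ b) (φ : ℝ) :
    flux n a b φ ≤ a + b + C := by
  have h1 := h.upper_sin φ
  have h2 := mul_le_of_le_one_right hC (sin_mul_cos_sq_le_one φ)
  have h3 := mul_le_of_le_one_right ha (Real.cos_sq_le_one φ)
  have h4 := mul_le_of_le_one_right hb (Real.sin_sq_le_one φ)
  unfold flux
  linarith

/-- This keeps ε² times the gap away from the saturation value of `P ε`, uniformly in φ. -/
lemma IsProfile.mul_flux_le (h : IsProfile c C n) (hc : 0 < c) (hC : 0 ≤ C) (ha : 0 < a)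
    (hb : 0 < b) (ε φ : ℝ) :
    ε ^ 2 * (Real.sin φ * Real.cos φ) ^ 2 * flux n a b φ ≤ ε ^ 2 * (a + b + C) := by
  have h1 := h.flux_le hC ha.le hb.le φ
  have h2 := h.flux_pos hc ha hb φ
  have h3 := sin_mul_cos_sq_le_one φ
  rw [mul_assoc]
  have : (Real.sin φ * Real.cos φ) ^ 2 * flux n a b φ ≤ flux n a b φ :=
    mul_le_of_le_one_left h2.le h3
  gcongr
  linarith

lemma IsProfile.continuous_slowness (h : IsProfile c C n) (hc : 0 < c) (hC : 0 ≤ C) (ha : 0 < a)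
    (hb : 0 < b) (hε : ε ^ 2 * (a + b + C) ≤ 1) : Continuous (slowness ε n a b) := by
  have h1 : Continuous (flux n a b) := h.continuous_flux
  unfold slowness recip
  refine Continuous.div (by fun_prop) (by fun_prop) fun φ => ?_
  have h2 := h.mul_flux_le hc hC ha hb ε φ
  exact (Real.sqrt_pos.2 (mul_pos (h.flux_pos hc ha hb φ) (by linarith))).ne'

lemma IsProfile.slowness_pos (h : IsProfile c C n) (hc : 0 < c) (hC : 0 ≤ C) (ha : 0 < a)
    (hb : 0 < b) (hε : ε ^ 2 * (a + b + C) < 1) (φ : ℝ) : 0 < slowness ε n a b φ :=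
  recip_pos (h.flux_pos hc ha hb φ) ((h.mul_flux_le hc hC ha hb ε φ).trans_lt hε)

lemma IsProfile.leftTime_nonneg (h : IsProfile c C n) (hc : 0 < c) (hC : 0 ≤ C) (ha : 0 < a)
    (hb : 0 < b) (hε : ε ^ 2 * (a + b + C) < 1) : 0 ≤ leftTime ε n a b :=
  intervalIntegral.integral_nonneg (by positivity) fun φ _ =>
    mul_nonneg (sq_nonneg _) (h.slowness_pos hc hC ha hb hε φ).le

lemma cos_le_sqrt (φ : ℝ) (ha : 0 ≤ a) {q : ℝ}
    (h : a * Real.cos φ ^ 2 ≤ q) : Real.cos φ * √a ≤ √q := by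
  refine Real.le_sqrt_of_sq_le ?_
  rw [mul_pow, Real.sq_sqrt ha]
  linarith

lemma cos_nonneg_of_mem (hφ : φ ∈ Icc 0 (Real.pi / 2)) : 0 ≤ Real.cos φ :=
  Real.cos_nonneg_of_mem_Icc ⟨by linarith [hφ.1, Real.pi_pos], hφ.2⟩

/-- Since the flux is at least a cos²φ, one factor cos φ of the weight compensates its possible
smallness at the right end. The bound is therefore independent of b. -/
lemma IsProfile.leftTime_le (h : IsProfile c C n) (hc : 0 < c) (hC : 0 ≤ C) (ha : 0 < a)
    (hb : 0 < b) (hε : ε ^ 2 * (a + b + C) ≤ 1) : leftTime ε n a b ≤ Real.pi / 2 * (√a)⁻¹ := by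
  have hpi := Real.pi_pos
  have hs : 0 < √a := Real.sqrt_pos.2 ha
  have hcont := h.continuous_slowness hc hC ha hb hε
  calc leftTime ε n a b ≤ ∫ _φ in (0 : ℝ)..(Real.pi / 2), (√a)⁻¹ := by
        refine intervalIntegral.integral_mono_on (by positivity)
          (Continuous.intervalIntegrable (by fun_prop) _ _)
          intervalIntegrable_const fun φ hφ => ?_
        have hco := cos_nonneg_of_mem hφ
        have hq := h.flux_pos hc ha hb φ
        have hsq : 0 < √(flux n a b φ) := Real.sqrt_pos.2 hq
        have h1 := h.lower_sin φ
        have h2 : 0 ≤ c * (Real.sin φ * Real.cos φ) ^ 2 := by positivity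
        have h3 : Real.cos φ * √a ≤ √(flux n a b φ) := by
          apply cos_le_sqrt φ ha.le
          unfold flux
          nlinarith [sq_nonneg (Real.sin φ)]
        have h4 : slowness ε n a b φ ≤ (√(flux n a b φ))⁻¹ :=
          recip_le_inv_sqrt hq (by positivity) ((h.mul_flux_le hc hC ha hb ε φ).trans hε)
        calc Real.cos φ ^ 2 * slowness ε n a b φ
            ≤ Real.cos φ ^ 2 * (√(flux n a b φ))⁻¹ := by gcongr
          _ ≤ Real.cos φ * (√(flux n a b φ))⁻¹ := by
            gcongr
            nlinarith [Real.cos_le_one φ]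
          _ ≤ (√a)⁻¹ := by
            rw [← div_eq_mul_inv, div_le_iff₀ hsq, inv_mul_eq_div, le_div_iff₀ hs]
            exact h3
    _ = _ := by simp

/-- Sensitivity of the left time to the right end and to the profile. -/
lemma IsProfile.abs_leftTime_sub_le {n' : ℝ → ℝ} {b' D : ℝ} (h : IsProfile c C n)
    (h' : IsProfile c C n') (hc : 0 < c) (hC : 0 ≤ C) (ha : 0 < a) (hb : 0 < b) (hb' : 0 < b')
    (hε : ε ^ 2 * (a + b + C) ≤ 1 / 2) (hε' : ε ^ 2 * (a + b' + C) ≤ 1 / 2)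
    (hD : ∀ t ∈ Icc (0 : ℝ) 1, |n t - n' t| ≤ D * (t * (1 - t))) :
    |leftTime ε n a b - leftTime ε n' a b'| ≤
      4 * c⁻¹ * (|b - b'| + D) *
        (leftTime ε n a b + rightTime ε n a b + leftTime ε n' a b' + rightTime ε n' a b') := by
  have hpi := Real.pi_pos
  have hc1 := h.continuous_slowness (ε := ε) hc hC ha hb (by linarith)
  have hc2 := h'.continuous_slowness (ε := ε) hc hC ha hb' (by linarith)
  have hsum : ∀ {m : ℝ → ℝ} {β : ℝ}, Continuous (slowness ε m a β) →
      leftTime ε m a β + rightTime ε m a β =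
        ∫ φ in (0 : ℝ)..(Real.pi / 2), slowness ε m a β φ := by
    intro m β hm
    rw [leftTime, rightTime, ← intervalIntegral.integral_add
      (Continuous.intervalIntegrable (by fun_prop) _ _)
      (Continuous.intervalIntegrable (by fun_prop) _ _)]
    refine intervalIntegral.integral_congr fun φ _ => ?_
    rw [← add_mul, Real.cos_sq_add_sin_sq, one_mul]
  rw [add_assoc, hsum hc1, hsum hc2, ← intervalIntegral.integral_add
      (Continuous.intervalIntegrable (by fun_prop) _ _)
      (Continuous.intervalIntegrable (by fun_prop) _ _), ← intervalIntegral.integral_const_mul,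
      leftTime, leftTime, ← intervalIntegral.integral_sub
      (Continuous.intervalIntegrable (by fun_prop) _ _)
      (Continuous.intervalIntegrable (by fun_prop) _ _), ← Real.norm_eq_abs]
  refine intervalIntegral.norm_integral_le_of_norm_le (by positivity) ?_
    (Continuous.intervalIntegrable (by fun_prop) _ _)
  refine Eventually.of_forall fun φ _ => ?_
  set q := flux n a b φ with hq
  set q' := flux n' a b' φ with hq'
  have q0 : 0 < q := h.flux_pos hc ha hb φ
  have q0' : 0 < q' := h'.flux_pos hc ha hb' φ
  have hm : 0 < min q q' := lt_min q0 q0'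
  have l1 := h.lower_sin φ
  have l2 := h'.lower_sin φ
  have k1 := (h.mul_flux_le hc hC ha hb ε φ).trans hε
  have k2 := (h'.mul_flux_le hc hC ha hb' ε φ).trans hε'
  have hκ : 0 ≤ ε ^ 2 * (Real.sin φ * Real.cos φ) ^ 2 := by positivity
  have hdn : |n (Real.sin φ ^ 2) - n' (Real.sin φ ^ 2)| ≤ D * (Real.sin φ * Real.cos φ) ^ 2 := by
    have := hD _ (sin_sq_mem φ)
    rwa [one_sub_sin_sq, ← mul_pow] at this
  have hmin : c * (Real.sin φ * Real.cos φ) ^ 2 ≤ min q q' := by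
    refine le_min (l1.trans ?_) (l2.trans ?_)
    · rw [hq, flux]; nlinarith [mul_nonneg ha.le (sq_nonneg (Real.cos φ)),
        mul_nonneg hb.le (sq_nonneg (Real.sin φ))]
    · rw [hq', flux]; nlinarith [mul_nonneg ha.le (sq_nonneg (Real.cos φ)),
        mul_nonneg hb'.le (sq_nonneg (Real.sin φ))]
  have hdq : |q - q'| ≤ |b - b'| * Real.sin φ ^ 2 + D * (Real.sin φ * Real.cos φ) ^ 2 := by
    have : q - q' = (b - b') * Real.sin φ ^ 2 + (n (Real.sin φ ^ 2) - n' (Real.sin φ ^ 2)) := by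
      rw [hq, hq', flux, flux]; ring
    rw [this]
    refine (abs_add_le _ _).trans (add_le_add ?_ hdn)
    rw [abs_mul, abs_of_nonneg (sq_nonneg (Real.sin φ))]
  -- The weight cos²φ upgrades the b-contribution |b − b'| sin²φ to a multiple of (sin φ cos φ)²,
  -- which the lower profile bound dominates by both fluxes.
  have hcq : Real.cos φ ^ 2 * |q - q'| ≤ (|b - b'| + D) * (c⁻¹ * min q q') := by
    have hD1 : 0 ≤ D := by
      have := (abs_nonneg _).trans (hD (1 / 2) ⟨by norm_num, by norm_num⟩)
      linarith
    have hD0 : 0 ≤ D * (Real.sin φ * Real.cos φ) ^ 2 := (abs_nonneg _).trans hdn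
    have e1 : Real.cos φ ^ 2 * |q - q'| ≤ (|b - b'| + D) * (Real.sin φ * Real.cos φ) ^ 2 := by
      calc Real.cos φ ^ 2 * |q - q'|
          ≤ Real.cos φ ^ 2 * (|b - b'| * Real.sin φ ^ 2 + D * (Real.sin φ * Real.cos φ) ^ 2) := by
            gcongr
        _ = |b - b'| * (Real.sin φ * Real.cos φ) ^ 2 +
            Real.cos φ ^ 2 * (D * (Real.sin φ * Real.cos φ) ^ 2) := by ring
        _ ≤ |b - b'| * (Real.sin φ * Real.cos φ) ^ 2 + D * (Real.sin φ * Real.cos φ) ^ 2 := by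
            exact add_le_add le_rfl (mul_le_of_le_one_left hD0 (Real.cos_sq_le_one φ))
        _ = _ := by ring
    refine e1.trans ?_
    gcongr
    rw [inv_mul_eq_div, le_div_iff₀ hc]
    linarith
  have h1 := abs_recip_sub_le hκ q0 q0' (k1.trans (by norm_num)) (k2.trans (by norm_num))
  have h2 : (√(min q q'))⁻¹ ≤ (√q)⁻¹ + (√q')⁻¹ := by
    rcases min_choice q q' with h3 | h3 <;> rw [h3]
    · linarith [inv_nonneg.2 (Real.sqrt_nonneg q')]
    · linarith [inv_nonneg.2 (Real.sqrt_nonneg q)]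
  have h3 := inv_sqrt_le_recip q0 hκ k1
  have h4 := inv_sqrt_le_recip q0' hκ k2
  -- The derivative of `recip` costs the power −3/2 of the flux. The factor min q q' gained above
  -- leaves the power −1/2, which is comparable with the slowness itself and so integrates to the
  -- total times.
  have hsm : min q q' * (√(min q q'))⁻¹ ^ 3 = (√(min q q'))⁻¹ := by
    have := Real.sqrt_pos.2 hm
    nth_rewrite 1 [← Real.sq_sqrt hm.le]
    field_simp
  have hbD : 0 ≤ |b - b'| + D := by
    have := (abs_nonneg _).trans (hD (1 / 2) ⟨by norm_num, by norm_num⟩)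
    have := abs_nonneg (b - b')
    linarith
  rw [← mul_sub, Real.norm_eq_abs, abs_mul, abs_of_nonneg (sq_nonneg (Real.cos φ))]
  change Real.cos φ ^ 2 * |recip _ q - recip _ q'| ≤ _ * (recip _ q + recip _ q')
  calc Real.cos φ ^ 2 * |recip _ q - recip _ q'|
      ≤ Real.cos φ ^ 2 * (|q - q'| * (√(min q q'))⁻¹ ^ 3) := by gcongr
    _ = Real.cos φ ^ 2 * |q - q'| * (√(min q q'))⁻¹ ^ 3 := by ring
    _ ≤ (|b - b'| + D) * (c⁻¹ * min q q') * (√(min q q'))⁻¹ ^ 3 := by gcongr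
    _ = c⁻¹ * (|b - b'| + D) * (min q q' * (√(min q q'))⁻¹ ^ 3) := by ring
    _ = c⁻¹ * (|b - b'| + D) * (√(min q q'))⁻¹ := by rw [hsm]
    _ ≤ c⁻¹ * (|b - b'| + D) * (4 * recip (ε ^ 2 * (Real.sin φ * Real.cos φ) ^ 2) q +
          4 * recip (ε ^ 2 * (Real.sin φ * Real.cos φ) ^ 2) q') := by
        gcongr
        linarith
    _ = _ := by ring

end

/-! ### Logarithmic asymptotics of the left time. -/

/-- Minus the derivative of `leftTime` with respect to the left parameter. -/
def leftRate (ε : ℝ) (n : ℝ → ℝ) (a b : ℝ) : ℝ :=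
  ∫ φ in (0 : ℝ)..(Real.pi / 2), Real.cos φ ^ 4 * (√(flux n a b φ *
    (2 - ε ^ 2 * (Real.sin φ * Real.cos φ) ^ 2 * flux n a b φ)))⁻¹ ^ 3

/-- Applied with x = cos φ: three of the four cosines in `leftRate` absorb the factor cos φ
contained in the lower bound of the radicand, and one survives to make the integral explicit. -/
lemma pow_mul_inv_pow_le {x u w : ℝ} (hx : 0 ≤ x) (hu : 0 < u) (hw : 0 < w) (h : x * u ≤ w) :
    x ^ 4 * w⁻¹ ^ 3 ≤ x * u⁻¹ ^ 3 := by
  have h1 : x * w⁻¹ ≤ u⁻¹ := by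
    rwa [← div_eq_mul_inv, div_le_iff₀ hw, inv_mul_eq_div, le_div_iff₀ hu]
  calc x ^ 4 * w⁻¹ ^ 3 = x * (x * w⁻¹) ^ 3 := by ring
    _ ≤ x * u⁻¹ ^ 3 := by gcongr

lemma le_pow_mul_inv_pow {x u w : ℝ} (hx : 0 ≤ x) (hu : 0 < u) (hw : 0 < w) (h : w ≤ x * u) :
    x * u⁻¹ ^ 3 ≤ x ^ 4 * w⁻¹ ^ 3 := by
  have h1 : u⁻¹ ≤ x * w⁻¹ := by
    rwa [← div_eq_mul_inv, le_div_iff₀ hw, inv_mul_eq_div, div_le_iff₀ hu]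
  calc x * u⁻¹ ^ 3 ≤ x * (x * w⁻¹) ^ 3 := by gcongr
    _ = _ := by ring

/-- The model integral with an explicit primitive. For fixed Y the right-hand side tends to 1/√A as
a → 0 when A and sin Y are positive; this is the source of the logarithmic rate. -/
lemma integral_cos_mul_inv_sqrt {a A : ℝ} (ha : 0 < a) (hA : 0 ≤ A) (Y : ℝ) :
    a * ∫ φ in (0 : ℝ)..Y, Real.cos φ * (√(a + A * Real.sin φ ^ 2))⁻¹ ^ 3 =
      Real.sin Y * (√(a + A * Real.sin Y ^ 2))⁻¹ := by
  have hp : ∀ φ : ℝ, 0 < a + A * Real.sin φ ^ 2 := fun φ => by positivity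
  have hs : ∀ φ : ℝ, 0 < √(a + A * Real.sin φ ^ 2) := fun φ => Real.sqrt_pos.2 (hp φ)
  rw [← intervalIntegral.integral_const_mul]
  have hd : ∀ φ : ℝ, HasDerivAt (fun φ => Real.sin φ * (√(a + A * Real.sin φ ^ 2))⁻¹)
      (a * (Real.cos φ * (√(a + A * Real.sin φ ^ 2))⁻¹ ^ 3)) φ := by
    intro φ
    have h1 := ((((Real.hasDerivAt_sin φ).pow 2).const_mul A).const_add a).sqrt (hp φ).ne'
    refine ((Real.hasDerivAt_sin φ).mul (h1.inv (hs φ).ne')).congr_deriv ?_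
    have h2 := Real.sq_sqrt (hp φ).le
    have h3 := hs φ
    simp only [Pi.pow_apply, Pi.inv_apply] at h2 h3 ⊢
    generalize √(a + A * Real.sin φ ^ 2) = w at h2 h3
    field_simp
    rw [h2]
    ring
  rw [intervalIntegral.integral_eq_sub_of_hasDerivAt (fun φ _ => hd φ)]
  · simp
  · refine Continuous.intervalIntegrable ?_ _ _
    have : Continuous fun φ => (√(a + A * Real.sin φ ^ 2))⁻¹ :=
      Continuous.inv₀ (by fun_prop) fun φ => (hs φ).ne'
    fun_prop

section

variable {c C ε a b : ℝ} {n : ℝ → ℝ}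

lemma IsProfile.radicand_pos (h : IsProfile c C n) (hc : 0 < c) (hC : 0 ≤ C) (ha : 0 < a)
    (hb : 0 < b) (hε : ε ^ 2 * (a + b + C) ≤ 1) (φ : ℝ) :
    0 < √(flux n a b φ * (2 - ε ^ 2 * (Real.sin φ * Real.cos φ) ^ 2 * flux n a b φ)) :=
  Real.sqrt_pos.2 (mul_pos (h.flux_pos hc ha hb φ)
    (by linarith [h.mul_flux_le hc hC ha hb ε φ]))

lemma IsProfile.continuous_rate (h : IsProfile c C n) (hc : 0 < c) (hC : 0 ≤ C) (ha : 0 < a)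
    (hb : 0 < b) (hε : ε ^ 2 * (a + b + C) ≤ 1) :
    Continuous fun φ => Real.cos φ ^ 4 * (√(flux n a b φ *
      (2 - ε ^ 2 * (Real.sin φ * Real.cos φ) ^ 2 * flux n a b φ)))⁻¹ ^ 3 := by
  have h1 : Continuous (flux n a b) := h.continuous_flux
  have : Continuous fun φ => (√(flux n a b φ *
      (2 - ε ^ 2 * (Real.sin φ * Real.cos φ) ^ 2 * flux n a b φ)))⁻¹ :=
    Continuous.inv₀ (by fun_prop) fun φ => (h.radicand_pos hc hC ha hb hε φ).ne'
  fun_prop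

lemma IsProfile.hasDerivAt_leftTime (h : IsProfile c C n) (hc : 0 < c) (hC : 0 ≤ C) (ha : 0 < a)
    (hb : 0 < b) (hε : ε ^ 2 * (a + b + C) < 1) :
    HasDerivAt (fun a => leftTime ε n a b) (-leftRate ε n a b) a := by
  have hpi := Real.pi_pos
  -- Staying above a/2 makes the derivative of the integrand bounded by (a/2)^(-3/2), a constant
  -- dominating function.
  have hs : {y : ℝ | a / 2 < y ∧ ε ^ 2 * (y + b + C) < 1} ∈ 𝓝 a := by
    refine IsOpen.mem_nhds ?_ ⟨by linarith, hε⟩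
    exact (isOpen_lt continuous_const continuous_id).inter (isOpen_lt
      (by fun_prop : Continuous fun y : ℝ => ε ^ 2 * (y + b + C)) continuous_const)
  have key := (intervalIntegral.hasDerivAt_integral_of_dominated_loc_of_deriv_le
    (μ := MeasureTheory.volume) (a := 0) (b := Real.pi / 2)
    (F := fun y φ => Real.cos φ ^ 2 * slowness ε n y b φ)
    (F' := fun y φ => -(Real.cos φ ^ 4 * (√(flux n y b φ *
      (2 - ε ^ 2 * (Real.sin φ * Real.cos φ) ^ 2 * flux n y b φ)))⁻¹ ^ 3))
    (bound := fun _ => 1 * (√(a / 2))⁻¹ ^ 3) hs ?_ ?_ ?_ ?_ ?_ ?_).2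
  · rwa [intervalIntegral.integral_neg] at key
  · filter_upwards [hs] with y hy
    have := h.continuous_slowness hc hC (by linarith [hy.1]) hb hy.2.le
    exact (by fun_prop : Continuous fun φ => Real.cos φ ^ 2 * slowness ε n y b φ).aestronglyMeasurable
  · have := h.continuous_slowness hc hC ha hb hε.le
    exact Continuous.intervalIntegrable (by fun_prop) _ _
  · exact (h.continuous_rate hc hC ha hb hε.le).neg.aestronglyMeasurable
  · refine Eventually.of_forall fun φ hφ y hy => ?_
    rw [uIoc_of_le (by positivity)] at hφ
    have hco := cos_nonneg_of_mem ⟨hφ.1.le, hφ.2⟩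
    have hy0 : 0 < y := by linarith [hy.1]
    have h2 := h.radicand_pos hc hC hy0 hb hy.2.le φ
    have h3 := h.lower_sin φ
    have h4 : 0 ≤ c * (Real.sin φ * Real.cos φ) ^ 2 := by positivity
    have h5 := h.mul_flux_le hc hC hy0 hb ε φ
    rw [norm_neg, Real.norm_eq_abs, abs_of_nonneg (by positivity)]
    refine (pow_mul_inv_pow_le hco (Real.sqrt_pos.2 (half_pos ha)) h2 ?_).trans ?_
    · refine cos_le_sqrt φ (half_pos ha).le ?_
      have h6 : y * Real.cos φ ^ 2 ≤ flux n y b φ := by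
        unfold flux
        nlinarith [sq_nonneg (Real.sin φ)]
      have h7 := h.flux_pos hc hy0 hb φ
      have h8 : a / 2 * Real.cos φ ^ 2 ≤ y * Real.cos φ ^ 2 := by
        have := hy.1.le
        gcongr
      nlinarith [hy.2]
    · gcongr
      exact Real.cos_le_one φ
  · exact intervalIntegrable_const
  · refine Eventually.of_forall fun φ _ y hy => ?_
    have hy0 : 0 < y := by linarith [hy.1]
    have h5 := h.mul_flux_le hc hC hy0 hb ε φ
    have h6 : HasDerivAt (fun y => flux n y b φ) (Real.cos φ ^ 2) y := by
      unfold flux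
      simpa using (((hasDerivAt_id y).mul_const (Real.cos φ ^ 2)).add_const
        (b * Real.sin φ ^ 2)).add_const (n (Real.sin φ ^ 2))
    have h7 := (hasDerivAt_recip (κ := ε ^ 2 * (Real.sin φ * Real.cos φ) ^ 2)
      (h.flux_pos hc hy0 hb φ) (by linarith [hy.2])).comp y h6
    refine (h7.const_mul (Real.cos φ ^ 2)).congr_deriv ?_
    ring

lemma cos_pos_of_le {Y φ : ℝ} (hφ : φ ∈ Icc 0 Y) (hY : Y < Real.pi / 2) : 0 < Real.cos φ :=
  Real.cos_pos_of_mem_Ioo ⟨by linarith [hφ.1, Real.pi_pos], by linarith [hφ.2]⟩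

/-- Up to Y the flux is at least cos²φ (a + A sin²φ), which leads to the model integral. Beyond Y it
is at least c sin²Y cos²φ, so that part stays bounded and carries the small factor a. -/
lemma IsProfile.mul_leftRate_le {A Y x₀ : ℝ} (h : IsProfile c C n) (hc : 0 < c) (hC : 0 ≤ C)
    (ha : 0 < a) (hb : 0 < b) (hx₀ : x₀ ≤ 1) (hε : ε ^ 2 * (a + b + C) ≤ x₀) (hA : 0 < A)
    (hY : Y ∈ Ioo 0 (Real.pi / 2))
    (hn : ∀ φ ∈ Icc 0 Y, A * (Real.sin φ * Real.cos φ) ^ 2 ≤ n (Real.sin φ ^ 2)) :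
    a * leftRate ε n a b ≤ (√(2 - x₀))⁻¹ ^ 3 * (√A)⁻¹ +
      a * (Real.pi / 2 * (√(c * Real.sin Y ^ 2))⁻¹ ^ 3) := by
  have hpi := Real.pi_pos
  have hcont := h.continuous_rate hc hC ha hb (hε.trans hx₀)
  have hsinY : 0 < Real.sin Y := Real.sin_pos_of_pos_of_lt_pi hY.1 (by linarith [hY.2])
  have hs : ∀ φ : ℝ, 0 < √(a + A * Real.sin φ ^ 2) := fun φ => Real.sqrt_pos.2 (by positivity)
  have h2x : 0 < √(2 - x₀) := Real.sqrt_pos.2 (by linarith)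
  have hcont' : Continuous fun φ => Real.cos φ * (√(a + A * Real.sin φ ^ 2))⁻¹ ^ 3 := by
    have : Continuous fun φ => (√(a + A * Real.sin φ ^ 2))⁻¹ :=
      Continuous.inv₀ (by fun_prop) fun φ => (hs φ).ne'
    fun_prop
  rw [leftRate, ← intervalIntegral.integral_add_adjacent_intervals
    (hcont.intervalIntegrable 0 Y) (hcont.intervalIntegrable Y (Real.pi / 2)), mul_add]
  have low : ∀ φ, A * (Real.sin φ * Real.cos φ) ^ 2 ≤ n (Real.sin φ ^ 2) →
      (Real.cos φ * √(a + A * Real.sin φ ^ 2)) ^ 2 ≤ flux n a b φ := by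
    intro φ hφ
    rw [mul_pow, Real.sq_sqrt (by positivity), flux]
    nlinarith [mul_nonneg hb.le (sq_nonneg (Real.sin φ))]
  refine add_le_add ?_ ?_
  · calc a * _ ≤ a * ∫ φ in (0 : ℝ)..Y,
          (√(2 - x₀))⁻¹ ^ 3 * (Real.cos φ * (√(a + A * Real.sin φ ^ 2))⁻¹ ^ 3) := by
          refine mul_le_mul_of_nonneg_left (intervalIntegral.integral_mono_on hY.1.le
            (hcont.intervalIntegrable _ _)
            (Continuous.intervalIntegrable (by fun_prop) _ _) fun φ hφ => ?_) ha.le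
          have hco := cos_pos_of_le hφ hY.2
          have h1 := low φ (hn φ hφ)
          have h3 := h.flux_pos hc ha hb φ
          have h4 := (h.mul_flux_le hc hC ha hb ε φ).trans hε
          have h5 := pow_mul_inv_pow_le hco.le (mul_pos (hs φ) h2x)
            (h.radicand_pos hc hC ha hb (hε.trans hx₀) φ) (by
              refine Real.le_sqrt_of_sq_le ?_
              rw [← mul_assoc, mul_pow, Real.sq_sqrt (by linarith)]
              exact mul_le_mul h1 (by linarith) (by linarith) h3.le)
          refine h5.trans (le_of_eq ?_)
          rw [mul_inv]
          ring
      _ = (√(2 - x₀))⁻¹ ^ 3 * (Real.sin Y * (√(a + A * Real.sin Y ^ 2))⁻¹) := by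
          rw [intervalIntegral.integral_const_mul, ← integral_cos_mul_inv_sqrt ha hA.le]
          ring
      _ ≤ _ := by
          gcongr
          rw [← div_eq_mul_inv, div_le_iff₀ (hs Y), inv_mul_eq_div, le_div_iff₀ (Real.sqrt_pos.2 hA)]
          refine Real.le_sqrt_of_sq_le ?_
          rw [mul_pow, Real.sq_sqrt hA.le]
          linarith
  · gcongr
    calc _ ≤ ∫ _φ in Y..(Real.pi / 2), (√(c * Real.sin Y ^ 2))⁻¹ ^ 3 := by
          refine intervalIntegral.integral_mono_on hY.2.le (hcont.intervalIntegrable _ _)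
            intervalIntegrable_const fun φ hφ => ?_
          have hco := cos_nonneg_of_mem ⟨hY.1.le.trans hφ.1, hφ.2⟩
          have hsin : Real.sin Y ≤ Real.sin φ :=
            Real.sin_le_sin_of_le_of_le_pi_div_two (by linarith [hY.1]) hφ.2 hφ.1
          have h3 := h.flux_pos hc ha hb φ
          have h4 := (h.mul_flux_le hc hC ha hb ε φ).trans hε
          have h6 := h.lower_sin φ
          have h7 : c * Real.sin Y ^ 2 ≤ c * Real.sin φ ^ 2 := by gcongr
          have h5 := pow_mul_inv_pow_le hco (Real.sqrt_pos.2 (by positivity : 0 < c * Real.sin Y ^ 2))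
            (h.radicand_pos hc hC ha hb (hε.trans hx₀) φ) (by
              refine cos_le_sqrt φ (by positivity) ?_
              calc c * Real.sin Y ^ 2 * Real.cos φ ^ 2
                  ≤ c * Real.sin φ ^ 2 * Real.cos φ ^ 2 := by gcongr
                _ ≤ n (Real.sin φ ^ 2) := by linarith
                _ ≤ flux n a b φ := by
                  unfold flux
                  nlinarith [mul_nonneg ha.le (sq_nonneg (Real.cos φ)),
                    mul_nonneg hb.le (sq_nonneg (Real.sin φ))]
                _ ≤ _ := by nlinarith)
          refine h5.trans (mul_le_of_le_one_left (by positivity) (Real.cos_le_one φ))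
      _ ≤ _ := by
          rw [intervalIntegral.integral_const, smul_eq_mul]
          gcongr
          linarith [hY.1]

/-- Only [0, Y] is kept. There b sin²φ ≤ B cos²φ sin²φ, so the right slope is absorbed by replacing
A with A + B. The second B comes from a ≤ B sin²Y when the model integral is bounded below. -/
lemma IsProfile.le_mul_leftRate {A B Y : ℝ} (h : IsProfile c C n) (hc : 0 < c) (hC : 0 ≤ C)
    (ha : 0 < a) (hb : 0 < b) (hε : ε ^ 2 * (a + b + C) ≤ 1) (hA : 0 ≤ A)
    (hY : Y ∈ Ioo 0 (Real.pi / 2)) (hB : b ≤ B * Real.cos Y ^ 2) (haB : a ≤ B * Real.sin Y ^ 2)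
    (hn : ∀ φ ∈ Icc 0 Y, n (Real.sin φ ^ 2) ≤ A * (Real.sin φ * Real.cos φ) ^ 2) :
    (√2)⁻¹ ^ 3 * (√(A + 2 * B))⁻¹ ≤ a * leftRate ε n a b := by
  have hpi := Real.pi_pos
  have hcont := h.continuous_rate hc hC ha hb hε
  have hsinY : 0 < Real.sin Y := Real.sin_pos_of_pos_of_lt_pi hY.1 (by linarith [hY.2])
  have hB0 : 0 < B := pos_of_mul_pos_left (ha.trans_le haB) (sq_nonneg _)
  have hs : ∀ φ : ℝ, 0 < √(a + (A + B) * Real.sin φ ^ 2) :=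
    fun φ => Real.sqrt_pos.2 (by positivity)
  have h2x : 0 < √(2 : ℝ) := by positivity
  have hcont' : Continuous fun φ => Real.cos φ * (√(a + (A + B) * Real.sin φ ^ 2))⁻¹ ^ 3 := by
    have : Continuous fun φ => (√(a + (A + B) * Real.sin φ ^ 2))⁻¹ :=
      Continuous.inv₀ (by fun_prop) fun φ => (hs φ).ne'
    fun_prop
  calc (√2)⁻¹ ^ 3 * (√(A + 2 * B))⁻¹
      ≤ (√2)⁻¹ ^ 3 * (Real.sin Y * (√(a + (A + B) * Real.sin Y ^ 2))⁻¹) := by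
        gcongr
        rw [← div_eq_mul_inv (Real.sin Y), le_div_iff₀ (hs Y), inv_mul_eq_div,
          div_le_iff₀ (Real.sqrt_pos.2 (by positivity))]
        refine Real.sqrt_le_iff.2 ⟨by positivity, ?_⟩
        rw [mul_pow, Real.sq_sqrt (by positivity)]
        nlinarith
    _ = a * ∫ φ in (0 : ℝ)..Y,
          (√2)⁻¹ ^ 3 * (Real.cos φ * (√(a + (A + B) * Real.sin φ ^ 2))⁻¹ ^ 3) := by
        rw [intervalIntegral.integral_const_mul, ← integral_cos_mul_inv_sqrt ha (by positivity)]
        ring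
    _ ≤ a * ∫ φ in (0 : ℝ)..Y, Real.cos φ ^ 4 * (√(flux n a b φ *
          (2 - ε ^ 2 * (Real.sin φ * Real.cos φ) ^ 2 * flux n a b φ)))⁻¹ ^ 3 := by
        refine mul_le_mul_of_nonneg_left (intervalIntegral.integral_mono_on hY.1.le
          (Continuous.intervalIntegrable (by fun_prop) _ _)
          (hcont.intervalIntegrable _ _) fun φ hφ => ?_) ha.le
        have hco := cos_pos_of_le hφ hY.2
        have hcY : Real.cos Y ≤ Real.cos φ :=
          Real.cos_le_cos_of_nonneg_of_le_pi hφ.1 (by linarith [hY.2]) hφ.2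
        have hcY0 := cos_pos_of_le ⟨hY.1.le, le_rfl⟩ hY.2
        have h3 := h.flux_pos hc ha hb φ
        have h1 : flux n a b φ ≤ Real.cos φ ^ 2 * (a + (A + B) * Real.sin φ ^ 2) := by
          have e1 := hn φ hφ
          have e2 : b * Real.sin φ ^ 2 ≤ B * Real.cos φ ^ 2 * Real.sin φ ^ 2 := by
            gcongr
            exact hB.trans (by gcongr)
          unfold flux
          nlinarith
        have h4 : 0 ≤ ε ^ 2 * (Real.sin φ * Real.cos φ) ^ 2 * flux n a b φ := by positivity
        have h5 := le_pow_mul_inv_pow hco.le (mul_pos (hs φ) h2x)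
          (h.radicand_pos hc hC ha hb hε φ) (by
            refine Real.sqrt_le_iff.2 ⟨by positivity, ?_⟩
            rw [← mul_assoc, mul_pow (Real.cos φ * _), mul_pow (Real.cos φ),
              Real.sq_sqrt (by positivity), Real.sq_sqrt (by positivity)]
            exact mul_le_mul h1 (by linarith)
              (by linarith [h.mul_flux_le hc hC ha hb ε φ]) (by positivity))
        refine (le_of_eq ?_).trans h5
        rw [mul_inv]
        ring
    _ ≤ _ := by
        refine mul_le_mul_of_nonneg_left ?_ ha.le
        rw [leftRate, ← intervalIntegral.integral_add_adjacent_intervals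
          (hcont.intervalIntegrable 0 Y) (hcont.intervalIntegrable Y (Real.pi / 2))]
        refine le_add_of_nonneg_right (intervalIntegral.integral_nonneg hY.2.le fun φ _ => ?_)
        positivity

end

/-- The profile `n` is close to `A t (1 - t)` near `t = 0`. -/
def IsFlat (A κ y : ℝ) (n : ℝ → ℝ) : Prop :=
  ∀ t ∈ Icc 0 y, |n t - A * (t * (1 - t))| ≤ κ * (t * (1 - t))

lemma exists_leftRate_close {A c C η : ℝ} (hA : 0 < A) (hc : 0 < c) (hC : 0 ≤ C) (hη : 0 < η) :
    ∃ κ > 0, ∀ y ∈ Ioo (0 : ℝ) 1, ∃ a₀ > 0, a₀ ≤ 1 ∧ ∃ ε₀ > 0, ε₀ ^ 2 * (2 + C) ≤ 1 / 2 ∧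
      ∀ n, IsProfile c C n → IsFlat A κ y n → ∀ a ∈ Ioc 0 a₀, ∀ b ∈ Ioc 0 a₀, ∀ ε ∈ Ioo 0 ε₀,
        |a * leftRate ε n a b - (√2)⁻¹ ^ 3 * (√A)⁻¹| ≤ η := by
  have hpi := Real.pi_pos
  have hsA : √A ≠ 0 := (Real.sqrt_pos.2 hA).ne'
  have t1 : Tendsto (fun κ : ℝ => (√(2 - κ))⁻¹ ^ 3 * (√(A - κ))⁻¹) (𝓝[>] 0)
      (𝓝 ((√2)⁻¹ ^ 3 * (√A)⁻¹)) := by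
    have : ContinuousAt (fun κ : ℝ => (√(2 - κ))⁻¹ ^ 3 * (√(A - κ))⁻¹) 0 := by
      refine ContinuousAt.mul (ContinuousAt.pow (ContinuousAt.inv₀ (by fun_prop) (by simp)) 3)
        (ContinuousAt.inv₀ (by fun_prop) (by simpa using hsA))
    simpa [ContinuousAt] using this.mono_left nhdsWithin_le_nhds
  have t2 : Tendsto (fun κ : ℝ => (√2)⁻¹ ^ 3 * (√(A + κ + 2 * κ))⁻¹) (𝓝[>] 0)
      (𝓝 ((√2)⁻¹ ^ 3 * (√A)⁻¹)) := by
    have : ContinuousAt (fun κ : ℝ => (√2)⁻¹ ^ 3 * (√(A + κ + 2 * κ))⁻¹) 0 := by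
      refine ContinuousAt.mul (by fun_prop)
        (ContinuousAt.inv₀ (by fun_prop) (by simpa using hsA))
    simpa [ContinuousAt] using this.mono_left nhdsWithin_le_nhds
  have t3 : ∀ᶠ κ in 𝓝[>] (0 : ℝ), κ < 1 / 2 ∧ κ < A := nhdsWithin_le_nhds
    ((gt_mem_nhds (by positivity : (0 : ℝ) < 1 / 2)).and (gt_mem_nhds hA))
  have t4 : ∀ᶠ κ in 𝓝[>] (0 : ℝ), 0 < κ := self_mem_nhdsWithin
  -- κ perturbs A and also serves as `x₀` and `B` in the two bounds. It is fixed before y, because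
  -- the range of flatness depends on κ. The upper bound gets only η/2: the other half pays for the
  -- part beyond Y.
  obtain ⟨κ, ⟨⟨hκ1, hκ2⟩, hκ3, hκ4⟩, hκ0⟩ :=
    (((t1.eventually (gt_mem_nhds (lt_add_of_pos_right _ (half_pos hη)))).and
      (t2.eventually (lt_mem_nhds (sub_lt_self _ hη)))).and t3).and t4 |>.exists
  refine ⟨κ, hκ0, fun y hy => ?_⟩
  -- Thus sin²φ ≤ y on [0, Y], which is the range where the profile is flat.
  set Y := Real.arcsin √y with hYdef
  have hsy : √y ∈ Ioo (0 : ℝ) 1 :=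
    ⟨Real.sqrt_pos.2 hy.1, by rw [Real.sqrt_lt' one_pos]; simpa using hy.2⟩
  have hY : Y ∈ Ioo 0 (Real.pi / 2) :=
    ⟨Real.arcsin_pos.2 hsy.1, Real.arcsin_lt_pi_div_two.2 hsy.2⟩
  have hsinY : Real.sin Y = √y := Real.sin_arcsin (by linarith [hsy.1]) hsy.2.le
  have hsY : 0 < Real.sin Y := by rw [hsinY]; exact hsy.1
  have hcY : 0 < Real.cos Y := cos_pos_of_le ⟨hY.1.le, le_rfl⟩ hY.2
  set M := Real.pi / 2 * (√(c * Real.sin Y ^ 2))⁻¹ ^ 3 with hM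
  have hM0 : 0 < M := by positivity
  refine ⟨min (min 1 (η / 2 / M)) (min (κ * Real.cos Y ^ 2) (κ * Real.sin Y ^ 2)),
    by positivity, (min_le_left _ _).trans (min_le_left _ _), min 1 (κ / (2 + C)), by positivity,
    ?_, ?_⟩
  · have e0 : 0 < min 1 (κ / (2 + C)) := by positivity
    have e1 : min 1 (κ / (2 + C)) ^ 2 ≤ κ / (2 + C) := by
      nlinarith [min_le_left 1 (κ / (2 + C)), min_le_right 1 (κ / (2 + C))]
    have := mul_le_mul_of_nonneg_right e1 (by linarith : 0 ≤ 2 + C)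
    rw [div_mul_cancel₀ _ (by linarith)] at this
    linarith
  intro n hn hflat a ha b hb ε hε
  have ha' := le_min_iff.1 ha.2
  have hb' := le_min_iff.1 hb.2
  have ha1 := le_min_iff.1 ha'.1
  have ha2 := le_min_iff.1 ha'.2
  have hb1 := le_min_iff.1 hb'.1
  have hb2 := le_min_iff.1 hb'.2
  have hε2 : ε ^ 2 * (a + b + C) ≤ κ := by
    have e1 : ε ^ 2 ≤ κ / (2 + C) := by
      nlinarith [hε.1, (lt_min_iff.1 hε.2).1, (lt_min_iff.1 hε.2).2]
    calc ε ^ 2 * (a + b + C) ≤ κ / (2 + C) * (2 + C) := by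
          have := ha.1
          have := hb.1
          gcongr
          linarith
      _ = κ := div_mul_cancel₀ _ (by linarith)
  have hfl : ∀ φ ∈ Icc 0 Y, |n (Real.sin φ ^ 2) - A * (Real.sin φ * Real.cos φ) ^ 2| ≤
      κ * (Real.sin φ * Real.cos φ) ^ 2 := by
    intro φ hφ
    have hle : Real.sin φ ≤ Real.sin Y :=
      Real.sin_le_sin_of_le_of_le_pi_div_two (by linarith [hφ.1]) hY.2.le hφ.2
    have h0 : 0 ≤ Real.sin φ := Real.sin_nonneg_of_nonneg_of_le_pi hφ.1 (by linarith [hφ.2, hY.2])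
    have := hflat (Real.sin φ ^ 2) ⟨sq_nonneg _, by
      calc Real.sin φ ^ 2 ≤ Real.sin Y ^ 2 := by gcongr
        _ = y := by rw [hsinY, Real.sq_sqrt hy.1.le]⟩
    rwa [one_sub_sin_sq, ← mul_pow] at this
  have up := hn.mul_leftRate_le hc hC ha.1 hb.1 (by linarith) hε2 (by linarith : 0 < A - κ) hY
    (fun φ hφ => by have := (abs_le.1 (hfl φ hφ)).1; linarith)
  have lo := hn.le_mul_leftRate (ε := ε) hc hC ha.1 hb.1 (by linarith) (by linarith : 0 ≤ A + κ) hY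
    hb2.1 ha2.2 (fun φ hφ => by have := (abs_le.1 (hfl φ hφ)).2; linarith)
  have hMa : a * M ≤ η / 2 := by
    have := mul_le_mul_of_nonneg_right ha1.2 hM0.le
    rwa [div_mul_cancel₀ _ hM0.ne'] at this
  rw [← hM] at up
  rw [abs_le]
  exact ⟨by linarith, by linarith⟩

/-- Logarithmic asymptotics of the left time, in Lipschitz form. -/
lemma exists_leftTime_log {A c C η : ℝ} (hA : 0 < A) (hc : 0 < c) (hC : 0 ≤ C) (hη : 0 < η) :
    ∃ κ > 0, ∀ y ∈ Ioo (0 : ℝ) 1, ∃ Λ ≥ 0, ∃ ε₀ > 0, ε₀ ^ 2 * (2 + C) ≤ 1 / 2 ∧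
      ∀ n, IsProfile c C n → IsFlat A κ y n → ∀ ε ∈ Ioo 0 ε₀, ∀ x ≥ Λ, ∀ x' ≥ Λ, ∀ w ≥ Λ,
        |leftTime ε n (Real.exp (-x)) (Real.exp (-w)) -
          leftTime ε n (Real.exp (-x')) (Real.exp (-w)) - (√2)⁻¹ ^ 3 * (√A)⁻¹ * (x - x')| ≤
            η * |x - x'| := by
  obtain ⟨κ, hκ, H⟩ := exists_leftRate_close hA hc hC hη
  refine ⟨κ, hκ, fun y hy => ?_⟩
  obtain ⟨a₀, ha₀, ha₁, ε₀, hε₀, hε₁, H⟩ := H y hy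
  refine ⟨-Real.log a₀, neg_nonneg.2 (Real.log_nonpos ha₀.le ha₁), ε₀, hε₀, hε₁, ?_⟩
  intro n hn hflat ε hε x hx x' hx' w hw
  have hexp : ∀ u ≥ -Real.log a₀, Real.exp (-u) ∈ Ioc 0 a₀ := fun u hu =>
    ⟨Real.exp_pos _, by rw [← Real.le_log_iff_exp_le ha₀]; linarith⟩
  have hw' := hexp w hw
  set k := (√2)⁻¹ ^ 3 * (√A)⁻¹ with hk
  -- In the variable u = −log a the derivative of the left time is a · `leftRate`, so subtracting k
  -- u leaves a function with derivative at most η in absolute value.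
  have hd : ∀ u ∈ Ici (-Real.log a₀), HasDerivWithinAt
      (fun u => leftTime ε n (Real.exp (-u)) (Real.exp (-w)) - k * u)
      (Real.exp (-u) * leftRate ε n (Real.exp (-u)) (Real.exp (-w)) - k)
      (Ici (-Real.log a₀)) u := by
    intro u hu
    have h1 : HasDerivAt (fun u : ℝ => Real.exp (-u)) (-Real.exp (-u)) u := by
      simpa using (hasDerivAt_neg u).exp
    have hu' := hexp u hu
    have h2 := (hn.hasDerivAt_leftTime (ε := ε) hc hC hu'.1 hw'.1 (by
      have e1 : ε ^ 2 ≤ ε₀ ^ 2 := by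
        have := hε.1
        have := hε.2
        gcongr
      have e2 : ε ^ 2 * (Real.exp (-u) + Real.exp (-w) + C) ≤ ε₀ ^ 2 * (2 + C) := by
        have := hu'.1
        have := hw'.1
        gcongr
        linarith [hu'.2, hw'.2]
      linarith)).comp u h1
    refine ((h2.sub ((hasDerivAt_id u).const_mul k)).congr_deriv ?_).hasDerivWithinAt
    ring
  have := (convex_Ici (-Real.log a₀)).norm_image_sub_le_of_norm_hasDerivWithin_le hd
    (C := η) (fun u hu => H n hn hflat _ (hexp u hu) _ hw' ε hε) hx' hx
  simp only [Real.norm_eq_abs] at this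
  convert this using 2
  ring

/-! ### The Gibbs function near the double tangent. -/

section

variable {F : ℝ → ℝ} {αbar βbar α₀ β₀ σ₀ b₀ : ℝ}

lemma IsFreeEnergy.contDiffOn_deriv (hF : IsFreeEnergy F αbar βbar) :
    ContDiffOn ℝ 4 (deriv F) (Ioi 0) :=
  hF.contDiffOn.deriv_of_isOpen isOpen_Ioi (by norm_num)

lemma IsFreeEnergy.contDiffOn_deriv2 (hF : IsFreeEnergy F αbar βbar) :
    ContDiffOn ℝ 3 (deriv (deriv F)) (Ioi 0) :=
  hF.contDiffOn_deriv.deriv_of_isOpen isOpen_Ioi (by norm_num)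

lemma IsFreeEnergy.hasDerivAt (hF : IsFreeEnergy F αbar βbar) {z : ℝ} (hz : 0 < z) :
    HasDerivAt F (deriv F z) z :=
  ((hF.contDiffOn.contDiffAt (Ioi_mem_nhds hz)).differentiableAt (by norm_num)).hasDerivAt

lemma IsFreeEnergy.hasDerivAt_deriv (hF : IsFreeEnergy F αbar βbar) {z : ℝ} (hz : 0 < z) :
    HasDerivAt (deriv F) (deriv (deriv F) z) z :=
  ((hF.contDiffOn_deriv.contDiffAt (Ioi_mem_nhds hz)).differentiableAt (by norm_num)).hasDerivAt

lemma IsFreeEnergy.hasDerivAt_gibbs (hF : IsFreeEnergy F αbar βbar) (σ : ℝ) {z : ℝ}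
    (hz : 0 < z) : HasDerivAt (Gibbs F σ) (deriv F z - σ) z :=
  ((hF.hasDerivAt hz).sub ((hasDerivAt_id z).const_mul σ)).congr_deriv (by simp)

lemma IsFreeEnergy.βbar_pos (hF : IsFreeEnergy F αbar βbar) : 0 < βbar := hF.pos.trans hF.lt

lemma IsFreeEnergy.strictMonoOn_left (hF : IsFreeEnergy F αbar βbar) :
    StrictMonoOn (deriv F) (Ioc 0 αbar) := by
  refine strictMonoOn_of_deriv_pos (convex_Ioc _ _)
    (hF.contDiffOn_deriv.continuousOn.mono fun z hz => hz.1) fun z hz => ?_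
  rw [interior_Ioc] at hz
  exact hF.convex_left z hz

lemma IsFreeEnergy.strictAntiOn_mid (hF : IsFreeEnergy F αbar βbar) :
    StrictAntiOn (deriv F) (Icc αbar βbar) := by
  refine strictAntiOn_of_deriv_neg (convex_Icc _ _)
    (hF.contDiffOn_deriv.continuousOn.mono fun z hz => hF.pos.trans_le hz.1) fun z hz => ?_
  rw [interior_Icc] at hz
  exact hF.concave_mid z hz

lemma IsFreeEnergy.strictMonoOn_right (hF : IsFreeEnergy F αbar βbar) :
    StrictMonoOn (deriv F) (Ici βbar) := by
  refine strictMonoOn_of_deriv_pos (convex_Ici _)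
    (hF.contDiffOn_deriv.continuousOn.mono fun z hz => hF.βbar_pos.trans_le hz) fun z hz => ?_
  rw [interior_Ici] at hz
  exact hF.convex_right z hz

/-- The two tangency points of the common tangent lie in the two convexity regions. -/
lemma IsMaxwell.location (hM : IsMaxwell F α₀ β₀ σ₀) (hF : IsFreeEnergy F αbar βbar) :
    α₀ < αbar ∧ βbar < β₀ ∧ ∃ γ ∈ Ioo αbar βbar, deriv F γ = σ₀ := by
  have hα := hM.pos
  have hαβ := hM.lt
  obtain ⟨γ, hγ, hγ0⟩ : ∃ γ ∈ Ioo α₀ β₀, deriv (Gibbs F σ₀) γ = 0 := by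
    refine exists_deriv_eq_zero hαβ (fun z hz =>
      (hF.hasDerivAt_gibbs σ₀ (hα.trans_le hz.1)).continuousAt.continuousWithinAt) ?_
    have := hM.equal_area
    unfold Gibbs; linarith
  have hγp : 0 < γ := hα.trans hγ.1
  rw [(hF.hasDerivAt_gibbs σ₀ hγp).deriv] at hγ0
  have hl := hM.left
  have hr := hM.right
  -- F' is injective on each of its three monotone branches, so α₀, the Rolle point γ and β₀ must
  -- lie on different ones.
  have no1 : ∀ x y, 0 < x → x < y → y ≤ αbar → deriv F x = σ₀ → deriv F y = σ₀ → False :=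
    fun x y h0 h1 h2 h3 h4 => by
      have := hF.strictMonoOn_left ⟨h0, h1.le.trans h2⟩ ⟨h0.trans h1, h2⟩ h1
      linarith
  have no2 : ∀ x y, αbar ≤ x → x < y → y ≤ βbar → deriv F x = σ₀ → deriv F y = σ₀ → False :=
    fun x y h0 h1 h2 h3 h4 => by
      have := hF.strictAntiOn_mid ⟨h0, h1.le.trans h2⟩ ⟨h0.trans h1.le, h2⟩ h1
      linarith
  have no3 : ∀ x y, βbar ≤ x → x < y → deriv F x = σ₀ → deriv F y = σ₀ → False :=
    fun x y h0 h1 h3 h4 => by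
      have := hF.strictMonoOn_right h0 (h0.trans h1.le) h1
      linarith
  have hγσ : deriv F γ = σ₀ := by linarith
  have h1 : αbar < γ := by
    by_contra! h
    exact no1 _ _ hα hγ.1 h hl hγσ
  have h2 : γ < βbar := by
    by_contra! h
    exact no3 _ _ h hγ.2 hγσ hr
  refine ⟨?_, ?_, γ, ⟨h1, h2⟩, hγσ⟩
  · by_contra! h
    exact no2 _ _ h hγ.1 h2.le hl hγσ
  · by_contra! h
    exact no2 _ _ h1.le hγ.2 h hγσ hr

lemma IsFreeEnergy.deriv2_pos_left (hF : IsFreeEnergy F αbar βbar)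
    (hM : IsMaxwell F α₀ β₀ σ₀) : 0 < deriv (deriv F) α₀ :=
  hF.convex_left _ ⟨hM.pos, (hM.location hF).1⟩

lemma IsFreeEnergy.deriv2_pos_right (hF : IsFreeEnergy F αbar βbar)
    (hM : IsMaxwell F α₀ β₀ σ₀) : 0 < deriv (deriv F) β₀ :=
  hF.convex_right _ (hM.location hF).2.1

/-- Monotonicity of the Gibbs function of the double tangent. -/
lemma IsMaxwell.monotonicity (hM : IsMaxwell F α₀ β₀ σ₀) (hF : IsFreeEnergy F αbar βbar) :
    ∃ γ ∈ Ioo α₀ β₀, StrictAntiOn (Gibbs F σ₀) (Ioc 0 α₀) ∧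
      StrictMonoOn (Gibbs F σ₀) (Icc α₀ γ) ∧ StrictAntiOn (Gibbs F σ₀) (Icc γ β₀) ∧
      StrictMonoOn (Gibbs F σ₀) (Ici β₀) ∧ ∀ z > β₀, σ₀ < deriv F z := by
  obtain ⟨hα, hβ, γ, hγ, hγσ⟩ := hM.location hF
  have hα0 := hM.pos
  have hγ0 : 0 < γ := hF.pos.trans hγ.1
  have hl := hM.left
  have hr := hM.right
  have hcont : ContinuousOn (Gibbs F σ₀) (Ioi 0) := fun z hz =>
    (hF.hasDerivAt_gibbs σ₀ hz).continuousAt.continuousWithinAt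
  have hder : ∀ z > 0, deriv (Gibbs F σ₀) z = deriv F z - σ₀ := fun z hz =>
    (hF.hasDerivAt_gibbs σ₀ hz).deriv
  have hz5 : ∀ z > β₀, σ₀ < deriv F z := fun z hz => by
    have := hF.strictMonoOn_right (mem_Ici.2 hβ.le) (mem_Ici.2 (hβ.le.trans (le_of_lt hz))) hz
    linarith
  refine ⟨γ, ⟨hα.trans hγ.1, hγ.2.trans hβ⟩, ?_, ?_, ?_, ?_, hz5⟩
  · refine strictAntiOn_of_deriv_neg (convex_Ioc _ _) (hcont.mono fun z hz => hz.1) fun z hz => ?_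
    rw [interior_Ioc] at hz
    rw [hder z hz.1]
    have := hF.strictMonoOn_left ⟨hz.1, (hz.2.trans hα).le⟩ ⟨hα0, hα.le⟩ hz.2
    linarith
  · refine strictMonoOn_of_deriv_pos (convex_Icc _ _)
      (hcont.mono fun z hz => hα0.trans_le hz.1) fun z hz => ?_
    rw [interior_Icc] at hz
    rw [hder z (hα0.trans hz.1)]
    rcases le_total z αbar with h | h
    · have := hF.strictMonoOn_left ⟨hα0, hα.le⟩ ⟨hα0.trans hz.1, h⟩ hz.1
      linarith
    · have := hF.strictAntiOn_mid ⟨h, (hz.2.trans hγ.2).le⟩ ⟨hγ.1.le, hγ.2.le⟩ hz.2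
      linarith
  · refine strictAntiOn_of_deriv_neg (convex_Icc _ _)
      (hcont.mono fun z hz => hγ0.trans_le hz.1) fun z hz => ?_
    rw [interior_Icc] at hz
    rw [hder z (hγ0.trans hz.1)]
    rcases le_total z βbar with h | h
    · have := hF.strictAntiOn_mid ⟨hγ.1.le, hγ.2.le⟩ ⟨(hγ.1.trans hz.1).le, h⟩ hz.1
      linarith
    · have := hF.strictMonoOn_right (mem_Ici.2 h) (mem_Ici.2 hβ.le) hz.2
      linarith
  · refine strictMonoOn_of_deriv_pos (convex_Ici _)
      (hcont.mono fun z hz => (hα0.trans hM.lt).trans_le hz) fun z hz => ?_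
    rw [interior_Ici] at hz
    rw [hder z ((hα0.trans hM.lt).trans hz)]
    linarith [hz5 z hz]

lemma IsMaxwell.gibbs_eq (hM : IsMaxwell F α₀ β₀ σ₀) : Gibbs F σ₀ β₀ = Gibbs F σ₀ α₀ := by
  have := hM.equal_area
  unfold Gibbs; linarith

lemma IsMaxwell.gibbs_lt (hM : IsMaxwell F α₀ β₀ σ₀) (hF : IsFreeEnergy F αbar βbar) {z : ℝ}
    (hz : z ∈ Ioo α₀ β₀) : Gibbs F σ₀ α₀ < Gibbs F σ₀ z := by
  obtain ⟨γ, hγ, h1, h2, h3, h4, h5⟩ := hM.monotonicity hF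
  rcases le_total z γ with h | h
  · exact h2 ⟨le_rfl, hγ.1.le⟩ ⟨hz.1.le, h⟩ hz.1
  · rw [← hM.gibbs_eq]
    exact h3 ⟨h, hz.2.le⟩ ⟨hγ.2.le, le_rfl⟩ hz.2

/-- Away from the tangency points the Gibbs function exceeds the tangent value, with at least
linear growth. -/
lemma IsMaxwell.exists_coercive (hM : IsMaxwell F α₀ β₀ σ₀) (hF : IsFreeEnergy F αbar βbar)
    {h : ℝ} (hh : 0 < h) : ∃ c > 0, ∀ z > 0, h ≤ |z - α₀| → h ≤ |z - β₀| →
      c * (1 + z) ≤ Gibbs F σ₀ z - Gibbs F σ₀ α₀ := by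
  obtain ⟨γ, hγ, h1, h2, h3, h4, h5⟩ := hM.monotonicity hF
  have hα0 := hM.pos
  set k := min (min h (α₀ / 2)) (min (γ - α₀) (β₀ - γ)) with hk
  have hk0 : 0 < k := lt_min (lt_min hh (by linarith)) (lt_min (by linarith [hγ.1])
    (by linarith [hγ.2]))
  have hkh : k ≤ h := (min_le_left _ _).trans (min_le_left _ _)
  have hkα : k ≤ α₀ / 2 := (min_le_left _ _).trans (min_le_right _ _)
  have hkγ : k ≤ γ - α₀ := (min_le_right _ _).trans (min_le_left _ _)
  have hkβ : k ≤ β₀ - γ := (min_le_right _ _).trans (min_le_right _ _)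
  have hγ1 := hγ.1
  have hγ2 := hγ.2
  set G : ℝ → ℝ := fun z => Gibbs F σ₀ z - Gibbs F σ₀ α₀ with hG
  have m1 : 0 < G (α₀ - k) := sub_pos.2 (h1 ⟨by linarith, by linarith⟩ ⟨hα0, le_rfl⟩ (by linarith))
  have m2 : 0 < G (α₀ + k) :=
    sub_pos.2 (h2 ⟨le_rfl, by linarith⟩ ⟨by linarith, by linarith⟩ (by linarith))
  have m3 : 0 < G (β₀ - k) := by
    refine sub_pos.2 ?_
    rw [← hM.gibbs_eq]
    exact h3 ⟨by linarith, by linarith⟩ ⟨by linarith, le_rfl⟩ (by linarith)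
  have m4 : 0 < G (β₀ + k) := by
    refine sub_pos.2 ?_
    rw [← hM.gibbs_eq]
    exact h4 (mem_Ici.2 le_rfl) (mem_Ici.2 (by linarith)) (by linarith)
  have m5 : 0 < deriv F (β₀ + k) - σ₀ := sub_pos.2 (h5 _ (by linarith))
  set m := min (min (G (α₀ - k)) (G (α₀ + k))) (min (G (β₀ - k)) (G (β₀ + k))) with hm
  have hm0 : 0 < m := lt_min (lt_min m1 m2) (lt_min m3 m4)
  have hB : 0 < 1 + (β₀ + k) := by linarith
  set c := min (m / (1 + (β₀ + k))) (deriv F (β₀ + k) - σ₀) with hc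
  have hc0 : 0 < c := lt_min (by positivity) m5
  have hcm : c * (1 + (β₀ + k)) ≤ m := by
    rw [← le_div_iff₀ hB]; exact min_le_left _ _
  have hcm' : c ≤ deriv F (β₀ + k) - σ₀ := min_le_right _ _
  refine ⟨c, hc0, fun z hz hzα hzβ => ?_⟩
  change _ ≤ G z
  have small : z ≤ β₀ + k → m ≤ G z → c * (1 + z) ≤ G z := fun h6 h7 =>
    (mul_le_mul_of_nonneg_left (by linarith) hc0.le).trans (hcm.trans h7)
  rcases le_or_gt z α₀ with hz1 | hz1
  · rw [abs_of_nonpos (by linarith)] at hzα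
    refine small (by linarith) (((min_le_left _ _).trans (min_le_left _ _)).trans ?_)
    exact sub_le_sub_right (h1.antitoneOn ⟨hz, hz1⟩ ⟨by linarith, by linarith⟩ (by linarith)) _
  rw [abs_of_pos (by linarith)] at hzα
  rcases le_or_gt z γ with hz2 | hz2
  · refine small (by linarith) (((min_le_left _ _).trans (min_le_right _ _)).trans ?_)
    exact sub_le_sub_right (h2.monotoneOn ⟨by linarith, by linarith⟩ ⟨hz1.le, hz2⟩
      (by linarith)) _
  rcases le_or_gt z β₀ with hz3 | hz3
  · rw [abs_of_nonpos (by linarith)] at hzβ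
    refine small (by linarith) (((min_le_right _ _).trans (min_le_left _ _)).trans ?_)
    exact sub_le_sub_right (h3.antitoneOn ⟨hz2.le, hz3⟩ ⟨by linarith, by linarith⟩
      (by linarith)) _
  rw [abs_of_pos (by linarith)] at hzβ
  have hzk : β₀ + k ≤ z := by linarith
  have hpos : ∀ y ∈ Ici (β₀ + k), 0 < y := fun y hy => by
    have : β₀ + k ≤ y := hy
    linarith
  -- To the right of β₀ + k the slope of the Gibbs function is at least its positive value at β₀ +
  -- k; this gives the linear growth.
  have hmv := (convex_Ici (β₀ + k)).mul_sub_le_image_sub_of_le_deriv (f := Gibbs F σ₀)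
    (C := deriv F (β₀ + k) - σ₀)
    (fun y hy => (hF.hasDerivAt_gibbs σ₀ (hpos y hy)).continuousAt.continuousWithinAt)
    (fun y hy => (hF.hasDerivAt_gibbs σ₀
      (hpos y (interior_subset hy))).differentiableAt.differentiableWithinAt)
    (fun y hy => by
      have hy' : β₀ + k ≤ y := interior_subset hy
      rw [(hF.hasDerivAt_gibbs σ₀ (hpos y hy')).deriv]
      have hβ := (hM.location hF).2.1
      exact sub_le_sub_right (hF.strictMonoOn_right.monotoneOn (mem_Ici.2 (by linarith))
        (mem_Ici.2 (by linarith)) hy') _) (β₀ + k) (mem_Ici.2 le_rfl) z hzk hzk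
  have hm4 : m ≤ G (β₀ + k) := (min_le_right _ _).trans (min_le_right _ _)
  have h8 : c * (z - (β₀ + k)) ≤ (deriv F (β₀ + k) - σ₀) * (z - (β₀ + k)) :=
    mul_le_mul_of_nonneg_right hcm' (by linarith)
  have h9 : G z = G (β₀ + k) + (Gibbs F σ₀ z - Gibbs F σ₀ (β₀ + k)) := by simp only [hG]; ring
  rw [h9]
  nlinarith

/-- On the level set, Φ_σ₀(z) − b₀ = (σ − σ₀)z + (b − b₀), which is less than c(1 + z) when Δ is
within c of Δ₀. Linear coercivity is needed because z is not bounded beforehand. -/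
lemma IsMaxwell.exists_nhds_level (hM : IsMaxwell F α₀ β₀ σ₀) (hF : IsFreeEnergy F αbar βbar)
    {h : ℝ} (hh : 0 < h) : ∃ N ∈ 𝓝 ((σ₀, Gibbs F σ₀ α₀) : ℝ × ℝ), ∀ Δ ∈ N, ∀ z > 0,
      Gibbs F Δ.1 z = Δ.2 → |z - α₀| < h ∨ |z - β₀| < h := by
  obtain ⟨c, hc, H⟩ := hM.exists_coercive hF hh
  refine ⟨Metric.ball _ c, Metric.ball_mem_nhds _ hc, fun Δ hΔ z hz hb => ?_⟩
  by_contra! hcon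
  have h1 := H z hz hcon.1 hcon.2
  rw [mem_ball_iff_norm, Prod.norm_def, max_lt_iff] at hΔ
  obtain ⟨h2, h3⟩ := hΔ
  simp only [Prod.fst_sub, Prod.snd_sub, Real.norm_eq_abs, abs_lt] at h2 h3
  have h4 : Gibbs F σ₀ z - Gibbs F σ₀ α₀ = (Δ.1 - σ₀) * z + (Δ.2 - Gibbs F σ₀ α₀) := by
    rw [← hb]; unfold Gibbs; ring
  have h5 : (Δ.1 - σ₀) * z < c * z := mul_lt_mul_of_pos_right h2.2 hz
  linarith [h3.2]

lemma IsTurningPair.not_convexOn {Δ : ℝ × ℝ} {z₁ z₂ : ℝ} (h : IsTurningPair F Δ z₁ z₂)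
    {s : Set ℝ} (h₁ : z₁ ∈ s) (h₂ : z₂ ∈ s) : ¬ConvexOn ℝ s F := by
  intro hc
  have h3 := hc.2 h₁ h₂ (by norm_num : (0 : ℝ) ≤ 1 / 2) (by norm_num : (0 : ℝ) ≤ 1 / 2)
    (by norm_num)
  have h4 := h.between ((1 / 2 : ℝ) • z₁ + (1 / 2 : ℝ) • z₂)
    ⟨by simp only [smul_eq_mul]; linarith [h.lt], by simp only [smul_eq_mul]; linarith [h.lt]⟩
  have h5 := h.left
  have h6 := h.right
  simp only [smul_eq_mul, Gibbs] at *
  linarith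

/-- Turning pairs of pairs close to the Maxwell point are close to the tangency points. -/
lemma IsMaxwell.exists_nhds_turningPair (hM : IsMaxwell F α₀ β₀ σ₀)
    (hF : IsFreeEnergy F αbar βbar) {h : ℝ} (hh : 0 < h) :
    ∃ N ∈ 𝓝 ((σ₀, Gibbs F σ₀ α₀) : ℝ × ℝ), ∀ Δ ∈ N, ∀ z₁ z₂, IsTurningPair F Δ z₁ z₂ →
      |z₁ - α₀| < h ∧ |z₂ - β₀| < h := by
  obtain ⟨hα, hβ, -⟩ := hM.location hF
  have hlt := hM.lt
  set k := min (min h (αbar - α₀)) (min (β₀ - βbar) ((β₀ - α₀) / 2)) with hk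
  have hk0 : 0 < k := lt_min (lt_min hh (by linarith)) (lt_min (by linarith) (by linarith))
  have hkh : k ≤ h := (min_le_left _ _).trans (min_le_left _ _)
  have hkα : k ≤ αbar - α₀ := (min_le_left _ _).trans (min_le_right _ _)
  have hkγ : k ≤ β₀ - βbar := (min_le_right _ _).trans (min_le_left _ _)
  have hkβ : k ≤ (β₀ - α₀) / 2 := (min_le_right _ _).trans (min_le_right _ _)
  obtain ⟨N, hN, H⟩ := hM.exists_nhds_level hF hk0
  refine ⟨N, hN, fun Δ hΔ z₁ z₂ hz => ?_⟩
  have hz2 : 0 < z₂ := hz.pos.trans hz.lt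
  have c1 : ConvexOn ℝ (Ioc 0 αbar) F :=
    MonotoneOn.convexOn_of_deriv (convex_Ioc _ _)
      (hF.contDiffOn.continuousOn.mono fun z hz => hz.1)
      (fun z hz => (hF.hasDerivAt (interior_subset hz).1).differentiableAt.differentiableWithinAt)
      (hF.strictMonoOn_left.monotoneOn.mono interior_subset)
  have c2 : ConvexOn ℝ (Ici βbar) F :=
    MonotoneOn.convexOn_of_deriv (convex_Ici _)
      (hF.contDiffOn.continuousOn.mono fun z hz => hF.βbar_pos.trans_le hz)
      (fun z hz => (hF.hasDerivAt
        (hF.βbar_pos.trans_le (interior_subset hz))).differentiableAt.differentiableWithinAt)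
      (hF.strictMonoOn_right.monotoneOn.mono interior_subset)
  have hlt' := hz.lt
  -- Two turning points near the same tangency point would lie in a region of convexity, and the
  -- swapped arrangement contradicts z₁ < z₂.
  rcases H Δ hΔ z₁ hz.pos hz.left with h1 | h1 <;> rcases H Δ hΔ z₂ hz2 hz.right with h2 | h2
  · rw [abs_lt] at h1 h2
    exact (hz.not_convexOn (s := Ioc 0 αbar) ⟨hz.pos, by linarith⟩ ⟨hz2, by linarith⟩ c1).elim
  · exact ⟨h1.trans_le hkh, h2.trans_le hkh⟩
  · rw [abs_lt] at h1 h2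
    linarith
  · rw [abs_lt] at h1 h2
    exact (hz.not_convexOn (mem_Ici.2 (by linarith)) (mem_Ici.2 (by linarith)) c2).elim

end

/-! ### The gap minus its Hermite interpolant, and uniform profile bounds. -/

/-- The gap between `F` and its chord over `[z.1, z.2]`. -/
def gap (F : ℝ → ℝ) (z : ℝ × ℝ) (t : ℝ) : ℝ :=
  F (z.1 + t * (z.2 - z.1)) - F z.1 - t * (F z.2 - F z.1)

/-- The slope of the gap at the left end. -/
def slopeL (F : ℝ → ℝ) (z : ℝ × ℝ) : ℝ := (z.2 - z.1) * deriv F z.1 - (F z.2 - F z.1)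

/-- Minus the slope of the gap at the right end. -/
def slopeR (F : ℝ → ℝ) (z : ℝ × ℝ) : ℝ := (F z.2 - F z.1) - (z.2 - z.1) * deriv F z.2

/-- The gap minus its cubic Hermite interpolant. -/
def remainder (F : ℝ → ℝ) (z : ℝ × ℝ) (t : ℝ) : ℝ :=
  gap F z t - t * (1 - t) * (slopeL F z * (1 - t) + slopeR F z * t)

/-- The first derivative of the remainder. -/
def remainder' (F : ℝ → ℝ) (z : ℝ × ℝ) (t : ℝ) : ℝ :=
  (z.2 - z.1) * deriv F (z.1 + t * (z.2 - z.1)) - (F z.2 - F z.1) -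
    (slopeL F z * (1 - 4 * t + 3 * t ^ 2) + slopeR F z * (2 * t - 3 * t ^ 2))

/-- The second derivative of the remainder. -/
def remainder'' (F : ℝ → ℝ) (z : ℝ × ℝ) (t : ℝ) : ℝ :=
  (z.2 - z.1) ^ 2 * deriv (deriv F) (z.1 + t * (z.2 - z.1)) -
    (slopeL F z * (6 * t - 4) + slopeR F z * (2 - 6 * t))

/-- The normalised remainder. -/
def profile (F : ℝ → ℝ) (z : ℝ × ℝ) (t : ℝ) : ℝ := remainder F z t / (t * (1 - t))

/-- Two applications of the mean value inequality; the sharp constant D/2 is not needed. -/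
lemma abs_le_mul_sq {f f' f'' : ℝ → ℝ} {D y : ℝ}
    (hf : ∀ t ∈ Icc 0 y, HasDerivAt f (f' t) t) (hf' : ∀ t ∈ Icc 0 y, HasDerivAt f' (f'' t) t)
    (h0 : f 0 = 0) (h1 : f' 0 = 0) (hD : ∀ t ∈ Icc 0 y, |f'' t| ≤ D) :
    ∀ t ∈ Icc 0 y, |f t| ≤ D * t ^ 2 := by
  intro t ht
  have hsub : Icc 0 t ⊆ Icc 0 y := Icc_subset_Icc_right ht.2
  have hD0 : 0 ≤ D := (abs_nonneg _).trans (hD t ht)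
  have e1 : ∀ s ∈ Icc 0 t, ‖f' s‖ ≤ D * t := by
    intro s hs
    have := (convex_Icc 0 t).norm_image_sub_le_of_norm_hasDerivWithin_le
      (fun u hu => (hf' u (hsub hu)).hasDerivWithinAt) (fun u hu => hD u (hsub hu))
      (left_mem_Icc.2 ht.1) hs
    rw [h1, sub_zero, sub_zero, Real.norm_of_nonneg hs.1] at this
    exact this.trans (by have := hs.2; gcongr)
  have := (convex_Icc 0 t).norm_image_sub_le_of_norm_hasDerivWithin_le
    (fun u hu => (hf u (hsub hu)).hasDerivWithinAt) e1 (left_mem_Icc.2 ht.1) (right_mem_Icc.2 ht.1)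
  rw [h0, sub_zero, sub_zero, Real.norm_of_nonneg ht.1, Real.norm_eq_abs] at this
  exact this.trans (le_of_eq (by ring))

lemma hasDerivAt_comp_one_sub {f : ℝ → ℝ} {d t : ℝ} (h : HasDerivAt f d (1 - t)) :
    HasDerivAt (fun t => f (1 - t)) (-d) t :=
  (h.comp t ((hasDerivAt_id t).const_sub 1)).congr_deriv (by ring)

lemma abs_le_mul_sq_right {f f' f'' : ℝ → ℝ} {D y : ℝ}
    (hf : ∀ t ∈ Icc 0 y, HasDerivAt f (f' (1 - t)) (1 - t))
    (hf' : ∀ t ∈ Icc 0 y, HasDerivAt f' (f'' (1 - t)) (1 - t))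
    (h0 : f 1 = 0) (h1 : f' 1 = 0) (hD : ∀ t ∈ Icc 0 y, |f'' (1 - t)| ≤ D) :
    ∀ t ∈ Icc 0 y, |f (1 - t)| ≤ D * t ^ 2 :=
  abs_le_mul_sq (f := fun t => f (1 - t)) (f' := fun t => -f' (1 - t))
    (f'' := fun t => f'' (1 - t)) (fun t ht => hasDerivAt_comp_one_sub (hf t ht))
    (fun t ht => (hasDerivAt_comp_one_sub (hf' t ht)).neg.congr_deriv (neg_neg _))
    (by simpa using h0) (by simpa using h1) hD

/-- A function with double zeros at both ends of `[0, 1]`. -/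
lemma abs_le_mul_sq_mul_sq {f f' f'' : ℝ → ℝ} {D : ℝ}
    (hf : ∀ t ∈ Icc (0 : ℝ) 1, HasDerivAt f (f' t) t)
    (hf' : ∀ t ∈ Icc (0 : ℝ) 1, HasDerivAt f' (f'' t) t)
    (h0 : f 0 = 0) (h0' : f' 0 = 0) (h1 : f 1 = 0) (h1' : f' 1 = 0)
    (hD : ∀ t ∈ Icc (0 : ℝ) 1, |f'' t| ≤ D) :
    ∀ t ∈ Icc (0 : ℝ) 1, |f t| ≤ 4 * D * (t * (1 - t)) ^ 2 := by
  intro t ht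
  have hm : ∀ t ∈ Icc (0 : ℝ) 1, 1 - t ∈ Icc (0 : ℝ) 1 :=
    fun t ht => ⟨by linarith [ht.2], by linarith [ht.1]⟩
  have hD0 : 0 ≤ D := (abs_nonneg _).trans (hD t ht)
  have e1 := abs_le_mul_sq hf hf' h0 h0' hD t ht
  have e2 := abs_le_mul_sq_right (fun s hs => hf _ (hm s hs)) (fun s hs => hf' _ (hm s hs)) h1 h1'
    (fun s hs => hD _ (hm s hs)) (1 - t) (hm t ht)
  rw [sub_sub_cancel] at e2
  -- Each half uses the double zero at its own end. The other factor is at least 1/4 after squaring,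
  -- whence the constant 4.
  rcases le_total t (1 / 2) with h | h
  · refine e1.trans ?_
    rw [mul_pow, mul_comm 4 D, mul_assoc]
    gcongr
    have : (1 / 2) ^ 2 ≤ (1 - t) ^ 2 := by gcongr; linarith
    nlinarith [sq_nonneg t]
  · refine e2.trans ?_
    rw [mul_pow, mul_comm 4 D, mul_assoc]
    gcongr
    have : (1 / 2) ^ 2 ≤ t ^ 2 := by gcongr
    nlinarith [sq_nonneg (1 - t)]

lemma div_le_of_le_sq {x D u : ℝ} (hu : 0 ≤ u) (h : x ≤ D * u ^ 2) : x / u ≤ D * u := by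
  rcases hu.eq_or_lt with h0 | h0
  · simp [← h0]
  · rw [div_le_iff₀ h0]; linarith

lemma le_div_of_sq_le {x D u : ℝ} (hu : 0 ≤ u) (h : D * u ^ 2 ≤ x) : D * u ≤ x / u := by
  rcases hu.eq_or_lt with h0 | h0
  · simp [← h0]
  · rw [le_div_iff₀ h0]; linarith

section

variable {F : ℝ → ℝ} {αbar βbar α₀ β₀ σ₀ : ℝ}

lemma segment_pos {z : ℝ × ℝ} {t : ℝ} (h1 : 0 < z.1) (h2 : 0 < z.2) (ht : t ∈ Icc (0 : ℝ) 1) :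
    0 < z.1 + t * (z.2 - z.1) := by
  have : z.1 + t * (z.2 - z.1) = (1 - t) * z.1 + t * z.2 := by ring
  rw [this]
  rcases ht.1.eq_or_lt with h | h
  · rw [← h]; simpa
  · have := ht.2
    have : 0 ≤ (1 - t) * z.1 := mul_nonneg (by linarith) h1.le
    positivity

lemma IsFreeEnergy.hasDerivAt_remainder (hF : IsFreeEnergy F αbar βbar) {z : ℝ × ℝ} {t : ℝ}
    (h1 : 0 < z.1) (h2 : 0 < z.2) (ht : t ∈ Icc (0 : ℝ) 1) :
    HasDerivAt (remainder F z) (remainder' F z t) t := by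
  have hid := hasDerivAt_id t
  have e1 : HasDerivAt (fun t : ℝ => z.1 + t * (z.2 - z.1)) (1 * (z.2 - z.1)) t :=
    (hid.mul_const _).const_add _
  have e2 := ((hF.hasDerivAt (segment_pos h1 h2 ht)).comp t e1).sub_const (F z.1)
  have e3 := e2.sub (hid.mul_const (F z.2 - F z.1))
  have e4 := (hid.mul (hid.const_sub 1)).mul
    (((hid.const_sub 1).const_mul (slopeL F z)).add (hid.const_mul (slopeR F z)))
  refine (e3.sub e4).congr_deriv ?_
  simp only [remainder', id, Pi.mul_apply, Pi.add_apply]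
  ring

lemma IsFreeEnergy.hasDerivAt_remainder' (hF : IsFreeEnergy F αbar βbar) {z : ℝ × ℝ} {t : ℝ}
    (h1 : 0 < z.1) (h2 : 0 < z.2) (ht : t ∈ Icc (0 : ℝ) 1) :
    HasDerivAt (remainder' F z) (remainder'' F z t) t := by
  have hid := hasDerivAt_id t
  have hsq := hasDerivAt_pow 2 t
  have e1 : HasDerivAt (fun t : ℝ => z.1 + t * (z.2 - z.1)) (1 * (z.2 - z.1)) t :=
    (hid.mul_const _).const_add _
  have e2 := (((hF.hasDerivAt_deriv (segment_pos h1 h2 ht)).comp t e1).const_mul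
    (z.2 - z.1)).sub_const (F z.2 - F z.1)
  have e4 := ((((hid.const_mul 4).const_sub 1).add (hsq.const_mul 3)).const_mul (slopeL F z)).add
    (((hid.const_mul 2).sub (hsq.const_mul 3)).const_mul (slopeR F z))
  refine (e2.sub e4).congr_deriv ?_
  simp only [remainder'']
  push_cast
  ring

lemma remainder_zero (F : ℝ → ℝ) (z : ℝ × ℝ) : remainder F z 0 = 0 := by simp [remainder, gap]

lemma remainder_one (F : ℝ → ℝ) (z : ℝ × ℝ) : remainder F z 1 = 0 := by simp [remainder, gap]

lemma remainder'_zero (F : ℝ → ℝ) (z : ℝ × ℝ) : remainder' F z 0 = 0 := by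
  simp [remainder', slopeL]

lemma remainder'_one (F : ℝ → ℝ) (z : ℝ × ℝ) : remainder' F z 1 = 0 := by
  simp [remainder', slopeR]; ring

/-- Joint regularity in (z, t) makes the second derivative of the remainder Lipschitz on compact
convex sets, and through the double zeros all profile bounds become uniform in z. -/
lemma IsFreeEnergy.contDiffOn_remainder'' (hF : IsFreeEnergy F αbar βbar) :
    ContDiffOn ℝ 1 (fun x : (ℝ × ℝ) × ℝ => remainder'' F x.1 x.2)
      {x | 0 < x.1.1 ∧ 0 < x.1.2 ∧ x.2 ∈ Icc (0 : ℝ) 1} := by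
  set S := {x : (ℝ × ℝ) × ℝ | 0 < x.1.1 ∧ 0 < x.1.2 ∧ x.2 ∈ Icc (0 : ℝ) 1} with hS
  have f1 : ContDiffOn ℝ 1 (fun x : (ℝ × ℝ) × ℝ => F x.1.1) S :=
    (hF.contDiffOn.of_le (by norm_num)).comp (by fun_prop) fun x hx => hx.1
  have f2 : ContDiffOn ℝ 1 (fun x : (ℝ × ℝ) × ℝ => F x.1.2) S :=
    (hF.contDiffOn.of_le (by norm_num)).comp (by fun_prop) fun x hx => hx.2.1
  have f3 : ContDiffOn ℝ 1 (fun x : (ℝ × ℝ) × ℝ => deriv F x.1.1) S :=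
    (hF.contDiffOn_deriv.of_le (by norm_num)).comp (by fun_prop) fun x hx => hx.1
  have f4 : ContDiffOn ℝ 1 (fun x : (ℝ × ℝ) × ℝ => deriv F x.1.2) S :=
    (hF.contDiffOn_deriv.of_le (by norm_num)).comp (by fun_prop) fun x hx => hx.2.1
  have f5 : ContDiffOn ℝ 1
      (fun x : (ℝ × ℝ) × ℝ => deriv (deriv F) (x.1.1 + x.2 * (x.1.2 - x.1.1))) S :=
    (hF.contDiffOn_deriv2.of_le (by norm_num)).comp (by fun_prop)
      fun x hx => segment_pos hx.1 hx.2.1 hx.2.2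
  have l1 : ContDiffOn ℝ 1 (fun x : (ℝ × ℝ) × ℝ => x.1.2 - x.1.1) S := by fun_prop
  have l2 : ContDiffOn ℝ 1 (fun x : (ℝ × ℝ) × ℝ => 6 * x.2 - 4) S := by fun_prop
  have l3 : ContDiffOn ℝ 1 (fun x : (ℝ × ℝ) × ℝ => 2 - 6 * x.2) S := by fun_prop
  exact ((l1.pow 2).mul f5).sub ((((l1.mul f3).sub (f2.sub f1)).mul l2).add
    (((f2.sub f1).sub (l1.mul f4)).mul l3))

lemma IsFreeEnergy.continuousOn_remainder (hF : IsFreeEnergy F αbar βbar) {z : ℝ × ℝ}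
    (h1 : 0 < z.1) (h2 : 0 < z.2) : ContinuousOn (remainder F z) (Icc 0 1) := fun _ ht =>
  (hF.hasDerivAt_remainder h1 h2 ht).continuousAt.continuousWithinAt

lemma isProfile_of_remainder {c C : ℝ} {z : ℝ × ℝ}
    (hcont : ContinuousOn (remainder F z) (Icc 0 1))
    (hl : ∀ t ∈ Icc (0 : ℝ) 1, c * (t * (1 - t)) ^ 2 ≤ remainder F z t)
    (hu : ∀ t ∈ Icc (0 : ℝ) 1, |remainder F z t| ≤ C * (t * (1 - t)) ^ 2) :
    IsProfile c C (profile F z) := by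
  have h0 : ∀ t ∈ Icc (0 : ℝ) 1, 0 ≤ t * (1 - t) := fun t ht =>
    mul_nonneg ht.1 (by linarith [ht.2])
  refine ⟨fun t ht => ?_, fun t ht => le_div_of_sq_le (h0 t ht) (hl t ht),
    fun t ht => div_le_of_le_sq (h0 t ht) ((le_abs_self _).trans (hu t ht))⟩
  rcases eq_or_ne (t * (1 - t)) 0 with h | h
  · have hz : profile F z t = 0 := by rw [profile, h, div_zero]
    rw [ContinuousWithinAt, hz]
    have hb : ∀ s ∈ Icc (0 : ℝ) 1, ‖profile F z s‖ ≤ C * (s * (1 - s)) := by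
      intro s hs
      rw [profile, norm_div, Real.norm_eq_abs, Real.norm_of_nonneg (h0 s hs)]
      exact div_le_of_le_sq (h0 s hs) (hu s hs)
    refine squeeze_zero_norm' (eventually_nhdsWithin_of_forall hb) ?_
    have : Tendsto (fun s : ℝ => C * (s * (1 - s))) (𝓝 t) (𝓝 (C * (t * (1 - t)))) :=
      Continuous.tendsto (by fun_prop) t
    rw [h, mul_zero] at this
    exact this.mono_left nhdsWithin_le_nhds
  · exact (hcont t ht).div (by fun_prop) h

lemma slopeL_eq_zero (hM : IsMaxwell F α₀ β₀ σ₀) : slopeL F (α₀, β₀) = 0 := by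
  have h1 := hM.equal_area
  have h2 := hM.left
  simp only [slopeL]
  rw [h1, h2]; ring

lemma slopeR_eq_zero (hM : IsMaxwell F α₀ β₀ σ₀) : slopeR F (α₀, β₀) = 0 := by
  have h1 := hM.equal_area
  have h2 := hM.right
  simp only [slopeR]
  rw [h1, h2]; ring

/-- Replacing t² by (t(1 − t))² costs the relative error t(2 − t) ≤ 2y, hence the condition on A y.
Half of the factor κ/8 + κ/8 = κ/4 idea is (1 − t)² ≥ 1/4, which restores κ. -/
lemma flat_of_remainder {A κ y t R : ℝ} (hA : 0 ≤ A) (hκ : 0 ≤ κ) (hy : y ≤ 1 / 2)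
    (hAy : 16 * A * y ≤ κ) (ht : t ∈ Icc 0 y) (h : |R - A * t ^ 2| ≤ κ / 8 * t ^ 2) :
    |R / (t * (1 - t)) - A * (t * (1 - t))| ≤ κ * (t * (1 - t)) := by
  rcases ht.1.eq_or_lt with h0 | h0
  · simp [← h0]
  have h1 : 1 / 2 ≤ 1 - t := by linarith [ht.2]
  have hu : 0 < t * (1 - t) := mul_pos h0 (by linarith)
  have e1 : R / (t * (1 - t)) - A * (t * (1 - t)) = (R - A * (t * (1 - t)) ^ 2) / (t * (1 - t)) := by
    field_simp
  rw [e1, abs_div, abs_of_pos hu]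
  refine div_le_of_le_sq hu.le ?_
  have e2 : R - A * (t * (1 - t)) ^ 2 = (R - A * t ^ 2) + A * t ^ 2 * (t * (2 - t)) := by ring
  have e4 : A * (t * (2 - t)) ≤ κ / 8 := by
    have : t * (2 - t) ≤ 2 * y := by nlinarith [ht.2]
    nlinarith [mul_le_mul_of_nonneg_left this hA]
  have e5 : (1 / 2) ^ 2 ≤ (1 - t) ^ 2 := by gcongr
  have e3 : 0 ≤ A * t ^ 2 * (t * (2 - t)) :=
    mul_nonneg (by positivity) (mul_nonneg h0.le (by linarith))
  rw [e2]
  refine (abs_add_le _ _).trans ?_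
  rw [abs_of_nonneg e3]
  calc |R - A * t ^ 2| + A * t ^ 2 * (t * (2 - t))
      ≤ κ / 8 * t ^ 2 + t ^ 2 * (κ / 8) := by
        have := mul_le_mul_of_nonneg_left e4 (sq_nonneg t)
        linarith
    _ = κ * (t ^ 2 * (1 / 2) ^ 2) := by ring
    _ ≤ κ * (t * (1 - t)) ^ 2 := by rw [mul_pow]; gcongr

set_option maxHeartbeats 800000 in
/-- Uniform properties of the profiles near the tangency points. -/
lemma IsMaxwell.exists_profile_bounds (hM : IsMaxwell F α₀ β₀ σ₀)
    (hF : IsFreeEnergy F αbar βbar) :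
    ∃ h > 0, h < α₀ ∧ ∃ c > 0, ∃ C ≥ 0, ∃ K ≥ 0,
      (∀ z ∈ Metric.closedBall (α₀, β₀) h, IsProfile c C (profile F z)) ∧
      (∀ z ∈ Metric.closedBall (α₀, β₀) h, ∀ z' ∈ Metric.closedBall (α₀, β₀) h,
        ∀ t ∈ Icc (0 : ℝ) 1,
          |profile F z t - profile F z' t| ≤ K * ‖z - z'‖ * (t * (1 - t))) ∧
      ∀ κ > 0, ∃ h' > 0, ∃ y ∈ Ioo (0 : ℝ) 1, ∀ z ∈ Metric.closedBall (α₀, β₀) h',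
        IsFlat ((β₀ - α₀) ^ 2 * deriv (deriv F) α₀ / 2) κ y (profile F z) ∧
        IsFlat ((β₀ - α₀) ^ 2 * deriv (deriv F) β₀ / 2) κ y (fun t => profile F z (1 - t)) := by
  have hα0 := hM.pos
  have hlt := hM.lt
  have hL : 0 < β₀ - α₀ := by linarith
  have hμ := hF.deriv2_pos_left hM
  have hν := hF.deriv2_pos_right hM
  set A := (β₀ - α₀) ^ 2 * deriv (deriv F) α₀ / 2 with hA
  set B := (β₀ - α₀) ^ 2 * deriv (deriv F) β₀ / 2 with hB
  have hA0 : 0 < A := by positivity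
  have hB0 : 0 < B := by positivity
  have hpos : ∀ z ∈ Metric.closedBall ((α₀, β₀) : ℝ × ℝ) (α₀ / 2), 0 < z.1 ∧ 0 < z.2 := by
    intro z hz
    rw [mem_closedBall_iff_norm, Prod.norm_def, max_le_iff] at hz
    simp only [Prod.fst_sub, Prod.snd_sub, Real.norm_eq_abs, abs_le] at hz
    exact ⟨by linarith [hz.1.1], by linarith [hz.2.1]⟩
  have hm : ∀ t ∈ Icc (0 : ℝ) 1, 1 - t ∈ Icc (0 : ℝ) 1 :=
    fun t ht => ⟨by linarith [ht.2], by linarith [ht.1]⟩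
  have hcpt : IsCompact (Metric.closedBall ((α₀, β₀) : ℝ × ℝ) (α₀ / 2) ×ˢ Icc (0 : ℝ) 1) :=
    (isCompact_closedBall _ _).prod isCompact_Icc
  have hcvx : Convex ℝ (Metric.closedBall ((α₀, β₀) : ℝ × ℝ) (α₀ / 2) ×ˢ Icc (0 : ℝ) 1) :=
    (convex_closedBall _ _).prod (convex_Icc _ _)
  have hC1 := hF.contDiffOn_remainder''.mono (s := _)
    (t := Metric.closedBall ((α₀, β₀) : ℝ × ℝ) (α₀ / 2) ×ˢ Icc (0 : ℝ) 1)
    fun x hx => ⟨(hpos _ hx.1).1, (hpos _ hx.1).2, hx.2⟩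
  obtain ⟨K, hK⟩ := hC1.exists_lipschitzOnWith one_ne_zero hcvx hcpt
  obtain ⟨M, hMb⟩ := hcpt.exists_bound_of_continuousOn hC1.continuousOn
  have hlip : ∀ z ∈ Metric.closedBall ((α₀, β₀) : ℝ × ℝ) (α₀ / 2), ∀ t ∈ Icc (0 : ℝ) 1,
      ∀ z' ∈ Metric.closedBall ((α₀, β₀) : ℝ × ℝ) (α₀ / 2), ∀ t' ∈ Icc (0 : ℝ) 1,
      |remainder'' F z t - remainder'' F z' t'| ≤ K * max ‖z - z'‖ |t - t'| := by
    intro z hz t ht z' hz' t' ht'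
    have := hK.norm_sub_le (x := (z, t)) ⟨hz, ht⟩ (y := (z', t')) ⟨hz', ht'⟩
    simpa [Prod.norm_def] using this
  have h00 : ((α₀, β₀) : ℝ × ℝ) ∈ Metric.closedBall ((α₀, β₀) : ℝ × ℝ) (α₀ / 2) :=
    Metric.mem_closedBall_self (by positivity)
  -- difference of remainders
  have hdiff : ∀ z ∈ Metric.closedBall ((α₀, β₀) : ℝ × ℝ) (α₀ / 2),
      ∀ z' ∈ Metric.closedBall ((α₀, β₀) : ℝ × ℝ) (α₀ / 2), ∀ t ∈ Icc (0 : ℝ) 1,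
      |remainder F z t - remainder F z' t| ≤ 4 * (K * ‖z - z'‖) * (t * (1 - t)) ^ 2 := by
    intro z hz z' hz'
    obtain ⟨p1, p2⟩ := hpos z hz
    obtain ⟨p1', p2'⟩ := hpos z' hz'
    -- A difference of remainders again has double zeros at both ends, so the Lipschitz bound on
    -- second derivatives transfers to it.
    refine abs_le_mul_sq_mul_sq (f := fun t => remainder F z t - remainder F z' t)
      (fun t ht => (hF.hasDerivAt_remainder p1 p2 ht).sub (hF.hasDerivAt_remainder p1' p2' ht))
      (fun t ht => (hF.hasDerivAt_remainder' p1 p2 ht).sub (hF.hasDerivAt_remainder' p1' p2' ht))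
      (by simp [remainder_zero]) (by simp [remainder'_zero]) (by simp [remainder_one])
      (by simp [remainder'_one]) fun t ht => ?_
    simpa using hlip z hz t ht z' hz' t ht
  -- flatness
  have r0 : remainder'' F (α₀, β₀) 0 = 2 * A := by
    simp only [remainder'', slopeL_eq_zero hM, slopeR_eq_zero hM, hA]
    ring_nf
  have r1 : remainder'' F (α₀, β₀) 1 = 2 * B := by
    simp only [remainder'', slopeL_eq_zero hM, slopeR_eq_zero hM, hB]
    ring_nf
  have hflat : ∀ κ > (0 : ℝ), ∀ y : ℝ, 0 < y → y ≤ 1 / 2 → K * y ≤ κ → ∀ h' : ℝ, h' ≤ α₀ / 2 → K * h' ≤ κ →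
      ∀ z ∈ Metric.closedBall ((α₀, β₀) : ℝ × ℝ) h', ∀ t ∈ Icc 0 y,
        |remainder F z t - A * t ^ 2| ≤ κ * t ^ 2 ∧
        |remainder F z (1 - t) - B * t ^ 2| ≤ κ * t ^ 2 := by
    intro κ hκ y hy hy2 hKy h' hh' hKh z hz
    have hz2 := Metric.closedBall_subset_closedBall hh' hz
    obtain ⟨p1, p2⟩ := hpos z hz2
    have hin : ∀ t ∈ Icc 0 y, t ∈ Icc (0 : ℝ) 1 := fun t ht => ⟨ht.1, by linarith [ht.2]⟩
    have hzn : ‖z - (α₀, β₀)‖ ≤ h' := mem_closedBall_iff_norm.1 hz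
    have hKm : ∀ t ∈ Icc 0 y, K * max ‖z - (α₀, β₀)‖ |t| ≤ κ := by
      intro t ht
      rcases max_choice ‖z - (α₀, β₀)‖ |t| with h | h <;> rw [h]
      · exact (mul_le_mul_of_nonneg_left hzn K.2).trans hKh
      · rw [abs_of_nonneg ht.1]
        exact (mul_le_mul_of_nonneg_left ht.2 K.2).trans hKy
    have dsq : ∀ (A t : ℝ), HasDerivAt (fun t : ℝ => A * t ^ 2) (2 * A * t) t := fun A t =>
      ((hasDerivAt_pow 2 t).const_mul A).congr_deriv (by push_cast; ring)
    have dlin : ∀ (A t : ℝ), HasDerivAt (fun t : ℝ => 2 * A * t) (2 * A) t := fun A t =>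
      ((hasDerivAt_id t).const_mul (2 * A)).congr_deriv (by ring)
    intro t ht
    constructor
    · refine abs_le_mul_sq (f := fun t => remainder F z t - A * t ^ 2)
        (fun t ht => (hF.hasDerivAt_remainder p1 p2 (hin t ht)).sub (dsq A t))
        (fun t ht => (hF.hasDerivAt_remainder' p1 p2 (hin t ht)).sub (dlin A t))
        (by simp [remainder_zero]) (by simp [remainder'_zero]) (fun t ht => ?_) t ht
      have := hlip z hz2 t (hin t ht) _ h00 0 (by simp)
      rw [r0, sub_zero] at this
      exact this.trans (hKm t ht)
    · refine abs_le_mul_sq (f := fun t => remainder F z (1 - t) - B * t ^ 2)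
        (fun t ht => (hasDerivAt_comp_one_sub
          (hF.hasDerivAt_remainder p1 p2 (hm t (hin t ht)))).sub (dsq B t))
        (fun t ht => ((hasDerivAt_comp_one_sub
          (hF.hasDerivAt_remainder' p1 p2 (hm t (hin t ht)))).neg).sub (dlin B t))
        (by simp [remainder_one]) (by simp [remainder'_one]) (fun t ht => ?_) t ht
      have := hlip z hz2 (1 - t) (hm t (hin t ht)) _ h00 1 (by simp)
      rw [r1, show 1 - t - 1 = -t by ring, abs_neg] at this
      rw [neg_neg]
      exact this.trans (hKm t ht)
  -- lower bound at the tangency points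
  have hKp : (0 : ℝ) ≤ K := K.2
  obtain ⟨c, hc, hlow⟩ : ∃ c > 0, ∀ t ∈ Icc (0 : ℝ) 1,
      c * (t * (1 - t)) ^ 2 ≤ remainder F (α₀, β₀) t := by
    set κ := min (A / 2) (B / 2) with hκ
    have hκ0 : 0 < κ := by positivity
    set y := min (1 / 2) (κ / (K + 1)) with hy
    have hy0 : 0 < y := by positivity
    have hy2 : y ≤ 1 / 2 := min_le_left _ _
    have hKy : K * y ≤ κ := by
      have : y ≤ κ / (K + 1) := min_le_right _ _
      rw [le_div_iff₀ (by positivity)] at this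
      linarith
    have hfl := hflat κ hκ0 y hy0 hy2 hKy 0 (by positivity) (by simpa using hκ0.le) _
      (Metric.mem_closedBall_self le_rfl)
    -- At the double tangent both end slopes vanish, so the remainder is the gap itself, positive
    -- inside. Compactness covers the middle and flatness the two ends.
    have hval : ∀ t ∈ Icc y (1 - y), 0 < remainder F (α₀, β₀) t := by
      intro t ht
      have e1 := hM.gibbs_lt hF (z := α₀ + t * (β₀ - α₀))
        ⟨by nlinarith [ht.1], by nlinarith [ht.2]⟩
      have e2 := hM.equal_area
      simp only [remainder, slopeL_eq_zero hM, slopeR_eq_zero hM, gap]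
      rw [e2]
      simp only [Gibbs] at e1
      linarith
    obtain ⟨t₀, ht₀, hmin⟩ := isCompact_Icc.exists_isMinOn (nonempty_Icc.2 (by linarith))
      ((hF.continuousOn_remainder (z := (α₀, β₀)) hα0 (hα0.trans hlt)).mono
        (Icc_subset_Icc hy0.le (by linarith) : Icc y (1 - y) ⊆ Icc 0 1))
    refine ⟨min κ (remainder F (α₀, β₀) t₀), lt_min hκ0 (hval t₀ ht₀), fun t ht => ?_⟩
    have ht1 : 0 ≤ 1 - t := by linarith [ht.2]
    rw [mul_pow]
    rcases le_total t y with h | h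
    · have := (abs_le.1 (hfl t ⟨ht.1, h⟩).1).1
      have h2 : κ ≤ A / 2 := min_le_left _ _
      have h3 : (1 - t) ^ 2 ≤ 1 := by nlinarith [ht.1]
      calc min κ _ * (t ^ 2 * (1 - t) ^ 2) ≤ κ * (t ^ 2 * 1) := by
            gcongr
            exact min_le_left _ _
        _ ≤ _ := by nlinarith [sq_nonneg t]
    rcases le_total t (1 - y) with h' | h'
    · have h2 : (t ^ 2 * (1 - t) ^ 2) ≤ 1 :=
        mul_le_one₀ (by nlinarith [ht.1, ht.2]) (sq_nonneg _) (by nlinarith [ht.1, ht.2])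
      have h3 := hval t₀ ht₀
      calc min κ (remainder F (α₀, β₀) t₀) * (t ^ 2 * (1 - t) ^ 2)
          ≤ remainder F (α₀, β₀) t₀ * 1 := by
            gcongr
            exact min_le_right _ _
        _ ≤ _ := by rw [mul_one]; exact hmin ⟨h, h'⟩
    · have := (abs_le.1 (hfl (1 - t) ⟨ht1, by linarith⟩).2).1
      rw [sub_sub_cancel] at this
      have h2 : κ ≤ B / 2 := min_le_right _ _
      have h3 : t ^ 2 ≤ 1 := by nlinarith [ht.1, ht.2]
      calc min κ _ * (t ^ 2 * (1 - t) ^ 2) ≤ κ * (1 * (1 - t) ^ 2) := by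
            gcongr
            exact min_le_left _ _
        _ ≤ _ := by nlinarith [sq_nonneg (1 - t)]
  -- Within this radius the remainder varies by at most c/2 times (t(1 − t))², so half of the lower
  -- bound at the double tangent survives.
  set h := min (α₀ / 2) (c / (8 * (K + 1))) with hh
  have hh0 : 0 < h := by positivity
  have hhα : h ≤ α₀ / 2 := min_le_left _ _
  have hsub : Metric.closedBall ((α₀, β₀) : ℝ × ℝ) h ⊆ Metric.closedBall (α₀, β₀) (α₀ / 2) :=
    Metric.closedBall_subset_closedBall hhα
  have hM0 : 0 ≤ M := (norm_nonneg _).trans (hMb ((α₀, β₀), 0) ⟨h00, by simp⟩)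
  refine ⟨h, hh0, by linarith, c / 2, by positivity, 4 * M, by positivity, 4 * K, by positivity,
    fun z hz => ?_, fun z hz z' hz' t ht => ?_, fun κ hκ => ?_⟩
  · obtain ⟨p1, p2⟩ := hpos z (hsub hz)
    refine isProfile_of_remainder (hF.continuousOn_remainder p1 p2) (fun t ht => ?_) ?_
    · have e1 := hdiff z (hsub hz) _ h00 t ht
      have e2 := hlow t ht
      have e3 : 4 * (K * ‖z - (α₀, β₀)‖) ≤ c / 2 := by
        have e4 : ‖z - (α₀, β₀)‖ ≤ c / (8 * (K + 1)) :=
          (mem_closedBall_iff_norm.1 hz).trans (min_le_right _ _)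
        rw [le_div_iff₀ (by positivity)] at e4
        nlinarith [norm_nonneg (z - (α₀, β₀))]
      have e5 := mul_le_mul_of_nonneg_right e3 (sq_nonneg (t * (1 - t)))
      have := (abs_le.1 e1).1
      linarith
    · exact abs_le_mul_sq_mul_sq (fun t ht => hF.hasDerivAt_remainder p1 p2 ht)
        (fun t ht => hF.hasDerivAt_remainder' p1 p2 ht) (remainder_zero _ _) (remainder'_zero _ _)
        (remainder_one _ _) (remainder'_one _ _) fun t ht => hMb (z, t) ⟨hsub hz, ht⟩
  · have hu : 0 ≤ t * (1 - t) := mul_nonneg ht.1 (by linarith [ht.2])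
    rw [profile, profile, ← sub_div, abs_div, abs_of_nonneg hu]
    refine div_le_of_le_sq hu ((hdiff z (hsub hz) z' (hsub hz') t ht).trans (le_of_eq (by ring)))
  · set y := min (1 / 2) (min (κ / (8 * (K + 1))) (min (κ / (16 * A)) (κ / (16 * B)))) with hy
    have hy0 : 0 < y := by positivity
    have hy2 : y ≤ 1 / 2 := min_le_left _ _
    have hy3 : y ≤ κ / (8 * (K + 1)) := (min_le_right _ _).trans (min_le_left _ _)
    have hy4 : y ≤ κ / (16 * A) :=
      (min_le_right _ _).trans ((min_le_right _ _).trans (min_le_left _ _))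
    have hy5 : y ≤ κ / (16 * B) :=
      (min_le_right _ _).trans ((min_le_right _ _).trans (min_le_right _ _))
    rw [le_div_iff₀ (by positivity)] at hy3 hy4 hy5
    have hh' : 0 < min (α₀ / 2) (κ / (8 * (K + 1))) := by positivity
    have hKh : K * min (α₀ / 2) (κ / (8 * (K + 1))) ≤ κ / 8 := by
      have : min (α₀ / 2) (κ / (8 * (K + 1))) ≤ κ / (8 * (K + 1)) := min_le_right _ _
      rw [le_div_iff₀ (by positivity)] at this
      linarith
    refine ⟨_, hh', y, ⟨hy0, by linarith⟩, fun z hz => ?_⟩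
    have H := hflat (κ / 8) (by positivity) y hy0 hy2 (by linarith) _ (min_le_left _ _) hKh z hz
    refine ⟨fun t ht => flat_of_remainder hA0.le hκ.le hy2 (by linarith) ht (H t ht).1,
      fun t ht => ?_⟩
    have := flat_of_remainder hB0.le hκ.le hy2 (by linarith) ht (H t ht).2
    simp only [profile]
    rw [sub_sub_cancel, mul_comm (1 - t) t]
    exact this

end

/-! ### From the time equations to a simple solution. -/

/-- The pair `(σ, b)` whose Gibbs function takes the value `b` at both points of `z`. -/
def pairOf (F : ℝ → ℝ) (z : ℝ × ℝ) : ℝ × ℝ :=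
  ((F z.2 - F z.1) / (z.2 - z.1), Gibbs F ((F z.2 - F z.1) / (z.2 - z.1)) z.1)

lemma gibbs_pairOf {F : ℝ → ℝ} {z : ℝ × ℝ} (hz : z.1 ≠ z.2) (t : ℝ) :
    Gibbs F (pairOf F z).1 (z.1 + t * (z.2 - z.1)) - (pairOf F z).2 = gap F z t := by
  have : z.2 - z.1 ≠ 0 := sub_ne_zero.2 hz.symm
  simp only [pairOf, Gibbs, gap]
  field_simp
  ring

lemma gap_sin_sq (F : ℝ → ℝ) (z : ℝ × ℝ) (φ : ℝ) :
    gap F z (Real.sin φ ^ 2) = (Real.sin φ * Real.cos φ) ^ 2 *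
      flux (profile F z) (slopeL F z) (slopeR F z) φ := by
  have hc := one_sub_sin_sq φ
  -- The end phases are separate because `profile` divides by t(1 − t).
  rcases eq_or_ne (Real.sin φ) 0 with h | h
  · simp [h, gap]
  rcases eq_or_ne (Real.cos φ) 0 with h' | h'
  · have : Real.sin φ ^ 2 = 1 := by rw [h'] at hc; linarith
    simp [h', gap, this]
  simp only [flux, profile, remainder, hc]
  field_simp
  ring

/-- The time that the profile spends before the phase `φ`, with weight `w`. -/
def clock (ε : ℝ) (n : ℝ → ℝ) (a b L : ℝ) (w : ℝ → ℝ) (φ : ℝ) : ℝ :=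
  ∫ θ in (0 : ℝ)..φ, w θ * (2 * L * slowness ε n a b θ)

section

variable {ε a b c C L : ℝ} {n : ℝ → ℝ}

lemma IsProfile.hasDerivAt_clock (h : IsProfile c C n) (hc : 0 < c) (hC : 0 ≤ C) (ha : 0 < a)
    (hb : 0 < b) (hε : ε ^ 2 * (a + b + C) < 1) (L : ℝ) {w : ℝ → ℝ} (hw : Continuous w) (φ : ℝ) :
    HasDerivAt (clock ε n a b L w) (w φ * (2 * L * slowness ε n a b φ)) φ := by
  have hs := h.continuous_slowness hc hC ha hb hε.le
  have hcont : Continuous fun θ => w θ * (2 * L * slowness ε n a b θ) := by fun_prop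
  exact intervalIntegral.integral_hasDerivAt_right (hcont.intervalIntegrable _ _)
    (hcont.stronglyMeasurableAtFilter _ _) hcont.continuousAt

lemma clock_cos_sq (ε : ℝ) (n : ℝ → ℝ) (a b L : ℝ) :
    clock ε n a b L (fun θ => Real.cos θ ^ 2) (Real.pi / 2) = 2 * L * leftTime ε n a b := by
  rw [clock, leftTime, ← intervalIntegral.integral_const_mul]
  congr 1; funext θ; ring

lemma clock_sin_sq (ε : ℝ) (n : ℝ → ℝ) (a b L : ℝ) :
    clock ε n a b L (fun θ => Real.sin θ ^ 2) (Real.pi / 2) = 2 * L * rightTime ε n a b := by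
  rw [clock, rightTime, ← intervalIntegral.integral_const_mul]
  congr 1; funext θ; ring

lemma IsProfile.clock_one (h : IsProfile c C n) (hc : 0 < c) (hC : 0 ≤ C) (ha : 0 < a)
    (hb : 0 < b) (hε : ε ^ 2 * (a + b + C) < 1) (L : ℝ) :
    clock ε n a b L (fun _ => 1) (Real.pi / 2) =
      2 * L * (leftTime ε n a b + rightTime ε n a b) := by
  have hs := h.continuous_slowness hc hC ha hb hε.le
  rw [mul_add, ← clock_cos_sq, ← clock_sin_sq, clock, clock, clock,
    ← intervalIntegral.integral_add (Continuous.intervalIntegrable (by fun_prop) _ _)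
      (Continuous.intervalIntegrable (by fun_prop) _ _)]
  congr 1; funext θ
  rw [← add_mul, Real.cos_sq_add_sin_sq]

lemma slowness_periodic (ε : ℝ) (n : ℝ → ℝ) (a b : ℝ) :
    Function.Periodic (slowness ε n a b) Real.pi := by
  intro φ
  simp [slowness, flux, Real.sin_add_pi, Real.cos_add_pi]

/-- The phase as a function of time. -/
lemma IsProfile.exists_phase (h : IsProfile c C n) (hc : 0 < c) (hC : 0 ≤ C) (ha : 0 < a)
    (hb : 0 < b) (hε : ε ^ 2 * (a + b + C) < 1) (hL : 0 < L) :
    ∃ ψ : ℝ → ℝ, StrictMono ψ ∧ ψ 0 = 0 ∧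
      ψ (2 * L * (leftTime ε n a b + rightTime ε n a b)) = Real.pi / 2 ∧
      ∀ y, HasDerivAt ψ (2 * L * slowness ε n a b (ψ y))⁻¹ y := by
  have hs := h.continuous_slowness hc hC ha hb hε.le
  have hpos : ∀ φ, 0 < 2 * L * slowness ε n a b φ := fun φ =>
    mul_pos (by positivity) (h.slowness_pos hc hC ha hb hε φ)
  have hd : ∀ φ, HasDerivAt (clock ε n a b L fun _ => 1) (2 * L * slowness ε n a b φ) φ :=
    fun φ => by
      simpa using h.hasDerivAt_clock hc hC ha hb hε L (w := fun _ => 1) continuous_const φ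
  have hmono : StrictMono (clock ε n a b L fun _ => 1) :=
    strictMono_of_hasDerivAt_pos hd hpos
  have hcont : Continuous (clock ε n a b L fun _ => 1) :=
    continuous_iff_continuousAt.2 fun φ => (hd φ).continuousAt
  have hper : Function.Periodic (fun θ => 1 * (2 * L * slowness ε n a b θ)) Real.pi := fun φ => by
    simp only [slowness_periodic ε n a b φ]
  have hint : ∀ t₁ t₂, IntervalIntegrable (fun θ => 1 * (2 * L * slowness ε n a b θ))
      MeasureTheory.volume t₁ t₂ := fun t₁ t₂ => Continuous.intervalIntegrable (by fun_prop) _ _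
  -- A positive periodic integrand makes the clock run to ±∞, so its inverse is defined on all of ℝ
  -- and end points need no special care.
  have hsurj : Function.Surjective (clock ε n a b L fun _ => 1) :=
    hcont.surjective
      (hper.tendsto_atTop_intervalIntegral_of_pos' (hint _ _) (by simpa using hpos) Real.pi_pos)
      (hper.tendsto_atBot_intervalIntegral_of_pos' (hint _ _) (by simpa using hpos) Real.pi_pos)
  set e := hmono.orderIsoOfSurjective _ hsurj with he
  have hee : ∀ φ, e φ = clock ε n a b L (fun _ => 1) φ := fun φ => rfl
  refine ⟨e.symm, e.symm.strictMono, ?_, ?_, fun y => ?_⟩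
  · rw [OrderIso.symm_apply_eq, hee]; simp [clock]
  · rw [OrderIso.symm_apply_eq, hee, h.clock_one hc hC ha hb hε]
  · exact HasDerivAt.of_local_left_inverse e.symm.continuous.continuousAt (hd _) (hpos _).ne'
      (Eventually.of_forall fun y => e.apply_symm_apply y)

end

section

variable {F : ℝ → ℝ} {αbar βbar ε r c C : ℝ} {z : ℝ × ℝ}

/-- The profile travelled at the right speed is a simple solution. -/
lemma IsFreeEnergy.exists_isSimpleSolution (hF : IsFreeEnergy F αbar βbar) (hz₁ : 0 < z.1)
    (hz : z.1 < z.2) (ha : 0 < slopeL F z) (hb : 0 < slopeR F z) (hc : 0 < c) (hC : 0 ≤ C)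
    (hn : IsProfile c C (profile F z)) (hε₀ : 0 < ε)
    (hε : ε ^ 2 * (slopeL F z + slopeR F z + C) < 1)
    (hl : leftTime ε (profile F z) (slopeL F z) (slopeR F z) = (z.2 - r) / (z.2 - z.1) ^ 2 / ε)
    (hr : rightTime ε (profile F z) (slopeL F z) (slopeR F z) = (r - z.1) / (z.2 - z.1) ^ 2 / ε) :
    ∃ u, IsSimpleSolution F ε r (pairOf F z) u ∧ u (-ε⁻¹) = z.1 ∧ u ε⁻¹ = z.2 := by
  set n := profile F z with hn_def
  set a := slopeL F z with ha_def
  set b := slopeR F z with hb_def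
  set L := z.2 - z.1 with hL_def
  have hL : 0 < L := sub_pos.2 hz
  have hei : 0 < ε⁻¹ := inv_pos.2 hε₀
  obtain ⟨ψ, hψm, hψ0, hψ1, hψd⟩ := hn.exists_phase hc hC ha hb hε hL
  have htot : 2 * L * (leftTime ε n a b + rightTime ε n a b) = ε⁻¹ + ε⁻¹ := by
    rw [hl, hr]
    field_simp
    rw [hL_def]; ring
  rw [htot] at hψ1
  have hs := hn.continuous_slowness hc hC ha hb hε.le
  have hspos := hn.slowness_pos hc hC ha hb hε
  have hψc : Continuous ψ := continuous_iff_continuousAt.2 fun y => (hψd y).continuousAt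
  have hψs : ∀ x, HasDerivAt (fun x => ψ (x + ε⁻¹)) (2 * L * slowness ε n a b (ψ (x + ε⁻¹)))⁻¹ x :=
    fun x => (hψd (x + ε⁻¹)).comp_add_const x ε⁻¹
  have hψl : ψ (-ε⁻¹ + ε⁻¹) = 0 := by rw [neg_add_cancel, hψ0]
  set u : ℝ → ℝ := fun x => z.1 + Real.sin (ψ (x + ε⁻¹)) ^ 2 * L with hu
  set v : ℝ → ℝ := fun x => Real.sin (ψ (x + ε⁻¹)) * Real.cos (ψ (x + ε⁻¹)) /
    slowness ε n a b (ψ (x + ε⁻¹)) with hv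
  have hud : ∀ x, HasDerivAt u (v x) x := by
    intro x
    have h1 := ((((Real.hasDerivAt_sin _).comp x (hψs x)).pow 2).mul_const L).const_add z.1
    refine h1.congr_deriv ?_
    have := (hspos (ψ (x + ε⁻¹))).ne'
    simp only [hv, Function.comp]
    generalize ψ (x + ε⁻¹) = θ at this
    field_simp
    norm_num
    ring
  have hderiv : deriv u = v := funext fun x => (hud x).deriv
  have hvc : Continuous v :=
    Continuous.div (by fun_prop) (by fun_prop) fun x => (hspos _).ne'
  have hu1 : ContDiff ℝ 1 u :=
    contDiff_one_iff_deriv.2 ⟨fun x => (hud x).differentiableAt, hderiv ▸ hvc⟩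
  have hul : u (-ε⁻¹) = z.1 := by simp [hu, hψ0]
  have hur : u ε⁻¹ = z.2 := by simp [hu, hψ1, hL_def]
  have hpos : ∀ x, 0 < u x := fun x => by positivity
  have hphase : ∀ x ∈ dom ε, ψ (x + ε⁻¹) ∈ Icc 0 (Real.pi / 2) := by
    intro x hx
    rw [← hψ1, ← hψl]
    exact ⟨hψm.monotone (by linarith [hx.1]), hψm.monotone (by linarith [hx.2])⟩
  have hphase' : ∀ x ∈ Ioo (-ε⁻¹) ε⁻¹, ψ (x + ε⁻¹) ∈ Ioo 0 (Real.pi / 2) := by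
    intro x hx
    rw [← hψ1, ← hψl]
    exact ⟨hψm (by linarith [hx.1]), hψm (by linarith [hx.2])⟩
  have hsc : ∀ x ∈ Ioo (-ε⁻¹) ε⁻¹, 0 < Real.sin (ψ (x + ε⁻¹)) * Real.cos (ψ (x + ε⁻¹)) := by
    intro x hx
    obtain ⟨h1, h2⟩ := hphase' x hx
    exact mul_pos (Real.sin_pos_of_pos_of_lt_pi h1 (by linarith [Real.pi_pos]))
      (Real.cos_pos_of_mem_Ioo ⟨by linarith, h2⟩)
  have hgap : ∀ x, Gibbs F (pairOf F z).1 (u x) - (pairOf F z).2 =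
      (Real.sin (ψ (x + ε⁻¹)) * Real.cos (ψ (x + ε⁻¹))) ^ 2 * flux n a b (ψ (x + ε⁻¹)) :=
    fun x => (gibbs_pairOf hz.ne _).trans (gap_sin_sq F z _)
  have hlt1 : ∀ x, ε ^ 2 * (Gibbs F (pairOf F z).1 (u x) - (pairOf F z).2) < 1 := by
    intro x
    rw [hgap, ← mul_assoc]
    exact (hn.mul_flux_le hc hC ha hb ε _).trans_lt hε
  have hgpos : ∀ x ∈ Ioo (-ε⁻¹) ε⁻¹, 0 < Gibbs F (pairOf F z).1 (u x) - (pairOf F z).2 := by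
    intro x hx
    rw [hgap]
    exact mul_pos (pow_pos (hsc x hx) 2) (hn.flux_pos hc ha hb _)
  have hvs : ∀ x ∈ Ioo (-ε⁻¹) ε⁻¹,
      v x = speed ε (Gibbs F (pairOf F z).1 (u x) - (pairOf F z).2) := by
    intro x hx
    have h1 := recip_mul_speed (ε := ε) (hsc x hx) (hn.flux_pos hc ha hb (ψ (x + ε⁻¹)))
      (by rw [← hgap]; exact hlt1 x)
    rw [hgap]
    simp only [hv]
    rw [div_eq_iff (hspos _).ne']
    exact h1.symm.trans (mul_comm _ _)
  have hfi : ∀ x ∈ Ioo (-ε⁻¹) ε⁻¹,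
      P ε (v x) = Gibbs F (pairOf F z).1 (u x) - (pairOf F z).2 := by
    intro x hx
    rw [hvs x hx, P_speed hε₀.ne' (hgpos x hx).le (hlt1 x)]
  have hgc : ContDiffOn ℝ 1 (fun x => Gibbs F (pairOf F z).1 (u x) - (pairOf F z).2)
      (Ioo (-ε⁻¹) ε⁻¹) := by
    have h1 : ContDiffOn ℝ 1 (fun x => F (u x)) (Ioo (-ε⁻¹) ε⁻¹) :=
      (hF.contDiffOn.of_le (by norm_num)).comp hu1.contDiffOn fun x _ => hpos x
    exact (h1.sub (contDiffOn_const.mul hu1.contDiffOn)).sub contDiffOn_const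
  -- The profile is only known to be continuous, so differentiability of the velocity comes from
  -- rewriting it as the speed of the gap. The square root is smooth in the open interval, where the
  -- gap is positive.
  have hvC1 : ContDiffOn ℝ 1 v (Ioo (-ε⁻¹) ε⁻¹) := by
    refine ContDiffOn.congr ?_ hvs
    unfold speed
    have h1 := contDiffOn_const (c := (2 : ℝ)).sub
      ((contDiffOn_const (c := ε ^ 2)).mul hgc)
    refine ((hgc.mul h1).sqrt fun x hx => ?_).div
      (contDiffOn_const.sub (contDiffOn_const.mul hgc)) fun x _ => ?_
    · exact (mul_pos (hgpos x hx) (by linarith [hlt1 x])).ne'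
    · exact (by linarith [hlt1 x] : (0 : ℝ) < 1 - ε ^ 2 * _).ne'
  have hnt : (-ε⁻¹) < ε⁻¹ := by linarith
  -- Change of variables: the clock with weight w, composed with the phase, is a primitive of w
  -- along the solution.
  have hmass : ∀ w : ℝ → ℝ, Continuous w → ∫ x in (-ε⁻¹)..ε⁻¹, w (ψ (x + ε⁻¹)) =
      clock ε n a b L w (Real.pi / 2) := by
    intro w hw
    have h1 : ∀ x, HasDerivAt (fun x => clock ε n a b L w (ψ (x + ε⁻¹))) (w (ψ (x + ε⁻¹))) x := by
      intro x
      have := (hspos (ψ (x + ε⁻¹))).ne'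
      refine ((hn.hasDerivAt_clock hc hC ha hb hε L hw _).comp x (hψs x)).congr_deriv ?_
      generalize ψ (x + ε⁻¹) = θ at this
      field_simp
    rw [intervalIntegral.integral_eq_sub_of_hasDerivAt (fun x _ => h1 x)
      (Continuous.intervalIntegrable (by fun_prop) _ _), hψl, hψ1]
    simp [clock]
  refine ⟨u, ⟨⟨fun x _ => hpos x, hu1.contDiffOn, ?_, fun x hx => ?_, ?_, ?_, ?_⟩, ?_, ?_⟩, hul, hur⟩
  · rw [show (2 : WithTop ℕ∞) = 1 + 1 from one_add_one_eq_two.symm,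
      contDiffOn_succ_iff_deriv_of_isOpen isOpen_Ioo, hderiv]
    exact ⟨hu1.differentiable one_ne_zero |>.differentiableOn, by simp, hvC1⟩
  · rw [hderiv]
    have hmem : Ioo (-ε⁻¹) ε⁻¹ ∈ 𝓝 x := isOpen_Ioo.mem_nhds hx
    have h1 : HasDerivAt v (deriv v x) x :=
      ((hvC1.contDiffAt hmem).differentiableAt one_ne_zero).hasDerivAt
    have h2 := (hasDerivAt_P ε (v x)).comp x h1
    have h3 := ((hF.hasDerivAt_gibbs (pairOf F z).1 (hpos x)).comp x (hud x)).sub_const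
      (pairOf F z).2
    -- Differentiating the first integral yields the equation multiplied by the velocity, which is
    -- positive here and can be cancelled.
    have h4 := h2.unique (h3.congr_of_eventuallyEq
      (by filter_upwards [hmem] with y hy using hfi y hy))
    have h5 : 0 < v x := div_pos (hsc x hx) (hspos _)
    apply mul_right_cancel₀ h5.ne'
    linarith
  · rw [dom, ((hud _).hasDerivWithinAt).derivWithin (uniqueDiffOn_Icc hnt _ (left_mem_Icc.2 hnt.le))]
    simp [hv, hψ0]
  · rw [dom, ((hud _).hasDerivWithinAt).derivWithin (uniqueDiffOn_Icc hnt _ (right_mem_Icc.2 hnt.le))]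
    simp [hv, hψ1]
  · have hz2 : ∀ θ, z.1 + Real.sin θ ^ 2 * L = z.1 * 1 + L * Real.sin θ ^ 2 := fun θ => by ring
    have h1 := hmass (fun θ => z.1 * 1 + L * Real.sin θ ^ 2) (by fun_prop)
    simp only [hu, hz2]
    rw [h1]
    have h2 : clock ε n a b L (fun θ => z.1 * 1 + L * Real.sin θ ^ 2) (Real.pi / 2) =
        z.1 * clock ε n a b L (fun _ => 1) (Real.pi / 2) +
          L * clock ε n a b L (fun θ => Real.sin θ ^ 2) (Real.pi / 2) := by
      rw [clock, clock, clock, ← intervalIntegral.integral_const_mul,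
        ← intervalIntegral.integral_const_mul, ← intervalIntegral.integral_add
          (Continuous.intervalIntegrable (by fun_prop) _ _)
          (Continuous.intervalIntegrable (by fun_prop) _ _)]
      congr 1; funext θ; ring
    rw [h2, hn.clock_one hc hC ha hb hε, clock_sin_sq, htot, hr]
    field_simp
    ring
  · intro x hx y hy hxy
    obtain ⟨h1, -⟩ := hphase x hx
    obtain ⟨h3, h4⟩ := hphase y hy
    have h5 : Real.sin (ψ (x + ε⁻¹)) < Real.sin (ψ (y + ε⁻¹)) :=
      Real.sin_lt_sin_of_lt_of_le_pi_div_two (by linarith [Real.pi_pos]) h4 (hψm (by linarith))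
    have h6 : 0 ≤ Real.sin (ψ (x + ε⁻¹)) :=
      Real.sin_nonneg_of_nonneg_of_le_pi h1 (by linarith [(hphase x hx).2, Real.pi_pos])
    simp only [hu]
    gcongr
  · intro x hx
    rw [hderiv]
    exact hfi x hx

end

/-! ### Every simple solution satisfies the time equations. -/

/-- Grönwall's inequality with zero initial value: multiplied by the integrating factor e^(-Mt), the
function is nonincreasing. -/
lemma nonpos_of_deriv_le_mul {f f' : ℝ → ℝ} {M x y : ℝ} (hxy : x ≤ y)
    (hc : ContinuousOn f (Icc x y)) (hd : ∀ t ∈ Ioo x y, HasDerivAt f (f' t) t)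
    (hb : ∀ t ∈ Ioo x y, f' t ≤ M * f t) (h0 : f x = 0) : f y ≤ 0 := by
  have hg : AntitoneOn (fun t => f t * Real.exp (-(M * t))) (Icc x y) := by
    refine antitoneOn_of_hasDerivWithinAt_nonpos (convex_Icc x y) (hc.mul (by fun_prop))
      (f' := fun t => (f' t - M * f t) * Real.exp (-(M * t))) (fun t ht => ?_) fun t ht => ?_
    · rw [interior_Icc] at ht
      have h1 : HasDerivAt (fun t : ℝ => Real.exp (-(M * t))) (Real.exp (-(M * t)) * -M) t := by
        simpa using (((hasDerivAt_id t).const_mul M).neg).exp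
      exact (((hd t ht).mul h1).congr_deriv (by ring)).hasDerivWithinAt
    · rw [interior_Icc] at ht
      exact mul_nonpos_of_nonpos_of_nonneg (by linarith [hb t ht]) (Real.exp_pos _).le
  have := hg (left_mem_Icc.2 hxy) (right_mem_Icc.2 hxy) hxy
  simp only [h0, zero_mul] at this
  exact nonpos_of_mul_nonpos_left this (Real.exp_pos _)

lemma deriv_nonneg_of_le_right {f : ℝ → ℝ} {d x y : ℝ} (hxy : x < y) (hd : HasDerivAt f d x)
    (h : ∀ t ∈ Ioo x y, f x ≤ f t) : 0 ≤ d := by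
  have h1 := (hasDerivWithinAt_iff_tendsto_slope' (notMem_Ioi.2 le_rfl)).1
    (hd.hasDerivWithinAt (s := Ioi x))
  refine ge_of_tendsto h1 ?_
  filter_upwards [Ioo_mem_nhdsGT hxy] with t ht
  rw [slope_def_field]
  exact div_nonneg (by linarith [h t ht]) (by linarith [ht.1])

lemma deriv_nonpos_of_le_left {f : ℝ → ℝ} {d x y : ℝ} (hxy : x < y) (hd : HasDerivAt f d y)
    (h : ∀ t ∈ Ioo x y, f y ≤ f t) : d ≤ 0 := by
  have h1 := (hasDerivWithinAt_iff_tendsto_slope' (notMem_Iio.2 le_rfl)).1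
    (hd.hasDerivWithinAt (s := Iio y))
  refine le_of_tendsto h1 ?_
  filter_upwards [Ioo_mem_nhdsLT hxy] with t ht
  rw [slope_def_field]
  exact div_nonpos_of_nonneg_of_nonpos (by linarith [h t ht]) (by linarith [ht.2])

section

variable {F : ℝ → ℝ} {αbar βbar ε r : ℝ} {Δ : ℝ × ℝ} {u : ℝ → ℝ}

/-- Quadratic bound for the Gibbs function near a degenerate zero of `Φ_σ - b`. -/
lemma IsFreeEnergy.exists_quadratic_bound (hF : IsFreeEnergy F αbar βbar) {z₁ z₂ Z : ℝ}
    (hz₁ : 0 < z₁) (hZ : Z ∈ Icc z₁ z₂) (h0 : Gibbs F Δ.1 Z = Δ.2) (h1 : deriv F Z = Δ.1) :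
    ∃ K ≥ 0, ∀ y ∈ Icc z₁ z₂, |Gibbs F Δ.1 y - Δ.2| ≤ K * (y - Z) ^ 2 := by
  have hpos : ∀ y ∈ Icc z₁ z₂, 0 < y := fun y hy => hz₁.trans_le hy.1
  obtain ⟨K, hK⟩ := isCompact_Icc.exists_bound_of_continuousOn
    (hF.contDiffOn_deriv2.continuousOn.mono (s := Ioi 0) (t := Icc z₁ z₂) hpos)
  refine ⟨K, (norm_nonneg _).trans (hK Z hZ), fun y hy => ?_⟩
  have hsub : uIcc Z y ⊆ Icc z₁ z₂ := ordConnected_Icc.uIcc_subset hZ hy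
  have e1 : ∀ s ∈ uIcc Z y, ‖deriv F s - Δ.1‖ ≤ K * |y - Z| := by
    intro s hs
    have := (convex_Icc z₁ z₂).norm_image_sub_le_of_norm_hasDerivWithin_le
      (fun w hw => (hF.hasDerivAt_deriv (hpos w hw)).hasDerivWithinAt) hK hZ (hsub hs)
    rw [h1] at this
    refine this.trans (mul_le_mul_of_nonneg_left ?_ ((norm_nonneg _).trans (hK Z hZ)))
    exact abs_sub_left_of_mem_uIcc hs
  have := (convex_uIcc Z y).norm_image_sub_le_of_norm_hasDerivWithin_le
    (fun w hw => (hF.hasDerivAt_gibbs Δ.1 (hpos w (hsub hw))).hasDerivWithinAt) e1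
    left_mem_uIcc right_mem_uIcc
  rw [h0, Real.norm_eq_abs, Real.norm_eq_abs] at this
  refine this.trans (le_of_eq ?_)
  rw [mul_assoc, ← sq, sq_abs]

lemma neg_inv_lt_inv (hε : 0 < ε) : -ε⁻¹ < ε⁻¹ := by
  have := inv_pos.2 hε
  linarith

lemma IsSimpleSolution.hasDerivAt (hu : IsSimpleSolution F ε r Δ u) {x : ℝ}
    (hx : x ∈ Ioo (-ε⁻¹) ε⁻¹) : HasDerivAt u (derivWithin u (dom ε) x) x := by
  have hmem : dom ε ∈ 𝓝 x := Icc_mem_nhds hx.1 hx.2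
  have := (hu.solution.contDiffOn_closed.contDiffAt hmem).differentiableAt one_ne_zero
  rw [derivWithin_of_mem_nhds hmem]
  exact this.hasDerivAt

/-- The first integral holds up to the end points. -/
lemma IsSimpleSolution.first_integral_closed (hF : IsFreeEnergy F αbar βbar) (hε : 0 < ε)
    (hu : IsSimpleSolution F ε r Δ u) {x : ℝ} (hx : x ∈ dom ε) :
    P ε (derivWithin u (dom ε) x) = Gibbs F Δ.1 (u x) - Δ.2 := by
  have hlt := neg_inv_lt_inv hε
  have hc := hu.solution.contDiffOn_closed.continuousOn
  have hv := hu.solution.contDiffOn_closed.continuousOn_derivWithin (uniqueDiffOn_Icc hlt) le_rfl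
  refine EqOn.of_subset_closure (s := Ioo (-ε⁻¹) ε⁻¹) (t := dom ε)
    (f := fun x => P ε (derivWithin u (dom ε) x)) (g := fun x => Gibbs F Δ.1 (u x) - Δ.2)
    (fun y hy => ?_) ?_ ?_ Ioo_subset_Icc_self (by rw [closure_Ioo hlt.ne, dom]) hx
  · have := hu.first_integral y hy
    rwa [(hu.hasDerivAt hy).deriv] at this
  · have hPc : Continuous (P ε) :=
      continuous_iff_continuousAt.2 fun s => (hasDerivAt_P ε s).continuousAt
    exact hPc.comp_continuousOn hv
  · have h1 : ContinuousOn (fun x => F (u x)) (dom ε) :=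
      hF.contDiffOn.continuousOn.comp hc fun y hy => hu.solution.pos y hy
    exact (h1.sub (continuousOn_const.mul hc)).sub continuousOn_const

lemma IsSimpleSolution.derivWithin_nonneg (hu : IsSimpleSolution F ε r Δ u) (x : ℝ) :
    0 ≤ derivWithin u (dom ε) x :=
  hu.strictMono.monotoneOn.derivWithin_nonneg

/-- A simple solution never meets an equilibrium. -/
lemma IsSimpleSolution.not_equilibrium (hF : IsFreeEnergy F αbar βbar) (hε : 0 < ε)
    (hu : IsSimpleSolution F ε r Δ u) {x₀ : ℝ} (hx₀ : x₀ ∈ dom ε)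
    (h0 : Gibbs F Δ.1 (u x₀) = Δ.2) : deriv F (u x₀) ≠ Δ.1 := by
  intro h1
  have hlt := neg_inv_lt_inv hε
  have hl : -ε⁻¹ ∈ dom ε := left_mem_Icc.2 hlt.le
  have hr : ε⁻¹ ∈ dom ε := right_mem_Icc.2 hlt.le
  have hmono := hu.strictMono.monotoneOn
  have hc := hu.solution.contDiffOn_closed.continuousOn
  have hv := hu.solution.contDiffOn_closed.continuousOn_derivWithin (uniqueDiffOn_Icc hlt) le_rfl
  have hrange : ∀ x ∈ dom ε, u x ∈ Icc (u (-ε⁻¹)) (u ε⁻¹) :=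
    fun x hx => ⟨hmono hl hx hx.1, hmono hx hr hx.2⟩
  obtain ⟨K, hK, hquad⟩ := hF.exists_quadratic_bound (hu.solution.pos _ hl) (hrange x₀ hx₀) h0 h1
  obtain ⟨S, hS⟩ := isCompact_Icc.exists_bound_of_continuousOn hv
  have hD : 0 ≤ 2 * (1 + (ε * S) ^ 2) * K := by positivity
  set M := √(2 * (1 + (ε * S) ^ 2) * K) with hM
  -- Near an equilibrium the gap is quadratic in u − u(x₀), and `P ε` is quadratic in the slope, so
  -- the velocity is at most linear in the distance.
  have hbound : ∀ x ∈ dom ε, derivWithin u (dom ε) x ≤ M * |u x - u x₀| := by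
    intro x hx
    have e1 := sq_le_of_P hε.ne' (hu.derivWithin_nonneg x) ((le_abs_self _).trans (hS x hx))
    rw [hu.first_integral_closed hF hε hx] at e1
    refine abs_le_of_sq_le_sq' ?_ (by positivity) |>.2
    rw [mul_pow, hM, Real.sq_sqrt hD, sq_abs]
    calc _ ≤ _ := e1
      _ ≤ 2 * (1 + (ε * S) ^ 2) * (K * (u x - u x₀) ^ 2) := by
        gcongr
        exact (le_abs_self _).trans (hquad _ (hrange x hx))
      _ = _ := by ring
  -- Grönwall forward from x₀ contradicts strict monotonicity; if x₀ is the right end, time is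
  -- reversed.
  rcases hx₀.2.eq_or_lt with he | he
  · subst he
    have hmaps : ∀ t ∈ Ioo (-ε⁻¹) ε⁻¹, -t ∈ Ioo (-ε⁻¹) ε⁻¹ :=
      fun t ht => ⟨by linarith [ht.2], by linarith [ht.1]⟩
    have hmaps' : ∀ t ∈ Icc (-ε⁻¹) ε⁻¹, -t ∈ dom ε :=
      fun t ht => ⟨by linarith [ht.2], by linarith [ht.1]⟩
    have := nonpos_of_deriv_le_mul (f := fun t => u ε⁻¹ - u (-t))
      (f' := fun t => derivWithin u (dom ε) (-t)) (M := M) hlt.le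
      (continuousOn_const.sub (hc.comp (by fun_prop) hmaps'))
      (fun t ht => by
        have := ((hu.hasDerivAt (hmaps t ht)).comp t (hasDerivAt_neg t)).const_sub (u ε⁻¹)
        exact this.congr_deriv (by ring))
      (fun t ht => by
        have h2 := Ioo_subset_Icc_self (hmaps t ht)
        have := hbound (-t) h2
        rwa [abs_sub_comm, abs_of_nonneg (sub_nonneg.2 (hmono h2 hr h2.2))] at this)
      (by simp)
    have h3 := hu.strictMono hl hr hlt
    linarith
  · have hsub : Icc x₀ ε⁻¹ ⊆ dom ε := Icc_subset_Icc_left hx₀.1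
    have := nonpos_of_deriv_le_mul (f := fun t => u t - u x₀)
      (f' := fun t => derivWithin u (dom ε) t) (M := M) he.le
      ((hc.mono hsub).sub continuousOn_const)
      (fun t ht => (hu.hasDerivAt ⟨hx₀.1.trans_lt ht.1, ht.2⟩).sub_const _)
      (fun t ht => by
        have h2 := hsub (Ioo_subset_Icc_self ht)
        have := hbound t h2
        rwa [abs_of_nonneg (sub_nonneg.2 (hmono hx₀ h2 ht.1.le))] at this)
      (by simp)
    have h3 := hu.strictMono hx₀ hr he
    linarith

lemma IsSimpleSolution.exists_eq (hε : 0 < ε) (hu : IsSimpleSolution F ε r Δ u) {s : ℝ}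
    (hs : s ∈ Ioo (u (-ε⁻¹)) (u ε⁻¹)) : ∃ x ∈ Ioo (-ε⁻¹) ε⁻¹, u x = s :=
  intermediate_value_Ioo (neg_inv_lt_inv hε).le hu.solution.contDiffOn_closed.continuousOn hs

/-- Since `P ε` is nonnegative, equality would make u x an interior minimum of the Gibbs function
over the range of u, hence an equilibrium. -/
lemma IsSimpleSolution.gibbs_gt (hF : IsFreeEnergy F αbar βbar) (hε : 0 < ε)
    (hu : IsSimpleSolution F ε r Δ u) {x : ℝ} (hx : x ∈ Ioo (-ε⁻¹) ε⁻¹) :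
    Δ.2 < Gibbs F Δ.1 (u x) := by
  have hlt := neg_inv_lt_inv hε
  have hx' : x ∈ dom ε := Ioo_subset_Icc_self hx
  have hge : ∀ y ∈ dom ε, Δ.2 ≤ Gibbs F Δ.1 (u y) := by
    intro y hy
    have h1 := hu.first_integral_closed hF hε hy
    have h2 := P_nonneg hε.ne' (derivWithin u (dom ε) y)
    linarith
  refine (hge x hx').lt_of_ne fun heq => ?_
  refine hu.not_equilibrium hF hε hx' heq.symm ?_
  have hmem : Ioo (u (-ε⁻¹)) (u ε⁻¹) ∈ 𝓝 (u x) :=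
    Ioo_mem_nhds (hu.strictMono (left_mem_Icc.2 hlt.le) hx' hx.1)
      (hu.strictMono hx' (right_mem_Icc.2 hlt.le) hx.2)
  have hmin : IsLocalMin (Gibbs F Δ.1) (u x) := by
    filter_upwards [hmem] with s hs
    obtain ⟨y, hy, rfl⟩ := hu.exists_eq hε hs
    rw [← heq]
    exact hge y (Ioo_subset_Icc_self hy)
  have := hmin.hasDerivAt_eq_zero (hF.hasDerivAt_gibbs Δ.1 (hu.solution.pos x hx'))
  linarith

/-- The end values of a simple solution are the turning points of its pair. -/
lemma IsSimpleSolution.isTurningPair (hF : IsFreeEnergy F αbar βbar) (hε : 0 < ε)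
    (hu : IsSimpleSolution F ε r Δ u) : IsTurningPair F Δ (u (-ε⁻¹)) (u ε⁻¹) := by
  have hlt := neg_inv_lt_inv hε
  have hl : -ε⁻¹ ∈ dom ε := left_mem_Icc.2 hlt.le
  have hr : ε⁻¹ ∈ dom ε := right_mem_Icc.2 hlt.le
  refine ⟨hu.solution.pos _ hl, hu.strictMono hl hr hlt, ?_, ?_, fun s hs => ?_⟩
  · have := hu.first_integral_closed hF hε hl
    rw [hu.solution.neumann_left, P_zero] at this
    linarith
  · have := hu.first_integral_closed hF hε hr
    rw [hu.solution.neumann_right, P_zero] at this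
    linarith
  · obtain ⟨x, hx, rfl⟩ := hu.exists_eq hε hs
    exact hu.gibbs_gt hF hε hx

lemma IsTurningPair.eq_pairOf {z₁ z₂ : ℝ} (h : IsTurningPair F Δ z₁ z₂) :
    Δ = pairOf F (z₁, z₂) := by
  have h1 := h.left
  have h2 := h.right
  have h3 : z₂ - z₁ ≠ 0 := (sub_pos.2 h.lt).ne'
  have h4 : Δ.1 = (F z₂ - F z₁) / (z₂ - z₁) := by
    rw [eq_div_iff h3]
    simp only [Gibbs] at h1 h2
    linarith
  refine Prod.ext h4 ?_
  rw [← h1, h4, pairOf]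

/-- The Gibbs function exceeds its end values in between, which gives the weak signs; they are
strict because the ends are not equilibria. -/
lemma IsSimpleSolution.slopes_pos (hF : IsFreeEnergy F αbar βbar) (hε : 0 < ε)
    (hu : IsSimpleSolution F ε r Δ u) :
    0 < slopeL F (u (-ε⁻¹), u ε⁻¹) ∧ 0 < slopeR F (u (-ε⁻¹), u ε⁻¹) := by
  have hlt := neg_inv_lt_inv hε
  have hl : -ε⁻¹ ∈ dom ε := left_mem_Icc.2 hlt.le
  have hr : ε⁻¹ ∈ dom ε := right_mem_Icc.2 hlt.le
  have ht := hu.isTurningPair hF hε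
  have hL : 0 < u ε⁻¹ - u (-ε⁻¹) := sub_pos.2 ht.lt
  have hF1 : F (u ε⁻¹) - F (u (-ε⁻¹)) = Δ.1 * (u ε⁻¹ - u (-ε⁻¹)) := by
    have h1 := ht.left
    have h2 := ht.right
    simp only [Gibbs] at h1 h2
    linarith
  have d1 := deriv_nonneg_of_le_right ht.lt (hF.hasDerivAt_gibbs Δ.1 (hu.solution.pos _ hl))
    fun s hs => by rw [ht.left]; exact (ht.between s hs).le
  have d2 := deriv_nonpos_of_le_left ht.lt (hF.hasDerivAt_gibbs Δ.1 (hu.solution.pos _ hr))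
    fun s hs => by rw [ht.right]; exact (ht.between s hs).le
  have n1 := hu.not_equilibrium hF hε hl ht.left
  have n2 := hu.not_equilibrium hF hε hr ht.right
  have p1 : 0 < deriv F (u (-ε⁻¹)) - Δ.1 := d1.lt_of_ne (sub_ne_zero.2 n1).symm
  have p2 : 0 < Δ.1 - deriv F (u ε⁻¹) := by
    have := d2.lt_of_ne (sub_ne_zero.2 n2)
    linarith
  constructor
  · simp only [slopeL, hF1]
    have := mul_pos p1 hL
    linarith
  · simp only [slopeR, hF1]
    have := mul_pos p2 hL
    linarith

/-- The phase of a value between the turning points. -/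
def phase (z : ℝ × ℝ) (y : ℝ) : ℝ := Real.arcsin √((y - z.1) / (z.2 - z.1))

lemma sin_phase_sq {z : ℝ × ℝ} {y : ℝ} (hz : z.1 < z.2) (hy : y ∈ Icc z.1 z.2) :
    Real.sin (phase z y) ^ 2 = (y - z.1) / (z.2 - z.1) := by
  have hL : 0 < z.2 - z.1 := sub_pos.2 hz
  have h0 : 0 ≤ (y - z.1) / (z.2 - z.1) := div_nonneg (by linarith [hy.1]) hL.le
  have h1 : (y - z.1) / (z.2 - z.1) ≤ 1 := by rw [div_le_one hL]; linarith [hy.2]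
  rw [phase, Real.sin_arcsin (by linarith [Real.sqrt_nonneg ((y - z.1) / (z.2 - z.1))])
    (Real.sqrt_le_one.2 h1), Real.sq_sqrt h0]

lemma eq_of_phase {z : ℝ × ℝ} {y : ℝ} (hz : z.1 < z.2) (hy : y ∈ Icc z.1 z.2) :
    y = z.1 + Real.sin (phase z y) ^ 2 * (z.2 - z.1) := by
  have hL : z.2 - z.1 ≠ 0 := (sub_pos.2 hz).ne'
  rw [sin_phase_sq hz hy, div_mul_cancel₀ _ hL]; ring

lemma phase_left (z : ℝ × ℝ) : phase z z.1 = 0 := by simp [phase]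

lemma phase_right {z : ℝ × ℝ} (hz : z.1 < z.2) : phase z z.2 = Real.pi / 2 := by
  rw [phase, div_self (sub_pos.2 hz).ne', Real.sqrt_one, Real.arcsin_one]

lemma continuous_phase (z : ℝ × ℝ) : Continuous (phase z) := by
  unfold phase
  exact Real.continuous_arcsin.comp (by fun_prop)

lemma hasDerivAt_phase {z : ℝ × ℝ} {y : ℝ} (hy : y ∈ Ioo z.1 z.2) :
    0 < Real.sin (phase z y) * Real.cos (phase z y) ∧
      HasDerivAt (phase z)
        (2 * (z.2 - z.1) * (Real.sin (phase z y) * Real.cos (phase z y)))⁻¹ y := by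
  have hL : 0 < z.2 - z.1 := by linarith [hy.1, hy.2]
  set τ := (y - z.1) / (z.2 - z.1) with hτ
  have h0 : 0 < τ := div_pos (by linarith [hy.1]) hL
  have h1 : τ < 1 := by rw [hτ, div_lt_one hL]; linarith [hy.2]
  have hs0 : 0 < √τ := Real.sqrt_pos.2 h0
  have hs1 : √τ < 1 := by rw [Real.sqrt_lt' one_pos]; simpa using h1
  have hsin : Real.sin (phase z y) = √τ := Real.sin_arcsin (by linarith) hs1.le
  have hcos : Real.cos (phase z y) = √(1 - √τ ^ 2) := by rw [phase, ← hτ, Real.cos_arcsin]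
  have hc0 : 0 < √(1 - √τ ^ 2) := Real.sqrt_pos.2 (by rw [Real.sq_sqrt h0.le]; linarith)
  rw [hsin, hcos]
  refine ⟨by positivity, ?_⟩
  have e1 : HasDerivAt (fun y : ℝ => (y - z.1) / (z.2 - z.1)) (1 / (z.2 - z.1)) y :=
    ((hasDerivAt_id y).sub_const _).div_const _
  have e2 := e1.sqrt h0.ne'
  have e3 := (Real.hasDerivAt_arcsin (by rw [← hτ]; linarith) (by rw [← hτ]; exact hs1.ne)).comp y e2
  refine e3.congr_deriv ?_
  rw [← hτ]
  field_simp

variable {c C : ℝ}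

/-- Integrals of functions of the phase along a simple solution. -/
lemma IsSimpleSolution.integral_phase (hF : IsFreeEnergy F αbar βbar) (hε₀ : 0 < ε)
    (hu : IsSimpleSolution F ε r Δ u) {z : ℝ × ℝ} (hz : z = (u (-ε⁻¹), u ε⁻¹)) (hc : 0 < c)
    (hC : 0 ≤ C) (hn : IsProfile c C (profile F z))
    (hε : ε ^ 2 * (slopeL F z + slopeR F z + C) < 1) {w : ℝ → ℝ} (hw : Continuous w) {x : ℝ}
    (hx : x ∈ dom ε) :
    ∫ y in (-ε⁻¹)..x, w (phase z (u y)) =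
      clock ε (profile F z) (slopeL F z) (slopeR F z) (z.2 - z.1) w (phase z (u x)) := by
  have hlt := neg_inv_lt_inv hε₀
  have hl : -ε⁻¹ ∈ dom ε := left_mem_Icc.2 hlt.le
  have hr : ε⁻¹ ∈ dom ε := right_mem_Icc.2 hlt.le
  have ht := hu.isTurningPair hF hε₀
  have hpair : Δ = pairOf F z := by rw [hz]; exact ht.eq_pairOf
  obtain ⟨ha, hb⟩ := hu.slopes_pos hF hε₀
  rw [← hz] at ha hb
  have hz1 : z.1 = u (-ε⁻¹) := by rw [hz]
  have hz2 : z.2 = u ε⁻¹ := by rw [hz]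
  have hzlt : z.1 < z.2 := by rw [hz1, hz2]; exact ht.lt
  have hcont := hu.solution.contDiffOn_closed.continuousOn
  have hsub : Icc (-ε⁻¹) x ⊆ dom ε := Icc_subset_Icc_right hx.2
  have hclock : ∀ φ, HasDerivAt _ _ φ := hn.hasDerivAt_clock hc hC ha hb hε (z.2 - z.1) hw
  have hclockc : Continuous
      (clock ε (profile F z) (slopeL F z) (slopeR F z) (z.2 - z.1) w) :=
    continuous_iff_continuousAt.2 fun φ => (hclock φ).continuousAt
  have hphc := (continuous_phase z).comp_continuousOn (hcont.mono hsub)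
  -- The phase involves arcsin of a square root and is handled at the turning points by continuity
  -- alone; derivatives are taken only in the open interval.
  rw [intervalIntegral.integral_eq_sub_of_hasDerivAt_of_le hx.1
    (f := fun y => clock ε (profile F z) (slopeL F z) (slopeR F z) (z.2 - z.1) w (phase z (u y)))
    (f' := fun y => w (phase z (u y))) (hclockc.comp_continuousOn hphc) (fun y hy => ?_)
    ((hw.comp_continuousOn hphc).intervalIntegrable_of_Icc hx.1), ← hz1, phase_left]
  · simp [clock]
  have hy' : y ∈ Ioo (-ε⁻¹) ε⁻¹ := ⟨hy.1, hy.2.trans_le hx.2⟩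
  have hyD : y ∈ dom ε := Ioo_subset_Icc_self hy'
  have huy : u y ∈ Ioo z.1 z.2 := by
    rw [hz1, hz2]
    exact ⟨hu.strictMono hl hyD hy'.1, hu.strictMono hyD hr hy'.2⟩
  obtain ⟨hm, hph⟩ := hasDerivAt_phase huy
  refine ((hclock _).comp y (hph.comp y (hu.hasDerivAt hy'))).congr_deriv ?_
  have hgap : Gibbs F Δ.1 (u y) - Δ.2 =
      (Real.sin (phase z (u y)) * Real.cos (phase z (u y))) ^ 2 *
        flux (profile F z) (slopeL F z) (slopeR F z) (phase z (u y)) := by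
    rw [← gap_sin_sq, ← gibbs_pairOf hzlt.ne, ← eq_of_phase hzlt (Ioo_subset_Icc_self huy), hpair]
  have hv : derivWithin u (dom ε) y = speed ε (Gibbs F Δ.1 (u y) - Δ.2) := by
    rw [← hu.first_integral_closed hF hε₀ hyD, speed_P hε₀.ne' (hu.derivWithin_nonneg y)]
  have hrs := recip_mul_speed (ε := ε) hm
    (hn.flux_pos hc ha hb (phase z (u y))) (by
      rw [← mul_assoc]
      exact (hn.mul_flux_le hc hC ha hb ε _).trans_lt hε)
  rw [← hgap, ← hv] at hrs
  have hL : z.2 - z.1 ≠ 0 := (sub_pos.2 hzlt).ne'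
  simp only [Function.comp, slowness]
  generalize Real.sin (phase z (u y)) * Real.cos (phase z (u y)) = m at *
  have hm' := hm.ne'
  field_simp
  rw [mul_assoc, hrs]

/-- The time conditions satisfied by a simple solution. -/
lemma IsSimpleSolution.times (hF : IsFreeEnergy F αbar βbar) (hε₀ : 0 < ε)
    (hu : IsSimpleSolution F ε r Δ u) {z : ℝ × ℝ} (hz : z = (u (-ε⁻¹), u ε⁻¹)) (hc : 0 < c)
    (hC : 0 ≤ C) (hn : IsProfile c C (profile F z))
    (hε : ε ^ 2 * (slopeL F z + slopeR F z + C) < 1) :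
    leftTime ε (profile F z) (slopeL F z) (slopeR F z) = (z.2 - r) / (z.2 - z.1) ^ 2 / ε ∧
    rightTime ε (profile F z) (slopeL F z) (slopeR F z) = (r - z.1) / (z.2 - z.1) ^ 2 / ε := by
  have hlt := neg_inv_lt_inv hε₀
  have hl : -ε⁻¹ ∈ dom ε := left_mem_Icc.2 hlt.le
  have hr : ε⁻¹ ∈ dom ε := right_mem_Icc.2 hlt.le
  have ht := hu.isTurningPair hF hε₀
  have hz1 : z.1 = u (-ε⁻¹) := by rw [hz]
  have hz2 : z.2 = u ε⁻¹ := by rw [hz]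
  have hzlt : z.1 < z.2 := by rw [hz1, hz2]; exact ht.lt
  have hL : 0 < z.2 - z.1 := sub_pos.2 hzlt
  have hcont := hu.solution.contDiffOn_closed.continuousOn
  have hui : IntervalIntegrable u MeasureTheory.volume (-ε⁻¹) ε⁻¹ :=
    hcont.intervalIntegrable_of_Icc hlt.le
  have hmono := hu.strictMono.monotoneOn
  have hsin : ∀ y ∈ uIcc (-ε⁻¹) ε⁻¹,
      Real.sin (phase z (u y)) ^ 2 = (u y - z.1) / (z.2 - z.1) := by
    intro y hy
    rw [uIcc_of_le hlt.le] at hy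
    refine sin_phase_sq hzlt ?_
    rw [hz1, hz2]
    exact ⟨hmono hl hy hy.1, hmono hy hr hy.2⟩
  have hcos : ∀ y ∈ uIcc (-ε⁻¹) ε⁻¹,
      Real.cos (phase z (u y)) ^ 2 = (z.2 - u y) / (z.2 - z.1) := by
    intro y hy
    rw [← one_sub_sin_sq, hsin y hy]
    field_simp
    ring
  -- Along the solution cos² and sin² of the phase are (z₂ − u)/L and (u − z₁)/L, whose integrals
  -- are fixed by the mass constraint.
  have i1 := hu.integral_phase hF hε₀ hz hc hC hn hε (w := fun φ => Real.cos φ ^ 2)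
    (by fun_prop) hr
  have i2 := hu.integral_phase hF hε₀ hz hc hC hn hε (w := fun φ => Real.sin φ ^ 2)
    (by fun_prop) hr
  rw [← hz2, phase_right hzlt] at i1 i2
  rw [clock_cos_sq, intervalIntegral.integral_congr hcos, intervalIntegral.integral_div,
    intervalIntegral.integral_sub intervalIntegrable_const hui, hu.solution.mass,
    intervalIntegral.integral_const, smul_eq_mul] at i1
  rw [clock_sin_sq, intervalIntegral.integral_congr hsin, intervalIntegral.integral_div,
    intervalIntegral.integral_sub hui intervalIntegrable_const, hu.solution.mass,
    intervalIntegral.integral_const, smul_eq_mul] at i2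
  constructor
  · field_simp at i1 ⊢
    linarith
  · field_simp at i2 ⊢
    linarith

/-- A simple solution is determined by its end values. -/
lemma IsSimpleSolution.eqOn (hF : IsFreeEnergy F αbar βbar) (hε₀ : 0 < ε) {u' : ℝ → ℝ}
    {r' : ℝ} {Δ' : ℝ × ℝ}
    (hu : IsSimpleSolution F ε r Δ u) (hu' : IsSimpleSolution F ε r' Δ' u')
    {z : ℝ × ℝ} (hz : z = (u (-ε⁻¹), u ε⁻¹)) (hz' : z = (u' (-ε⁻¹), u' ε⁻¹)) (hc : 0 < c)
    (hC : 0 ≤ C) (hn : IsProfile c C (profile F z))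
    (hε : ε ^ 2 * (slopeL F z + slopeR F z + C) < 1) : EqOn u u' (dom ε) := by
  intro x hx
  have hlt := neg_inv_lt_inv hε₀
  have hl : -ε⁻¹ ∈ dom ε := left_mem_Icc.2 hlt.le
  have hr : ε⁻¹ ∈ dom ε := right_mem_Icc.2 hlt.le
  have ht := hu.isTurningPair hF hε₀
  obtain ⟨ha, hb⟩ := hu.slopes_pos hF hε₀
  rw [← hz] at ha hb
  have hz1 : z.1 = u (-ε⁻¹) := by rw [hz]
  have hz2 : z.2 = u ε⁻¹ := by rw [hz]
  have hzlt : z.1 < z.2 := by rw [hz1, hz2]; exact ht.lt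
  have hz1' : z.1 = u' (-ε⁻¹) := by rw [hz']
  have hz2' : z.2 = u' ε⁻¹ := by rw [hz']
  have hL : 0 < z.2 - z.1 := sub_pos.2 hzlt
  -- With unit weight the clock at the current phase is the elapsed time, the same for both
  -- solutions; the clock is injective.
  have i1 := hu.integral_phase hF hε₀ hz hc hC hn hε (w := fun _ => 1) (by fun_prop) hx
  have i2 := hu'.integral_phase hF hε₀ hz' hc hC hn hε (w := fun _ => 1) (by fun_prop) hx
  have hmono : StrictMono
      (clock ε (profile F z) (slopeL F z) (slopeR F z) (z.2 - z.1) fun _ => 1) :=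
    strictMono_of_hasDerivAt_pos
      (hn.hasDerivAt_clock hc hC ha hb hε (z.2 - z.1) (w := fun _ => 1) continuous_const)
      fun φ => by
        have := hn.slowness_pos hc hC ha hb hε φ
        positivity
  have hph := hmono.injective (i1.symm.trans i2)
  have m1 : u x ∈ Icc z.1 z.2 := by
    rw [hz1, hz2]
    exact ⟨hu.strictMono.monotoneOn hl hx hx.1, hu.strictMono.monotoneOn hx hr hx.2⟩
  have m2 : u' x ∈ Icc z.1 z.2 := by
    rw [hz1', hz2']
    exact ⟨hu'.strictMono.monotoneOn hl hx hx.1, hu'.strictMono.monotoneOn hx hr hx.2⟩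
  rw [eq_of_phase hzlt m1, hph, ← eq_of_phase hzlt m2]

end

/-! ### The contraction argument for the logarithmic time equations. -/

lemma abs_exp_neg_sub_le {c x y : ℝ} (hx : c ≤ x) (hy : c ≤ y) :
    |Real.exp (-x) - Real.exp (-y)| ≤ Real.exp (-c) * |x - y| := by
  have h : ∀ t ∈ Ici c, HasDerivWithinAt (fun t : ℝ => Real.exp (-t)) (-Real.exp (-t)) (Ici c) t :=
    fun t _ => by simpa using ((hasDerivAt_neg t).exp).hasDerivWithinAt
  refine (convex_Ici c).norm_image_sub_le_of_norm_hasDerivWithin_le h (fun t ht => ?_) hy hx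
  rw [norm_neg, Real.norm_eq_abs, Real.abs_exp, Real.exp_le_exp]
  exact neg_le_neg ht

/-- The coupling is exponentially small but is multiplied by times of order 1/ε; the product still
vanishes. -/
lemma tendsto_exp_neg_div_mul_inv {c : ℝ} (hc : 0 < c) :
    Tendsto (fun ε : ℝ => Real.exp (-(c / ε)) * ε⁻¹) (𝓝[>] 0) (𝓝 0) := by
  have h := (Real.tendsto_pow_mul_exp_neg_atTop_nhds_zero 1).comp
    (tendsto_inv_nhdsGT_zero.const_mul_atTop hc)
  have h2 := h.const_mul c⁻¹
  rw [mul_zero] at h2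
  refine h2.congr fun ε => ?_
  simp only [Function.comp, pow_one, div_eq_mul_inv]
  field_simp

/-- The intermediate value J' separates the change of the component's own variable, cancelled by the
Newton step up to η, from the change of everything else. -/
lemma newton_step_le {k η x x' J J' J'' ρ ρ' T T' : ℝ} (hk : 0 < k)
    (hA : |J - J' - k * (x - x')| ≤ η * |x - x'|) (hB : |J' - J''| ≤ T) (hρ : |ρ - ρ'| ≤ T') :
    |(x - k⁻¹ * (J - ρ)) - (x' - k⁻¹ * (J'' - ρ'))| ≤ k⁻¹ * (η * |x - x'| + T + T') := by
  have h1 : (x - k⁻¹ * (J - ρ)) - (x' - k⁻¹ * (J'' - ρ')) =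
      k⁻¹ * (-(J - J' - k * (x - x')) - (J' - J'') + (ρ - ρ')) := by
    field_simp
    ring
  rw [h1, abs_mul, abs_of_pos (inv_pos.2 hk)]
  refine mul_le_mul_of_nonneg_left ?_ (inv_pos.2 hk).le
  refine (abs_add_le _ _).trans (add_le_add ((abs_sub _ _).trans (add_le_add ?_ hB)) hρ)
  rwa [abs_neg]

/-- The exponentials of the parameters. -/
def expNeg (l : ℝ × ℝ) : ℝ × ℝ := (Real.exp (-l.1), Real.exp (-l.2))

lemma norm_expNeg_sub_le {c : ℝ} {l l' : ℝ × ℝ} (h1 : c ≤ l.1) (h2 : c ≤ l.2) (h1' : c ≤ l'.1)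
    (h2' : c ≤ l'.2) : ‖expNeg l - expNeg l'‖ ≤ Real.exp (-c) * ‖l - l'‖ := by
  rw [Prod.norm_def]
  refine max_le ?_ ?_
  · refine (abs_exp_neg_sub_le h1 h1').trans ?_
    gcongr
    exact norm_fst_le (l - l')
  · refine (abs_exp_neg_sub_le h2 h2').trans ?_
    gcongr
    exact norm_snd_le (l - l')

lemma norm_expNeg_le {c : ℝ} {l : ℝ × ℝ} (h1 : c ≤ l.1) (h2 : c ≤ l.2) :
    ‖expNeg l‖ ≤ Real.exp (-c) := by
  rw [Prod.norm_def]
  simp only [expNeg, Real.norm_eq_abs, Real.abs_exp]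
  exact max_le (Real.exp_le_exp.2 (by linarith)) (Real.exp_le_exp.2 (by linarith))

/-- The a priori bounds for one parameter. -/
lemma mem_box_of_abs_sub_le {k η B ε x ρ m M : ℝ} (hk : 0 < k) (hε : 0 < ε) (hx : 0 ≤ x)
    (hη : η ≤ k / 4) (hB : ε * B ≤ m / 4) (hρ : ρ ∈ Icc m M) (hm : 0 < m)
    (h : |ρ / ε - k * x| ≤ η * x + B) : m / (4 * k) / ε ≤ x ∧ x ≤ 2 * M / k / ε := by
  obtain ⟨h1, h2⟩ := abs_le.1 h
  have h3 : ρ / ε * ε = ρ := div_mul_cancel₀ _ hε.ne'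
  have h6 : 0 ≤ k * x * ε := by positivity
  have h7 : η * x * ε ≤ k / 4 * x * ε := by gcongr
  have h4 := mul_le_mul_of_nonneg_right h1 hε.le
  have h5 := mul_le_mul_of_nonneg_right h2 hε.le
  have h8 := hρ.1
  have h9 := hρ.2
  constructor
  · rw [div_div, div_le_iff₀ (by positivity)]
    nlinarith
  · rw [div_div, le_div_iff₀ (by positivity)]
    nlinarith

/-- The Newton step for one parameter maps the box to itself. -/
lemma newton_step_mem_box {k η B C ε x J ρ m M : ℝ} (hk : 0 < k) (hε : 0 < ε)
    (hx : x ≤ C / ε) (hη : 0 ≤ η) (hηC : η * C ≤ m / 4) (hB : ε * B ≤ m / 4) (hρ : ρ ∈ Icc m M)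
    (hm : 0 < m) (h : |J - k * x| ≤ η * x + B) :
    m / (4 * k) / ε ≤ x - k⁻¹ * (J - ρ / ε) ∧ x - k⁻¹ * (J - ρ / ε) ≤ 2 * M / k / ε := by
  obtain ⟨h1, h2⟩ := abs_le.1 h
  have h3 : ρ / ε * ε = ρ := div_mul_cancel₀ _ hε.ne'
  have e1 : x - k⁻¹ * (J - ρ / ε) = (k * x - J + ρ / ε) * ε / (k * ε) := by
    field_simp
    ring
  have h4 := mul_le_mul_of_nonneg_right h1 hε.le
  have h5 := mul_le_mul_of_nonneg_right h2 hε.le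
  have h6 : η * x * ε ≤ m / 4 := by
    rw [le_div_iff₀ hε] at hx
    nlinarith
  have h8 := hρ.1
  have h9 := hρ.2
  rw [e1]
  constructor
  · rw [div_div, div_le_div_iff₀ (by positivity) (by positivity)]
    have : m / 4 ≤ (k * x - J + ρ / ε) * ε := by nlinarith
    nlinarith [mul_pos hk hε]
  · rw [div_div]
    have : (k * x - J + ρ / ε) * ε ≤ 2 * M := by nlinarith
    exact div_le_div_of_nonneg_right this (by positivity)

set_option maxHeartbeats 1000000 in
/-- Unique solvability of a weakly coupled pair of logarithmic time equations. -/
theorem exists_unique_of_times {J₁ J₂ : ℝ → ℝ → ℝ → ℝ × ℝ → ℝ} {ζ : ℝ × ℝ → ℝ × ℝ}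
    {ρ₁ ρ₂ : ℝ → ℝ × ℝ → ℝ} {G : ℝ → ℝ} {z₀ : ℝ × ℝ} {R : Set ℝ}
    {k₁ k₂ h K Kζ Kρ m M εc d : ℝ} (hk₁ : 0 < k₁) (hk₂ : 0 < k₂) (hh : 0 < h) (hK : 0 ≤ K)
    (hKζ : 0 ≤ Kζ) (hKρ : 0 ≤ Kρ) (hm : 0 < m) (hmM : m ≤ M) (hεc : 0 < εc) (hd : 0 < d)
    (hζ : LipschitzOnWith Kζ.toNNReal ζ (Metric.closedBall 0 d)) (hζ0 : ζ 0 = z₀)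
    (hA₁ : ∀ η > 0, ∃ h' > 0, ∃ Λ ≥ 0, ∃ ε₀ > 0, ∀ ε ∈ Ioo 0 ε₀, ∀ z ∈ Metric.closedBall z₀ h',
      ∀ x ≥ Λ, ∀ x' ≥ Λ, ∀ w ≥ Λ, |J₁ ε x w z - J₁ ε x' w z - k₁ * (x - x')| ≤ η * |x - x'|)
    (hA₂ : ∀ η > 0, ∃ h' > 0, ∃ Λ ≥ 0, ∃ ε₀ > 0, ∀ ε ∈ Ioo 0 ε₀, ∀ z ∈ Metric.closedBall z₀ h',
      ∀ x ≥ Λ, ∀ x' ≥ Λ, ∀ w ≥ Λ, |J₂ ε w x z - J₂ ε w x' z - k₂ * (x - x')| ≤ η * |x - x'|)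
    (hG₁ : ∀ ε ∈ Ioo 0 εc, ∀ z ∈ Metric.closedBall z₀ h, ∀ x ≥ 0, ∀ w ≥ 0,
      0 ≤ J₁ ε x w z ∧ J₁ ε x w z ≤ G x)
    (hG₂ : ∀ ε ∈ Ioo 0 εc, ∀ z ∈ Metric.closedBall z₀ h, ∀ x ≥ 0, ∀ w ≥ 0,
      0 ≤ J₂ ε w x z ∧ J₂ ε w x z ≤ G x)
    (hB₁ : ∀ ε ∈ Ioo 0 εc, ∀ z ∈ Metric.closedBall z₀ h, ∀ z' ∈ Metric.closedBall z₀ h, ∀ x ≥ 0,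
      ∀ w ≥ 0, ∀ w' ≥ 0, |J₁ ε x w z - J₁ ε x w' z'| ≤
        K * (|Real.exp (-w) - Real.exp (-w')| + ‖z - z'‖) *
          (J₁ ε x w z + J₂ ε x w z + J₁ ε x w' z' + J₂ ε x w' z'))
    (hB₂ : ∀ ε ∈ Ioo 0 εc, ∀ z ∈ Metric.closedBall z₀ h, ∀ z' ∈ Metric.closedBall z₀ h, ∀ x ≥ 0,
      ∀ w ≥ 0, ∀ w' ≥ 0, |J₂ ε w x z - J₂ ε w' x z'| ≤
        K * (|Real.exp (-w) - Real.exp (-w')| + ‖z - z'‖) *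
          (J₁ ε w x z + J₂ ε w x z + J₁ ε w' x z' + J₂ ε w' x z'))
    (hρ₁ : ∀ r ∈ R, ∀ z ∈ Metric.closedBall z₀ h, ρ₁ r z ∈ Icc m M)
    (hρ₂ : ∀ r ∈ R, ∀ z ∈ Metric.closedBall z₀ h, ρ₂ r z ∈ Icc m M)
    (hL₁ : ∀ r ∈ R, ∀ z ∈ Metric.closedBall z₀ h, ∀ z' ∈ Metric.closedBall z₀ h,
      |ρ₁ r z - ρ₁ r z'| ≤ Kρ * ‖z - z'‖)
    (hL₂ : ∀ r ∈ R, ∀ z ∈ Metric.closedBall z₀ h, ∀ z' ∈ Metric.closedBall z₀ h,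
      |ρ₂ r z - ρ₂ r z'| ≤ Kρ * ‖z - z'‖) :
    ∃ c > 0, ∃ Λ ≥ 0, ∃ ε₁ > 0, ∀ ε ∈ Ioo 0 ε₁, ∀ r ∈ R, ∃ l : ℝ × ℝ,
      (Λ ≤ l.1 ∧ Λ ≤ l.2) ∧ (c / ε ≤ l.1 ∧ c / ε ≤ l.2) ∧
      (J₁ ε l.1 l.2 (ζ (expNeg l)) = ρ₁ r (ζ (expNeg l)) / ε ∧
        J₂ ε l.1 l.2 (ζ (expNeg l)) = ρ₂ r (ζ (expNeg l)) / ε) ∧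
      ∀ l' : ℝ × ℝ, Λ ≤ l'.1 → Λ ≤ l'.2 →
        J₁ ε l'.1 l'.2 (ζ (expNeg l')) = ρ₁ r (ζ (expNeg l')) / ε →
        J₂ ε l'.1 l'.2 (ζ (expNeg l')) = ρ₂ r (ζ (expNeg l')) / ε → l' = l := by
  have hM : 0 < M := hm.trans_le hmM
  set c := min (m / (4 * k₁)) (m / (4 * k₂)) with hc
  have hc0 : 0 < c := by positivity
  set C := max (2 * M / k₁) (2 * M / k₂) with hC
  have hC0 : 0 < C := lt_max_of_lt_left (by positivity)
  -- The first entry makes the Newton map preserve the box of side bounds c/ε and C/ε. The others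
  -- give the a priori bounds and half of the contraction constant.
  set η := min (m / 4 / C) (min (k₁ / 4) (k₂ / 4)) with hη
  have hη0 : 0 < η := by positivity
  have hη1 : η ≤ k₁ / 4 := (min_le_right _ _).trans (min_le_left _ _)
  have hη2 : η ≤ k₂ / 4 := (min_le_right _ _).trans (min_le_right _ _)
  have hηC : η * C ≤ m / 4 := by rw [← le_div_iff₀ hC0]; exact min_le_left _ _
  obtain ⟨h₁, hh₁, Λ₁, hΛ₁, ε₁, hε₁, A₁⟩ := hA₁ η hη0
  obtain ⟨h₂, hh₂, Λ₂, hΛ₂, ε₂, hε₂, A₂⟩ := hA₂ η hη0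
  set h' := min h (min h₁ h₂) with hh'
  have hh'0 : 0 < h' := by positivity
  -- the parameters are so large that the turning points are close to `z₀`
  set s := min d (h' / (Kζ + 1)) with hs
  have hs0 : 0 < s := by positivity
  set Λ := max (max Λ₁ Λ₂) (-Real.log s) with hΛ
  have hΛ0 : 0 ≤ Λ := (hΛ₁.trans (le_max_left _ _)).trans (le_max_left _ _)
  have hΛ1 : Λ₁ ≤ Λ := (le_max_left _ _).trans (le_max_left _ _)
  have hΛ2 : Λ₂ ≤ Λ := (le_max_right _ _).trans (le_max_left _ _)
  have hexpΛ : Real.exp (-Λ) ≤ s := by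
    rw [← Real.le_log_iff_exp_le hs0]
    linarith [le_max_right (max Λ₁ Λ₂) (-Real.log s)]
  have hball : ∀ l : ℝ × ℝ, Λ ≤ l.1 → Λ ≤ l.2 → expNeg l ∈ Metric.closedBall (0 : ℝ × ℝ) d := by
    intro l hl1 hl2
    rw [mem_closedBall_zero_iff]
    exact (norm_expNeg_le hl1 hl2).trans (hexpΛ.trans (min_le_left _ _))
  have hζlip : ∀ y ∈ Metric.closedBall (0 : ℝ × ℝ) d, ∀ y' ∈ Metric.closedBall (0 : ℝ × ℝ) d,
      ‖ζ y - ζ y'‖ ≤ Kζ * ‖y - y'‖ := by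
    intro y hy y' hy'
    have := hζ.norm_sub_le hy hy'
    rwa [Real.coe_toNNReal _ hKζ] at this
  have hzin : ∀ l : ℝ × ℝ, Λ ≤ l.1 → Λ ≤ l.2 → ζ (expNeg l) ∈ Metric.closedBall z₀ h' := by
    intro l hl1 hl2
    have e1 := hζlip _ (hball l hl1 hl2) 0 (Metric.mem_closedBall_self hd.le)
    rw [hζ0, sub_zero] at e1
    rw [mem_closedBall_iff_norm]
    have e2 : ‖expNeg l‖ ≤ h' / (Kζ + 1) :=
      (norm_expNeg_le hl1 hl2).trans (hexpΛ.trans (min_le_right _ _))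
    rw [le_div_iff₀ (by positivity)] at e2
    nlinarith [norm_nonneg (expNeg l)]
  have hsub : Metric.closedBall z₀ h' ⊆ Metric.closedBall z₀ h :=
    Metric.closedBall_subset_closedBall (min_le_left _ _)
  have hsub₁ : Metric.closedBall z₀ h' ⊆ Metric.closedBall z₀ h₁ :=
    Metric.closedBall_subset_closedBall ((min_le_right _ _).trans (min_le_left _ _))
  have hsub₂ : Metric.closedBall z₀ h' ⊆ Metric.closedBall z₀ h₂ :=
    Metric.closedBall_subset_closedBall ((min_le_right _ _).trans (min_le_right _ _))
  -- crude bounds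
  set B := (k₁ + k₂ + η) * Λ + |G Λ| with hB
  have hB0 : 0 ≤ B := by positivity
  have crude₁ : ∀ ε ∈ Ioo 0 (min εc ε₁), ∀ z ∈ Metric.closedBall z₀ h', ∀ x ≥ Λ, ∀ w ≥ Λ,
      |J₁ ε x w z - k₁ * x| ≤ η * x + B := by
    intro ε hε z hz x hx w hw
    -- Comparison with the base point x' = Λ, where the time is bounded by G Λ whatever the other
    -- parameter is.
    have e1 := A₁ ε ⟨hε.1, hε.2.trans_le (min_le_right _ _)⟩ z (hsub₁ hz) x (hΛ1.trans hx) Λ hΛ1 w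
      (hΛ1.trans hw)
    obtain ⟨e2, e3⟩ := hG₁ ε ⟨hε.1, hε.2.trans_le (min_le_left _ _)⟩ z (hsub hz) Λ hΛ0 w
      (hΛ0.trans hw)
    rw [abs_of_nonneg (sub_nonneg.2 hx), abs_le] at e1
    have e4 := le_abs_self (G Λ)
    have e5 : 0 ≤ k₁ * Λ := by positivity
    have e6 : 0 ≤ k₂ * Λ := by positivity
    have e7 : 0 ≤ η * Λ := by positivity
    rw [abs_le, hB]
    constructor <;> linarith
  have crude₂ : ∀ ε ∈ Ioo 0 (min εc ε₂), ∀ z ∈ Metric.closedBall z₀ h', ∀ x ≥ Λ, ∀ w ≥ Λ,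
      |J₂ ε w x z - k₂ * x| ≤ η * x + B := by
    intro ε hε z hz x hx w hw
    have e1 := A₂ ε ⟨hε.1, hε.2.trans_le (min_le_right _ _)⟩ z (hsub₂ hz) x (hΛ2.trans hx) Λ hΛ2 w
      (hΛ2.trans hw)
    obtain ⟨e2, e3⟩ := hG₂ ε ⟨hε.1, hε.2.trans_le (min_le_left _ _)⟩ z (hsub hz) Λ hΛ0 w
      (hΛ0.trans hw)
    rw [abs_of_nonneg (sub_nonneg.2 hx), abs_le] at e1
    have e4 := le_abs_self (G Λ)
    have e5 : 0 ≤ k₁ * Λ := by positivity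
    have e6 : 0 ≤ k₂ * Λ := by positivity
    have e7 : 0 ≤ η * Λ := by positivity
    rw [abs_le, hB]
    constructor <;> linarith
  -- smallness of `ε`
  set D := (k₁ + k₂ + η) * C + B with hD
  have hD0 : 0 ≤ D := by positivity
  -- D/ε bounds each of the four times in the coupling estimate. E collects the effect of the other
  -- slope and of the moving turning points, on the times and on the right-hand sides.
  set E := K * (1 + Kζ) * (4 * D) + Kρ * Kζ with hE
  have hE0 : 0 ≤ E := by positivity
  have hsmall : ∀ᶠ ε in 𝓝[>] (0 : ℝ), E * (Real.exp (-(c / ε)) * ε⁻¹) < min k₁ k₂ / 4 := by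
    have := (tendsto_exp_neg_div_mul_inv hc0).const_mul E
    rw [mul_zero] at this
    exact this.eventually (gt_mem_nhds (by positivity))
  obtain ⟨ε₃, hε₃, hsmall⟩ := (mem_nhdsGT_iff_exists_Ioo_subset).1 hsmall
  set εs := min (min (min εc ε₁) (min εc ε₂)) (min (min ε₃ 1) (min (m / 4 / (B + 1)) (c / (Λ + 1))))
    with hεs
  have hεs0 : 0 < εs := by
    have : (0 : ℝ) < ε₃ := hε₃
    positivity
  refine ⟨c, hc0, Λ, hΛ0, εs, hεs0, fun ε hε r hr => ?_⟩
  have hε0 := hε.1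
  have hεa : ε ∈ Ioo 0 (min εc ε₁) :=
    ⟨hε0, hε.2.trans_le ((min_le_left _ _).trans (min_le_left _ _))⟩
  have hεb : ε ∈ Ioo 0 (min εc ε₂) :=
    ⟨hε0, hε.2.trans_le ((min_le_left _ _).trans (min_le_right _ _))⟩
  have hεcm : ε ∈ Ioo 0 εc := ⟨hε0, hεa.2.trans_le (min_le_left _ _)⟩
  have hε1m : ε ∈ Ioo 0 ε₁ := ⟨hε0, hεa.2.trans_le (min_le_right _ _)⟩
  have hε2m : ε ∈ Ioo 0 ε₂ := ⟨hε0, hεb.2.trans_le (min_le_right _ _)⟩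
  have hεr := hε.2.trans_le (min_le_right _ _)
  have hε3m : ε ∈ Ioo 0 ε₃ := ⟨hε0, hεr.trans_le ((min_le_left _ _).trans (min_le_left _ _))⟩
  have hε1 : ε < 1 := hεr.trans_le ((min_le_left _ _).trans (min_le_right _ _))
  have hεB : ε * B ≤ m / 4 := by
    have := (hεr.trans_le ((min_le_right _ _).trans (min_le_left _ _))).le
    rw [le_div_iff₀ (by positivity)] at this
    linarith
  have hΛc : Λ ≤ c / ε := by
    have := (hεr.trans_le ((min_le_right _ _).trans (min_le_right _ _))).le
    rw [le_div_iff₀ (by positivity)] at this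
    rw [le_div_iff₀ hε0]
    linarith
  have hstar : E * (Real.exp (-(c / ε)) * ε⁻¹) < min k₁ k₂ / 4 := hsmall hε3m
  set S : Set (ℝ × ℝ) := Icc (c / ε, c / ε) (C / ε, C / ε) with hS
  have hSmem : ∀ l : ℝ × ℝ, l ∈ S ↔
      (c / ε ≤ l.1 ∧ c / ε ≤ l.2) ∧ (l.1 ≤ C / ε ∧ l.2 ≤ C / ε) := fun l => Iff.rfl
  have hbox₁ : ∀ {x : ℝ}, m / (4 * k₁) / ε ≤ x ∧ x ≤ 2 * M / k₁ / ε → c / ε ≤ x ∧ x ≤ C / ε :=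
    fun hx => ⟨(div_le_div_of_nonneg_right (min_le_left _ _) hε0.le).trans hx.1,
      hx.2.trans (div_le_div_of_nonneg_right (le_max_left _ _) hε0.le)⟩
  have hbox₂ : ∀ {x : ℝ}, m / (4 * k₂) / ε ≤ x ∧ x ≤ 2 * M / k₂ / ε → c / ε ≤ x ∧ x ≤ C / ε :=
    fun hx => ⟨(div_le_div_of_nonneg_right (min_le_right _ _) hε0.le).trans hx.1,
      hx.2.trans (div_le_div_of_nonneg_right (le_max_right _ _) hε0.le)⟩
  set Ψ : ℝ × ℝ → ℝ × ℝ := fun l =>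
    (l.1 - k₁⁻¹ * (J₁ ε l.1 l.2 (ζ (expNeg l)) - ρ₁ r (ζ (expNeg l)) / ε),
      l.2 - k₂⁻¹ * (J₂ ε l.1 l.2 (ζ (expNeg l)) - ρ₂ r (ζ (expNeg l)) / ε)) with hΨ
  have hmaps : MapsTo Ψ S S := by
    intro l hl
    obtain ⟨⟨l1, l2⟩, l3, l4⟩ := (hSmem l).1 hl
    have hz := hzin l (hΛc.trans l1) (hΛc.trans l2)
    have e1 := hbox₁ (newton_step_mem_box hk₁ hε0 l3 hη0.le hηC hεB (hρ₁ r hr _ (hsub hz)) hm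
      (crude₁ ε hεa _ hz _ (hΛc.trans l1) _ (hΛc.trans l2)))
    have e2 := hbox₂ (newton_step_mem_box hk₂ hε0 l4 hη0.le hηC hεB (hρ₂ r hr _ (hsub hz)) hm
      (crude₂ ε hεb _ hz _ (hΛc.trans l2) _ (hΛc.trans l1)))
    exact (hSmem _).2 ⟨⟨e1.1, e2.1⟩, e1.2, e2.2⟩
  have htime : ∀ x w, c / ε ≤ x → c / ε ≤ w → x ≤ C / ε → w ≤ C / ε →
      ∀ z ∈ Metric.closedBall z₀ h', J₁ ε x w z ≤ D * ε⁻¹ ∧ J₂ ε x w z ≤ D * ε⁻¹ := by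
    intro x w hx hw hx' hw' z hz
    have e1 := (abs_le.1 (crude₁ ε hεa z hz x (hΛc.trans hx) w (hΛc.trans hw))).2
    have e2 := (abs_le.1 (crude₂ ε hεb z hz w (hΛc.trans hw) x (hΛc.trans hx))).2
    have e3 : B ≤ B * ε⁻¹ := le_mul_of_one_le_right hB0 ((one_le_inv₀ hε0).2 hε1.le)
    rw [div_eq_mul_inv] at hx' hw'
    have hinv : 0 < ε⁻¹ := inv_pos.2 hε0
    have hCi : 0 ≤ C * ε⁻¹ := by positivity
    constructor
    · have e4 : (k₁ + η) * x ≤ (k₁ + η) * (C * ε⁻¹) := by gcongr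
      have e5 : 0 ≤ k₂ * (C * ε⁻¹) := by positivity
      rw [hD]
      linarith
    · have e4 : (k₂ + η) * w ≤ (k₂ + η) * (C * ε⁻¹) := by gcongr
      have e5 : 0 ≤ k₁ * (C * ε⁻¹) := by positivity
      rw [hD]
      linarith
  have hcontr : ∀ l ∈ S, ∀ l' ∈ S, ‖Ψ l - Ψ l'‖ ≤ 1 / 2 * ‖l - l'‖ := by
    intro l hl l' hl'
    obtain ⟨⟨l1, l2⟩, l3, l4⟩ := (hSmem l).1 hl
    obtain ⟨⟨l1', l2'⟩, l3', l4'⟩ := (hSmem l').1 hl'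
    have hz := hzin l (hΛc.trans l1) (hΛc.trans l2)
    have hz' := hzin l' (hΛc.trans l1') (hΛc.trans l2')
    have hc' : 0 ≤ c / ε := by positivity
    set q := Real.exp (-(c / ε)) with hq
    have hq0 : 0 < q := Real.exp_pos _
    have n1 : |l.1 - l'.1| ≤ ‖l - l'‖ := norm_fst_le (l - l')
    have n2 : |l.2 - l'.2| ≤ ‖l - l'‖ := norm_snd_le (l - l')
    have hzz : ‖ζ (expNeg l) - ζ (expNeg l')‖ ≤ Kζ * (q * ‖l - l'‖) := by
      refine (hζlip _ (hball l (hΛc.trans l1) (hΛc.trans l2)) _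
        (hball l' (hΛc.trans l1') (hΛc.trans l2'))).trans ?_
      gcongr
      exact norm_expNeg_sub_le l1 l2 l1' l2'
    have hT : ∀ {y s₁ s₂ s₃ s₄ : ℝ}, y ≤ q * ‖l - l'‖ →
        s₁ ≤ D * ε⁻¹ → s₂ ≤ D * ε⁻¹ → s₃ ≤ D * ε⁻¹ → s₄ ≤ D * ε⁻¹ → 0 ≤ s₁ + s₂ + s₃ + s₄ →
        K * (y + ‖ζ (expNeg l) - ζ (expNeg l')‖) * (s₁ + s₂ + s₃ + s₄) ≤
          K * (1 + Kζ) * (4 * D) * (q * ε⁻¹) * ‖l - l'‖ := by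
      intro y s₁ s₂ s₃ s₄ hy a1 a2 a3 a4 a5
      calc _ ≤ K * (q * ‖l - l'‖ + Kζ * (q * ‖l - l'‖)) * (4 * (D * ε⁻¹)) := by
            gcongr
            linarith
        _ = _ := by ring
    have hρT : ∀ {p p' : ℝ}, |p - p'| ≤ Kρ * ‖ζ (expNeg l) - ζ (expNeg l')‖ →
        |p / ε - p' / ε| ≤ Kρ * Kζ * (q * ε⁻¹) * ‖l - l'‖ := by
      intro p p' hp
      rw [← sub_div, abs_div, abs_of_pos hε0, div_eq_mul_inv]
      calc |p - p'| * ε⁻¹ ≤ Kρ * (Kζ * (q * ‖l - l'‖)) * ε⁻¹ := by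
            have := inv_pos.2 hε0
            gcongr
            exact hp.trans (by gcongr)
        _ = _ := by ring
    have fin : ∀ {k x : ℝ}, 0 < k → η ≤ k / 4 → min k₁ k₂ ≤ k → |x| ≤ ‖l - l'‖ →
        k⁻¹ * (η * |x| + K * (1 + Kζ) * (4 * D) * (q * ε⁻¹) * ‖l - l'‖ +
          Kρ * Kζ * (q * ε⁻¹) * ‖l - l'‖) ≤ 1 / 2 * ‖l - l'‖ := by
      intro k x hk h1 h2 h3
      rw [inv_mul_le_iff₀ hk]
      have h4 : η * |x| ≤ k / 4 * ‖l - l'‖ := by gcongr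
      have h5 : E * (q * ε⁻¹) * ‖l - l'‖ ≤ k / 4 * ‖l - l'‖ := by
        gcongr
        linarith
      rw [hE] at h5
      linarith
    -- Mixed states: only the component's own variable has been replaced, while the other parameter
    -- and the turning points are still those of l, or vice versa for the second component.
    have t1 := htime _ _ l1' l2 l3' l4 _ hz
    have t2 := htime _ _ l1' l2' l3' l4' _ hz'
    have t3 := htime _ _ l1 l2' l3 l4' _ hz
    have g1 := hG₁ ε hεcm _ (hsub hz) _ (hc'.trans l1') _ (hc'.trans l2)
    have g2 := hG₂ ε hεcm _ (hsub hz) _ (hc'.trans l2) _ (hc'.trans l1')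
    have g3 := hG₁ ε hεcm _ (hsub hz') _ (hc'.trans l1') _ (hc'.trans l2')
    have g4 := hG₂ ε hεcm _ (hsub hz') _ (hc'.trans l2') _ (hc'.trans l1')
    have g5 := hG₁ ε hεcm _ (hsub hz) _ (hc'.trans l1) _ (hc'.trans l2')
    have g6 := hG₂ ε hεcm _ (hsub hz) _ (hc'.trans l2') _ (hc'.trans l1)
    rw [Prod.norm_def]
    refine max_le ?_ ?_
    · refine (newton_step_le hk₁ (A₁ ε hε1m _ (hsub₁ hz) _ (hΛ1.trans (hΛc.trans l1)) _
        (hΛ1.trans (hΛc.trans l1')) _ (hΛ1.trans (hΛc.trans l2)))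
        ((hB₁ ε hεcm _ (hsub hz) _ (hsub hz') _ (hc'.trans l1') _ (hc'.trans l2) _
          (hc'.trans l2')).trans (hT ?_ t1.1 t1.2 t2.1 t2.2 ?_))
        (hρT (hL₁ r hr _ (hsub hz) _ (hsub hz')))).trans (fin hk₁ hη1 (min_le_left _ _) n1)
      · exact (abs_exp_neg_sub_le l2 l2').trans (by gcongr)
      · linarith [g1.1, g2.1, g3.1, g4.1]
    · refine (newton_step_le hk₂ (A₂ ε hε2m _ (hsub₂ hz) _ (hΛ2.trans (hΛc.trans l2)) _
        (hΛ2.trans (hΛc.trans l2')) _ (hΛ2.trans (hΛc.trans l1)))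
        ((hB₂ ε hεcm _ (hsub hz) _ (hsub hz') _ (hc'.trans l2') _ (hc'.trans l1) _
          (hc'.trans l1')).trans (hT ?_ t3.1 t3.2 t2.1 t2.2 ?_))
        (hρT (hL₂ r hr _ (hsub hz) _ (hsub hz')))).trans (fin hk₂ hη2 (min_le_right _ _) n2)
      · exact (abs_exp_neg_sub_le l1 l1').trans (by gcongr)
      · linarith [g5.1, g6.1, g3.1, g4.1]
  have hfix : ∀ l : ℝ × ℝ, Ψ l = l ↔ (J₁ ε l.1 l.2 (ζ (expNeg l)) = ρ₁ r (ζ (expNeg l)) / ε ∧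
      J₂ ε l.1 l.2 (ζ (expNeg l)) = ρ₂ r (ζ (expNeg l)) / ε) := by
    intro l
    simp only [hΨ, Prod.ext_iff, sub_eq_self, mul_eq_zero, inv_eq_zero, hk₁.ne', hk₂.ne', false_or,
      sub_eq_zero]
  have hcC : c / ε ≤ C / ε := by
    have e1 := hbox₁ (x := m / (4 * k₁) / ε) ⟨le_rfl, by
      gcongr ?_ / ε
      rw [div_le_div_iff₀ (by positivity) hk₁]
      nlinarith⟩
    exact e1.1.trans e1.2
  have hlip : ContractingWith (1 / 2 : NNReal) (hmaps.restrict Ψ S S) := by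
    refine ⟨by norm_num, LipschitzWith.of_dist_le_mul fun l l' => ?_⟩
    have := hcontr l l.2 l' l'.2
    rw [← dist_eq_norm, ← dist_eq_norm] at this
    change dist (Ψ l) (Ψ l') ≤ _
    simpa [Subtype.dist_eq] using this
  obtain ⟨l, hlS, hl, -⟩ := hlip.exists_fixedPoint' isClosed_Icc.isComplete hmaps
    (x := (c / ε, c / ε)) ((hSmem _).2 ⟨⟨le_rfl, le_rfl⟩, hcC, hcC⟩) (edist_ne_top _ _)
  obtain ⟨⟨l1, l2⟩, -⟩ := (hSmem l).1 hlS
  refine ⟨l, ⟨hΛc.trans l1, hΛc.trans l2⟩, ⟨l1, l2⟩, (hfix l).1 hl, fun l' h1 h2 h3 h4 => ?_⟩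
  -- Uniqueness is claimed above Λ and not merely in the box: the crude bounds force any such
  -- solution into the box, where the contraction applies.
  have hz' := hzin l' h1 h2
  have c1 := crude₁ ε hεa _ hz' _ h1 _ h2
  have c2 := crude₂ ε hεb _ hz' _ h2 _ h1
  rw [h3] at c1
  rw [h4] at c2
  have b1 := hbox₁ (mem_box_of_abs_sub_le hk₁ hε0 (hΛ0.trans h1) hη1 hεB
    (hρ₁ r hr _ (hsub hz')) hm c1)
  have b2 := hbox₂ (mem_box_of_abs_sub_le hk₂ hε0 (hΛ0.trans h2) hη2 hεB
    (hρ₂ r hr _ (hsub hz')) hm c2)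
  have := hcontr l' ((hSmem l').2 ⟨⟨b1.1, b2.1⟩, b1.2, b2.2⟩) l hlS
  rw [(hfix l').2 ⟨h3, h4⟩, show Ψ l = l from hl] at this
  have hn : ‖l' - l‖ = 0 := le_antisymm (by linarith) (norm_nonneg _)
  exact sub_eq_zero.1 (norm_eq_zero.1 hn)

/-! ### End slopes as coordinates, and admissibility. -/

section

variable {F : ℝ → ℝ} {αbar βbar α₀ β₀ σ₀ : ℝ}

lemma abs_div_sq_sub_le {p p' q q' P Q e : ℝ} (hQ : 0 < Q) (hq : Q ≤ q) (hq' : Q ≤ q')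
    (hp' : |p'| ≤ P) (hpe : |p - p'| ≤ e) (hqe : |q - q'| ≤ 2 * e) :
    |p / q ^ 2 - p' / q' ^ 2| ≤ (1 / Q ^ 2 + 4 * P / Q ^ 3) * e := by
  have h1 : 0 < q := hQ.trans_le hq
  have h2 : 0 < q' := hQ.trans_le hq'
  have hP : 0 ≤ P := (abs_nonneg _).trans hp'
  have he : 0 ≤ e := (abs_nonneg _).trans hpe
  have e1 : p / q ^ 2 - p' / q' ^ 2 =
      (p - p') / q ^ 2 - p' * (q - q') * (1 / (q * q' ^ 2) + 1 / (q ^ 2 * q')) := by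
    field_simp
    ring
  rw [e1]
  have e2 : |(p - p') / q ^ 2| ≤ e / Q ^ 2 := by
    rw [abs_div, abs_of_pos (by positivity : 0 < q ^ 2)]
    gcongr
  have e3 : |p' * (q - q') * (1 / (q * q' ^ 2) + 1 / (q ^ 2 * q'))| ≤
      P * (2 * e) * (1 / (Q * Q ^ 2) + 1 / (Q ^ 2 * Q)) := by
    rw [abs_mul, abs_mul,
      abs_of_pos (by positivity : 0 < 1 / (q * q' ^ 2) + 1 / (q ^ 2 * q'))]
    gcongr
  refine (abs_sub _ _).trans ((add_le_add e2 e3).trans (le_of_eq ?_))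
  field_simp
  ring

lemma IsFreeEnergy.hasStrictDerivAt (hF : IsFreeEnergy F αbar βbar) {z : ℝ} (hz : 0 < z) :
    HasStrictDerivAt F (deriv F z) z :=
  (hF.contDiffOn.contDiffAt (Ioi_mem_nhds hz)).hasStrictDerivAt (by norm_num)

lemma IsFreeEnergy.hasStrictDerivAt_deriv (hF : IsFreeEnergy F αbar βbar) {z : ℝ} (hz : 0 < z) :
    HasStrictDerivAt (deriv F) (deriv (deriv F) z) z :=
  (hF.contDiffOn_deriv.contDiffAt (Ioi_mem_nhds hz)).hasStrictDerivAt (by norm_num)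

/-- Near the double tangent, the end slopes are coordinates for the turning points. -/
lemma IsMaxwell.exists_ofSlopes (hM : IsMaxwell F α₀ β₀ σ₀) (hF : IsFreeEnergy F αbar βbar) :
    ∃ (ζ : ℝ × ℝ → ℝ × ℝ) (K : NNReal), ζ 0 = (α₀, β₀) ∧
      (∀ᶠ y in 𝓝 0, slopeL F (ζ y) = y.1 ∧ slopeR F (ζ y) = y.2) ∧
      (∀ᶠ z in 𝓝 (α₀, β₀), ζ (slopeL F z, slopeR F z) = z) ∧
      Tendsto (fun z => (slopeL F z, slopeR F z)) (𝓝 (α₀, β₀)) (𝓝 0) ∧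
      ∃ s ∈ 𝓝 (0 : ℝ × ℝ), LipschitzOnWith K ζ s := by
  have hα := hM.pos
  have hβ := hα.trans hM.lt
  have hL : β₀ - α₀ ≠ 0 := (sub_pos.2 hM.lt).ne'
  set z₀ : ℝ × ℝ := (α₀, β₀) with hz₀
  have d1 : HasStrictFDerivAt (fun z : ℝ × ℝ => z.1) (ContinuousLinearMap.fst ℝ ℝ ℝ) z₀ :=
    hasStrictFDerivAt_fst
  have d2 : HasStrictFDerivAt (fun z : ℝ × ℝ => z.2) (ContinuousLinearMap.snd ℝ ℝ ℝ) z₀ :=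
    hasStrictFDerivAt_snd
  have f1 : HasStrictFDerivAt (fun z : ℝ × ℝ => F z.1) _ z₀ :=
    (hF.hasStrictDerivAt hα).comp_hasStrictFDerivAt z₀ d1
  have f2 : HasStrictFDerivAt (fun z : ℝ × ℝ => F z.2) _ z₀ :=
    (hF.hasStrictDerivAt hβ).comp_hasStrictFDerivAt z₀ d2
  have g1 : HasStrictFDerivAt (deriv F ∘ fun z : ℝ × ℝ => z.1) _ z₀ :=
    (hF.hasStrictDerivAt_deriv hα).comp_hasStrictFDerivAt z₀ d1
  have g2 : HasStrictFDerivAt (deriv F ∘ fun z : ℝ × ℝ => z.2) _ z₀ :=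
    (hF.hasStrictDerivAt_deriv hβ).comp_hasStrictFDerivAt z₀ d2
  -- The off-diagonal derivatives are ±(F'(z₁) − F'(z₂)) and vanish at the double tangent; the
  -- diagonal ones are L F''(z₁) and −L F''(z₂).
  set e : (ℝ × ℝ) ≃L[ℝ] ℝ × ℝ :=
    (ContinuousLinearEquiv.unitsEquivAut ℝ
      (Units.mk0 ((β₀ - α₀) * deriv (deriv F) α₀)
        (mul_ne_zero hL (hF.deriv2_pos_left hM).ne'))).prodCongr
    (ContinuousLinearEquiv.unitsEquivAut ℝ
      (Units.mk0 (-((β₀ - α₀) * deriv (deriv F) β₀))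
        (neg_ne_zero.2 (mul_ne_zero hL (hF.deriv2_pos_right hM).ne')))) with he
  have hd : HasStrictFDerivAt (fun z => (slopeL F z, slopeR F z)) (e : ℝ × ℝ →L[ℝ] ℝ × ℝ) z₀ := by
    have := (((d2.sub d1).mul g1).sub (f2.sub f1)).prodMk ((f2.sub f1).sub ((d2.sub d1).mul g2))
    refine this.congr_fderiv ?_
    ext <;> simp [he, hz₀, hM.left, hM.right]
  have h0 : (slopeL F z₀, slopeR F z₀) = (0 : ℝ × ℝ) := by
    rw [hz₀, slopeL_eq_zero hM, slopeR_eq_zero hM]; rfl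
  obtain ⟨K, s, hs, hK⟩ := hd.to_localInverse.exists_lipschitzOnWith
  have hleft := hd.eventually_left_inverse
  have hright := hd.eventually_right_inverse
  have himg := hd.localInverse_apply_image
  have hcont := hd.hasFDerivAt.continuousAt.tendsto
  simp only [h0] at hs hright himg hcont
  exact ⟨_, K, himg, hright.mono fun y hy => Prod.ext_iff.1 hy, hleft, hcont, s, hs, hK⟩

lemma pairOf_eq (hM : IsMaxwell F α₀ β₀ σ₀) :
    pairOf F (α₀, β₀) = (σ₀, Gibbs F σ₀ α₀) := by
  have : (F β₀ - F α₀) / (β₀ - α₀) = σ₀ := by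
    rw [hM.equal_area, mul_div_cancel_right₀ _ (sub_pos.2 hM.lt).ne']
  simp only [pairOf, this]

lemma IsMaxwell.exists_norm_pairOf_sub_le (hM : IsMaxwell F α₀ β₀ σ₀)
    (hF : IsFreeEnergy F αbar βbar) : ∃ K > 0, ∀ᶠ z in 𝓝 (α₀, β₀),
      ‖pairOf F z - (σ₀, Gibbs F σ₀ α₀)‖ ≤ K * ‖z - (α₀, β₀)‖ := by
  have hL : β₀ - α₀ ≠ 0 := (sub_pos.2 hM.lt).ne'
  have hα := hM.pos
  have f1 : DifferentiableAt ℝ (fun z : ℝ × ℝ => F z.1) (α₀, β₀) :=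
    (hF.hasDerivAt hα).differentiableAt.comp (α₀, β₀) differentiableAt_fst
  have f2 : DifferentiableAt ℝ (fun z : ℝ × ℝ => F z.2) (α₀, β₀) :=
    (hF.hasDerivAt (hα.trans hM.lt)).differentiableAt.comp (α₀, β₀) differentiableAt_snd
  have d : DifferentiableAt ℝ (pairOf F) (α₀, β₀) := by
    have hL' : DifferentiableAt ℝ (fun z : ℝ × ℝ => z.2 - z.1) (α₀, β₀) := by fun_prop
    have hs : DifferentiableAt ℝ (fun z : ℝ × ℝ => (F z.2 - F z.1) / (z.2 - z.1)) (α₀, β₀) := by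
      simp only [div_eq_mul_inv]
      exact (f2.sub f1).mul (hL'.fun_inv hL)
    exact hs.prodMk (f1.sub (hs.mul differentiableAt_fst))
  obtain ⟨K, hK, h⟩ := d.hasFDerivAt.isBigO_sub.exists_pos
  refine ⟨K, hK, ?_⟩
  rw [← pairOf_eq hM]
  exact h.bound

/-- Turning points close to the double tangent belong to an admissible pair. -/
lemma IsMaxwell.exists_isAdmissible (hM : IsMaxwell F α₀ β₀ σ₀)
    (hF : IsFreeEnergy F αbar βbar) : ∃ N ∈ 𝓝 σ₀, ∃ h > 0, ∀ (Δ : ℝ × ℝ) (z₁ z₂ : ℝ), Δ.1 ∈ N →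
      |z₁ - α₀| < h → |z₂ - β₀| < h → Δ.1 < deriv F z₁ → deriv F z₂ < Δ.1 →
      IsTurningPair F Δ z₁ z₂ → IsAdmissible F Δ := by
  obtain ⟨h1, h2, -⟩ := hM.location hF
  have hα := hM.pos
  have hβ := hα.trans hM.lt
  have k1 : deriv F (α₀ / 2) < σ₀ := by
    rw [← hM.left]
    exact hF.strictMonoOn_left ⟨by linarith, by linarith⟩ ⟨hα, h1.le⟩ (by linarith)
  have k2 : σ₀ < deriv F (β₀ + 1) := by
    rw [← hM.right]
    exact hF.strictMonoOn_right h2.le (mem_Ici.2 (by linarith)) (by linarith)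
  refine ⟨Ioo (deriv F (α₀ / 2)) (deriv F (β₀ + 1)), Ioo_mem_nhds k1 k2,
    min (min (α₀ / 2) 1) (min (αbar - α₀) (β₀ - βbar)),
    lt_min (by positivity) (lt_min (by linarith) (by linarith)), ?_⟩
  intro Δ z₁ z₂ hσ hz₁ hz₂ hs₁ hs₂ ht
  simp only [lt_min_iff, abs_lt] at hz₁ hz₂
  obtain ⟨⟨⟨l1, -⟩, -⟩, ⟨-, l2⟩, -⟩ := hz₁
  obtain ⟨⟨-, -, l3⟩, -, l4, -⟩ := hz₂
  have hc : ContinuousOn (deriv F) (Ioi 0) := hF.contDiffOn_deriv.continuousOn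
  have hg : ContinuousOn (Gibbs F Δ.1) (Ioi 0) :=
    fun z hz => (hF.hasDerivAt_gibbs Δ.1 hz).continuousAt.continuousWithinAt
  have hz1 := ht.pos
  have hz12 := ht.lt
  -- Critical points are found on either side of z₁ and z₂ and between them. The Gibbs function is
  -- monotone from the outer ones to the turning points, so its values there are below b.
  obtain ⟨α, hα1, hα2⟩ := intermediate_value_Ioo (by linarith : α₀ / 2 ≤ z₁)
    (hc.mono fun z hz => lt_of_lt_of_le (by positivity) hz.1) ⟨hσ.1, hs₁⟩
  obtain ⟨ξ, hξ1, hξ2⟩ := intermediate_value_Ioo' hz12.le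
    (hc.mono fun z hz => hz1.trans_le hz.1) ⟨hs₂, hs₁⟩
  obtain ⟨β, hβ1, hβ2⟩ := intermediate_value_Ioo (by linarith : z₂ ≤ β₀ + 1)
    (hc.mono fun z hz => (hz1.trans hz12).trans_le hz.1) ⟨hs₂, hσ.2⟩
  have hα0 : 0 < α := by linarith [hα1.1]
  have hz2b : βbar < z₂ := by linarith
  refine ⟨α, ξ, β, hα0, hα1.2.trans hξ1.1, hξ1.2.trans hβ1.1, hα2, hξ2, hβ2,
    max_lt ?_ ?_, ht.between ξ hξ1⟩
  · rw [← ht.left]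
    refine strictMonoOn_of_deriv_pos (convex_Icc α z₁) (hg.mono fun z hz => hα0.trans_le hz.1)
      (fun z hz => ?_) (left_mem_Icc.2 hα1.2.le) (right_mem_Icc.2 hα1.2.le) hα1.2
    rw [interior_Icc] at hz
    have hz0 := hα0.trans hz.1
    rw [(hF.hasDerivAt_gibbs Δ.1 hz0).deriv, ← hα2, sub_pos]
    exact hF.strictMonoOn_left ⟨hα0, by linarith [hα1.2]⟩ ⟨hz0, by linarith [hz.2]⟩ hz.1
  · rw [← ht.right]
    refine strictAntiOn_of_deriv_neg (convex_Icc z₂ β)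
      (hg.mono fun z hz => (hz1.trans hz12).trans_le hz.1)
      (fun z hz => ?_) (left_mem_Icc.2 hβ1.1.le) (right_mem_Icc.2 hβ1.1.le) hβ1.1
    rw [interior_Icc] at hz
    have hz0 := (hz1.trans hz12).trans hz.1
    rw [(hF.hasDerivAt_gibbs Δ.1 hz0).deriv, ← hβ2, sub_neg]
    exact hF.strictMonoOn_right (mem_Ici.2 (by linarith [hz.1])) (mem_Ici.2 (by linarith [hβ1.1]))
      hz.2

lemma lt_deriv_of_slopeL_pos {z : ℝ × ℝ} (hz : z.1 < z.2) (h : 0 < slopeL F z) :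
    (pairOf F z).1 < deriv F z.1 := by
  rw [pairOf, div_lt_iff₀ (sub_pos.2 hz)]
  simp only [slopeL] at h
  linarith

lemma deriv_lt_of_slopeR_pos {z : ℝ × ℝ} (hz : z.1 < z.2) (h : 0 < slopeR F z) :
    deriv F z.2 < (pairOf F z).1 := by
  rw [pairOf, lt_div_iff₀ (sub_pos.2 hz)]
  simp only [slopeR] at h
  linarith

end

/-! ### Verification of the abstract hypotheses and conclusion. -/

section

variable {n : ℝ × ℝ → ℝ → ℝ} {z₀ : ℝ × ℝ} {A c C h K : ℝ}

lemma exists_leftTime_log_family (hh : 0 < h) (hA : 0 < A) (hc : 0 < c) (hC : 0 ≤ C)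
    (hn : ∀ z ∈ Metric.closedBall z₀ h, IsProfile c C (n z))
    (hflat : ∀ κ > 0, ∃ h' > 0, ∃ y ∈ Ioo (0 : ℝ) 1, ∀ z ∈ Metric.closedBall z₀ h',
      IsFlat A κ y (n z)) {η : ℝ} (hη : 0 < η) :
    ∃ h' > 0, ∃ Λ ≥ 0, ∃ ε₀ > 0, ∀ ε ∈ Ioo 0 ε₀, ∀ z ∈ Metric.closedBall z₀ h',
      ∀ x ≥ Λ, ∀ x' ≥ Λ, ∀ w ≥ Λ,
        |leftTime ε (n z) (Real.exp (-x)) (Real.exp (-w)) -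
          leftTime ε (n z) (Real.exp (-x')) (Real.exp (-w)) - (√2)⁻¹ ^ 3 * (√A)⁻¹ * (x - x')| ≤
        η * |x - x'| := by
  obtain ⟨κ, hκ, H⟩ := exists_leftTime_log hA hc hC hη
  obtain ⟨h', hh', y, hy, hf⟩ := hflat κ hκ
  obtain ⟨Λ, hΛ, ε₀, hε₀, -, H⟩ := H y hy
  refine ⟨min h h', lt_min hh hh', Λ, hΛ, ε₀, hε₀, fun ε hε z hz => ?_⟩
  exact H _ (hn z (Metric.closedBall_subset_closedBall (min_le_left _ _) hz))
    (hf z (Metric.closedBall_subset_closedBall (min_le_right _ _) hz)) ε hε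

/-- One threshold for ε, depending on C alone, keeps every gap with end slopes at most 1 safely
below saturation. -/
lemma sq_mul_le_half {ε a b : ℝ} (hC : 0 ≤ C) (hε : ε ∈ Ioo 0 (2 * (2 + C))⁻¹) (ha : a ≤ 1)
    (hb : b ≤ 1) : ε ^ 2 * (a + b + C) ≤ 1 / 2 := by
  have h1 : ε * (2 * (2 + C)) ≤ 1 := by
    rw [← le_div_iff₀ (by positivity), one_div]
    exact hε.2.le
  have h0 := hε.1
  have h2 : ε ≤ 1 := by nlinarith
  calc ε ^ 2 * (a + b + C) ≤ ε ^ 2 * (2 + C) := by gcongr; linarith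
    _ = ε * (ε * (2 * (2 + C)) / 2) := by ring
    _ ≤ 1 * (1 / 2) := by gcongr
    _ = 1 / 2 := one_mul _

lemma exp_neg_le_one {x : ℝ} (hx : 0 ≤ x) : Real.exp (-x) ≤ 1 := by
  rw [Real.exp_le_one_iff]; linarith

lemma leftTime_mem_of_isProfile {f : ℝ → ℝ} (hc : 0 < c) (hC : 0 ≤ C) (hf : IsProfile c C f)
    {ε x w : ℝ} (hε : ε ∈ Ioo 0 (2 * (2 + C))⁻¹) (hx : 0 ≤ x) (hw : 0 ≤ w) :
    0 ≤ leftTime ε f (Real.exp (-x)) (Real.exp (-w)) ∧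
      leftTime ε f (Real.exp (-x)) (Real.exp (-w)) ≤
        Real.pi / 2 * (√(Real.exp (-x)))⁻¹ := by
  have := sq_mul_le_half hC hε (exp_neg_le_one hx) (exp_neg_le_one hw)
  exact ⟨hf.leftTime_nonneg hc hC (Real.exp_pos _) (Real.exp_pos _) (by linarith),
    hf.leftTime_le hc hC (Real.exp_pos _) (Real.exp_pos _) (by linarith)⟩

lemma abs_leftTime_sub_le_of_isProfile {f f' : ℝ → ℝ} (hc : 0 < c) (hC : 0 ≤ C)
    (hf : IsProfile c C f) (hf' : IsProfile c C f') {ε x w w' D : ℝ}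
    (hε : ε ∈ Ioo 0 (2 * (2 + C))⁻¹) (hx : 0 ≤ x) (hw : 0 ≤ w) (hw' : 0 ≤ w') (hD : 0 ≤ D)
    (hK : 0 ≤ K)
    (hff : ∀ t ∈ Icc (0 : ℝ) 1, |f t - f' t| ≤ K * D * (t * (1 - t))) :
    |leftTime ε f (Real.exp (-x)) (Real.exp (-w)) -
      leftTime ε f' (Real.exp (-x)) (Real.exp (-w'))| ≤
      4 * c⁻¹ * (1 + K) * (|Real.exp (-w) - Real.exp (-w')| + D) *
        (leftTime ε f (Real.exp (-x)) (Real.exp (-w)) +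
          rightTime ε f (Real.exp (-x)) (Real.exp (-w)) +
          leftTime ε f' (Real.exp (-x)) (Real.exp (-w')) +
          rightTime ε f' (Real.exp (-x)) (Real.exp (-w'))) := by
  have h1 := sq_mul_le_half hC hε (exp_neg_le_one hx) (exp_neg_le_one hw)
  have h2 := sq_mul_le_half hC hε (exp_neg_le_one hx) (exp_neg_le_one hw')
  have p1 := (leftTime_mem_of_isProfile hc hC hf hε hx hw).1
  have p2 := (leftTime_mem_of_isProfile hc hC hf' hε hx hw').1
  have p3 := (leftTime_mem_of_isProfile hc hC hf.reflect hε hw hx).1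
  have p4 := (leftTime_mem_of_isProfile hc hC hf'.reflect hε hw' hx).1
  rw [← rightTime_eq] at p3 p4
  refine (hf.abs_leftTime_sub_le hf' hc hC (Real.exp_pos _) (Real.exp_pos _) (Real.exp_pos _)
    h1 h2 hff).trans ?_
  have : 0 < c⁻¹ := inv_pos.2 hc
  rw [mul_assoc (4 * c⁻¹) (1 + K)]
  gcongr
  have := mul_nonneg hK (abs_nonneg (Real.exp (-w) - Real.exp (-w')))
  nlinarith

end

section

variable {F : ℝ → ℝ} {αbar βbar α₀ β₀ σ₀ δ h : ℝ}

lemma mem_bounds_of_mem_closedBall {z : ℝ × ℝ} (hz : z ∈ Metric.closedBall (α₀, β₀) h) :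
    |z.1 - α₀| ≤ h ∧ |z.2 - β₀| ≤ h := by
  rw [mem_closedBall_iff_norm, Prod.norm_def] at hz
  exact max_le_iff.1 hz

/-- The rescaled times required by the mass constraint are bounded above and below. -/
lemma time_mem_Icc {p q : ℝ} (hδ : δ ∈ Ioo 0 ((β₀ - α₀) / 2)) (hp : δ / 2 ≤ p)
    (hp' : p ≤ 2 * (β₀ - α₀)) (hq : (β₀ - α₀) / 2 ≤ q) (hq' : q ≤ 2 * (β₀ - α₀)) :
    p / q ^ 2 ∈ Icc (δ / 2 / (2 * (β₀ - α₀)) ^ 2)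
      (2 * (β₀ - α₀) / ((β₀ - α₀) / 2) ^ 2) := by
  have h0 := hδ.1
  have hL : 0 < β₀ - α₀ := by linarith [hδ.2]
  have hq0 : 0 < q := by linarith
  constructor <;> gcongr
  linarith

lemma exp_neg_div_lt {c s ε : ℝ} (hc : 0 < c) (hs : 0 < s) (hε : ε ∈ Ioo 0 (c * s)) :
    Real.exp (-c / ε) < s := by
  have h1 : 0 < c / ε := div_pos hc hε.1
  have h2 : c / ε + 1 ≤ Real.exp (c / ε) := Real.add_one_le_exp _
  rw [neg_div, Real.exp_neg, inv_lt_comm₀ (Real.exp_pos _) hs]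
  refine lt_of_lt_of_le ?_ (le_trans (by linarith) h2 : c / ε ≤ _)
  rw [inv_lt_iff_one_lt_mul₀ hs, div_mul_eq_mul_div, one_lt_div hε.1]
  exact hε.2

/-- Unique solvability of the time equations, with the end slopes `exp (-l)` as unknowns. -/
lemma IsMaxwell.exists_unique_logSlopes (hM : IsMaxwell F α₀ β₀ σ₀)
    (hF : IsFreeEnergy F αbar βbar) (hδ : δ ∈ Ioo 0 ((β₀ - α₀) / 2)) {c C K d : ℝ}
    {Kζ : NNReal} {ζ : ℝ × ℝ → ℝ × ℝ} (hh : 0 < h) (hhδ : h ≤ δ / 2) (hc : 0 < c) (hC : 0 ≤ C)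
    (hK : 0 ≤ K) (hn : ∀ z ∈ Metric.closedBall (α₀, β₀) h, IsProfile c C (profile F z))
    (hnn : ∀ z ∈ Metric.closedBall (α₀, β₀) h, ∀ z' ∈ Metric.closedBall (α₀, β₀) h,
      ∀ t ∈ Icc (0 : ℝ) 1, |profile F z t - profile F z' t| ≤ K * ‖z - z'‖ * (t * (1 - t)))
    (hflat : ∀ κ > 0, ∃ h' > 0, ∃ y ∈ Ioo (0 : ℝ) 1, ∀ z ∈ Metric.closedBall (α₀, β₀) h',
      IsFlat ((β₀ - α₀) ^ 2 * deriv (deriv F) α₀ / 2) κ y (profile F z) ∧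
      IsFlat ((β₀ - α₀) ^ 2 * deriv (deriv F) β₀ / 2) κ y (fun t => profile F z (1 - t)))
    (hd : 0 < d) (hζ : LipschitzOnWith Kζ ζ (Metric.closedBall 0 d)) (hζ0 : ζ 0 = (α₀, β₀)) :
    ∃ c > 0, ∃ Λ ≥ 0, ∃ ε₁ > 0, ∀ ε ∈ Ioo 0 ε₁, ∀ r ∈ Icc (α₀ + δ) (β₀ - δ), ∃ l : ℝ × ℝ,
      (Λ ≤ l.1 ∧ Λ ≤ l.2) ∧ (c / ε ≤ l.1 ∧ c / ε ≤ l.2) ∧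
      (leftTime ε (profile F (ζ (expNeg l))) (Real.exp (-l.1)) (Real.exp (-l.2)) =
          ((ζ (expNeg l)).2 - r) / ((ζ (expNeg l)).2 - (ζ (expNeg l)).1) ^ 2 / ε ∧
        rightTime ε (profile F (ζ (expNeg l))) (Real.exp (-l.1)) (Real.exp (-l.2)) =
          (r - (ζ (expNeg l)).1) / ((ζ (expNeg l)).2 - (ζ (expNeg l)).1) ^ 2 / ε) ∧
      ∀ l' : ℝ × ℝ, Λ ≤ l'.1 → Λ ≤ l'.2 →
        leftTime ε (profile F (ζ (expNeg l'))) (Real.exp (-l'.1)) (Real.exp (-l'.2)) =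
          ((ζ (expNeg l')).2 - r) / ((ζ (expNeg l')).2 - (ζ (expNeg l')).1) ^ 2 / ε →
        rightTime ε (profile F (ζ (expNeg l'))) (Real.exp (-l'.1)) (Real.exp (-l'.2)) =
          (r - (ζ (expNeg l')).1) / ((ζ (expNeg l')).2 - (ζ (expNeg l')).1) ^ 2 / ε → l' = l := by
  have hL : 0 < β₀ - α₀ := sub_pos.2 hM.lt
  have hδ1 := hδ.1
  have hδ2 := hδ.2
  have hA : 0 < (β₀ - α₀) ^ 2 * deriv (deriv F) α₀ / 2 := by
    have := hF.deriv2_pos_left hM; positivity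
  have hB : 0 < (β₀ - α₀) ^ 2 * deriv (deriv F) β₀ / 2 := by
    have := hF.deriv2_pos_right hM; positivity
  have hm : ∀ t ∈ Icc (0 : ℝ) 1, 1 - t ∈ Icc (0 : ℝ) 1 :=
    fun t ht => ⟨by linarith [ht.2], by linarith [ht.1]⟩
  have hP : ∀ r ∈ Icc (α₀ + δ) (β₀ - δ), ∀ z ∈ Metric.closedBall (α₀, β₀) h,
      (δ / 2 ≤ z.2 - r ∧ z.2 - r ≤ 2 * (β₀ - α₀)) ∧ (δ / 2 ≤ r - z.1 ∧ r - z.1 ≤ 2 * (β₀ - α₀)) ∧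
        (β₀ - α₀) / 2 ≤ z.2 - z.1 ∧ z.2 - z.1 ≤ 2 * (β₀ - α₀) := by
    intro r hr z hz
    obtain ⟨e1, e2⟩ := mem_bounds_of_mem_closedBall hz
    rw [abs_le] at e1 e2
    have := hr.1
    have := hr.2
    refine ⟨⟨?_, ?_⟩, ⟨?_, ?_⟩, ?_, ?_⟩ <;> linarith
  have hD : ∀ z z' : ℝ × ℝ, |z.2 - z.1 - (z'.2 - z'.1)| ≤ 2 * ‖z - z'‖ := by
    intro z z'
    have e1 := norm_fst_le (z - z')
    have e2 := norm_snd_le (z - z')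
    rw [Real.norm_eq_abs] at e1 e2
    calc |z.2 - z.1 - (z'.2 - z'.1)| = |(z - z').2 - (z - z').1| := by
          simp only [Prod.fst_sub, Prod.snd_sub]; ring_nf
      _ ≤ |(z - z').2| + |(z - z').1| := abs_sub _ _
      _ ≤ 2 * ‖z - z'‖ := by linarith
  refine exists_unique_of_times
    (J₁ := fun ε x w z => leftTime ε (profile F z) (Real.exp (-x)) (Real.exp (-w)))
    (J₂ := fun ε x w z => rightTime ε (profile F z) (Real.exp (-x)) (Real.exp (-w)))
    (ρ₁ := fun r z => (z.2 - r) / (z.2 - z.1) ^ 2) (ρ₂ := fun r z => (r - z.1) / (z.2 - z.1) ^ 2)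
    (G := fun x => Real.pi / 2 * (√(Real.exp (-x)))⁻¹) (z₀ := (α₀, β₀))
    (k₁ := (√2)⁻¹ ^ 3 * (√((β₀ - α₀) ^ 2 * deriv (deriv F) α₀ / 2))⁻¹)
    (k₂ := (√2)⁻¹ ^ 3 * (√((β₀ - α₀) ^ 2 * deriv (deriv F) β₀ / 2))⁻¹) (h := h)
    (K := 4 * c⁻¹ * (1 + K)) (Kζ := Kζ)
    (Kρ := 1 / ((β₀ - α₀) / 2) ^ 2 + 4 * (2 * (β₀ - α₀)) / ((β₀ - α₀) / 2) ^ 3)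
    (m := δ / 2 / (2 * (β₀ - α₀)) ^ 2) (M := 2 * (β₀ - α₀) / ((β₀ - α₀) / 2) ^ 2)
    (εc := (2 * (2 + C))⁻¹) (d := d)
    (by positivity) (by positivity) hh (by positivity) Kζ.2 (by positivity) (by positivity) ?_
    (by positivity) hd (by rwa [Real.toNNReal_coe]) hζ0 ?_ ?_ ?_ ?_ ?_ ?_ ?_ ?_ ?_ ?_
  · have := time_mem_Icc (p := β₀ - α₀) (q := β₀ - α₀) hδ (by linarith) (by linarith)
      (by linarith) (by linarith)
    exact this.1.trans this.2
  · intro η hη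
    refine exists_leftTime_log_family hh hA hc hC hn (fun κ hκ => ?_) hη
    obtain ⟨h', hh', y, hy, H⟩ := hflat κ hκ
    exact ⟨h', hh', y, hy, fun z hz => (H z hz).1⟩
  · intro η hη
    simp only [rightTime_eq]
    refine exists_leftTime_log_family (n := fun z t => profile F z (1 - t)) hh hB hc hC
      (fun z hz => (hn z hz).reflect) (fun κ hκ => ?_) hη
    obtain ⟨h', hh', y, hy, H⟩ := hflat κ hκ
    exact ⟨h', hh', y, hy, fun z hz => (H z hz).2⟩
  · intro ε hε z hz x hx w hw
    exact leftTime_mem_of_isProfile hc hC (hn z hz) hε hx hw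
  · intro ε hε z hz x hx w hw
    simp only [rightTime_eq]
    exact leftTime_mem_of_isProfile hc hC (hn z hz).reflect hε hx hw
  · intro ε hε z hz z' hz' x hx w hw w' hw'
    exact abs_leftTime_sub_le_of_isProfile hc hC (hn z hz) (hn z' hz') hε hx hw hw'
      (norm_nonneg _) hK (hnn z hz z' hz')
  · intro ε hε z hz z' hz' x hx w hw w' hw'
    have := abs_leftTime_sub_le_of_isProfile hc hC (hn z hz).reflect (hn z' hz').reflect hε hx hw
      hw' (norm_nonneg (z - z')) hK (fun t ht => by
        have := hnn z hz z' hz' _ (hm t ht)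
        rwa [sub_sub_cancel, mul_comm (1 - t)] at this)
    -- The estimate for the reflected profiles contains their right times too; reflecting twice
    -- expresses these through the original left times.
    rw [rightTime_eq ε (fun t => profile F z (1 - t)), rightTime_eq ε (fun t => profile F z' (1 - t)),
      ← rightTime_eq, ← rightTime_eq] at this
    simp only [sub_sub_cancel] at this
    refine this.trans (le_of_eq (by ring))
  · intro r hr z hz
    obtain ⟨⟨e1, e2⟩, -, e3, e4⟩ := hP r hr z hz
    exact time_mem_Icc hδ e1 e2 e3 e4
  · intro r hr z hz
    obtain ⟨-, ⟨e1, e2⟩, e3, e4⟩ := hP r hr z hz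
    exact time_mem_Icc hδ e1 e2 e3 e4
  · intro r hr z hz z' hz'
    obtain ⟨-, -, e3, -⟩ := hP r hr z hz
    obtain ⟨⟨e1, e2⟩, -, e4, -⟩ := hP r hr z' hz'
    refine abs_div_sq_sub_le (by positivity) e3 e4 (by rw [abs_of_nonneg] <;> linarith) ?_ (hD z z')
    rw [sub_sub_sub_cancel_right]
    exact norm_snd_le (z - z')
  · intro r hr z hz z' hz'
    obtain ⟨-, -, e3, -⟩ := hP r hr z hz
    obtain ⟨-, ⟨e1, e2⟩, e4, -⟩ := hP r hr z' hz'
    refine abs_div_sq_sub_le (by positivity) e3 e4 (by rw [abs_of_nonneg] <;> linarith) ?_ (hD z z')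
    rw [sub_sub_sub_cancel_left, abs_sub_comm]
    exact norm_fst_le (z - z')

set_option maxHeartbeats 1000000 in
/-- Near the Maxwell point there is exactly one simple solution. -/
theorem IsMaxwell.exists_unique_isSimpleSolution (hM : IsMaxwell F α₀ β₀ σ₀)
    (hF : IsFreeEnergy F αbar βbar) (hδ : δ ∈ Ioo 0 ((β₀ - α₀) / 2)) :
    ∃ ε_δ : ℝ, 0 < ε_δ ∧ ∃ N ∈ 𝓝 ((σ₀, Gibbs F σ₀ α₀) : ℝ × ℝ), ∃ C : ℝ, 0 < C ∧ ∃ K : ℝ,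
      ∀ ε ∈ Ioo 0 ε_δ, ∀ r ∈ Icc (α₀ + δ) (β₀ - δ),
        ∃ (Δ : ℝ × ℝ) (z : ℝ → ℝ),
          (IsSimpleSolution F ε r Δ z ∧ IsAdmissible F Δ ∧ Δ ∈ N) ∧
          (∀ (Δ' : ℝ × ℝ) (z' : ℝ → ℝ), IsSimpleSolution F ε r Δ' z' → Δ' ∈ N →
            Δ' = Δ ∧ EqOn z' z (dom ε)) ∧
          IsTurningPair F Δ (z (-ε⁻¹)) (z ε⁻¹) ∧
          ‖Δ - (σ₀, Gibbs F σ₀ α₀)‖ ≤ K * Real.exp (-C / ε) ∧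
          |z (-ε⁻¹) - α₀| ≤ K * Real.exp (-C / ε) ∧
          |z ε⁻¹ - β₀| ≤ K * Real.exp (-C / ε) := by
  have hδ1 := hδ.1
  obtain ⟨h₀, hh₀, hhα, c, hc, C, hC, K, hK, hn, hnn, hflat⟩ := hM.exists_profile_bounds hF
  obtain ⟨ζ, Kζ, hζ0, hright, hleft, hf, s, hs, hlip⟩ := hM.exists_ofSlopes hF
  obtain ⟨Kp, hKp, hpair⟩ := hM.exists_norm_pairOf_sub_le hF
  obtain ⟨Na, hNa, ha, hha, hadm⟩ := hM.exists_isAdmissible hF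
  obtain ⟨d, hd, hds⟩ := Metric.nhds_basis_closedBall.mem_iff.1 (Filter.inter_mem hs hright)
  set h := min h₀ (δ / 2) with hh
  have hhpos : 0 < h := by positivity
  have hsub : Metric.closedBall (α₀, β₀) h ⊆ Metric.closedBall (α₀, β₀) h₀ :=
    Metric.closedBall_subset_closedBall (min_le_left _ _)
  obtain ⟨c₁, hc₁, Λ, hΛ, ε₁, hε₁, H⟩ := hM.exists_unique_logSlopes hF hδ hhpos (min_le_right _ _)
    hc hC hK (fun z hz => hn z (hsub hz)) (fun z hz z' hz' => hnn z (hsub hz) z' (hsub hz')) hflat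
    hd (hlip.mono fun y hy => (hds hy).1) hζ0
  have hΛ1 : Real.exp (-Λ) ≤ 1 := exp_neg_le_one hΛ
  obtain ⟨h₂, hh₂, hball⟩ := Metric.nhds_basis_ball.mem_iff.1
    (Filter.inter_mem (Filter.inter_mem hleft hpair)
      (hf (Metric.ball_mem_nhds 0 (Real.exp_pos (-Λ)))))
  set h₃ := min (min h h₂) ha with hh₃
  have hh₃pos : 0 < h₃ := by positivity
  obtain ⟨N, hN, hNturn⟩ := hM.exists_nhds_turningPair hF hh₃pos
  have hNN : N ∩ Prod.fst ⁻¹' Na ∈ 𝓝 ((σ₀, Gibbs F σ₀ α₀) : ℝ × ℝ) :=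
    Filter.inter_mem hN (continuous_fst.continuousAt hNa)
  obtain ⟨ϱ, hϱ, hϱN⟩ := Metric.nhds_basis_ball.mem_iff.1 hNN
  -- Once e^(-c₁/ε) < t, the slopes lie in the domain of ζ, the turning points within h₃ of the
  -- tangency points, and the pair in the chosen neighbourhood.
  set t := min d (min (h₃ / (Kζ + 1)) (ϱ / ((Kp + 1) * (Kζ + 1)))) with ht
  have htpos : 0 < t := by positivity
  have hmem : ∀ z : ℝ × ℝ, |z.1 - α₀| < h₃ → |z.2 - β₀| < h₃ →
      IsProfile c C (profile F z) ∧ ζ (slopeL F z, slopeR F z) = z ∧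
      ‖pairOf F z - (σ₀, Gibbs F σ₀ α₀)‖ ≤ Kp * ‖z - (α₀, β₀)‖ ∧
      |slopeL F z| < Real.exp (-Λ) ∧ |slopeR F z| < Real.exp (-Λ) ∧ 0 < z.1 ∧ z.1 < z.2 := by
    intro z h1 h2
    have e1 : ‖z - (α₀, β₀)‖ < h₃ := by
      rw [Prod.norm_def]; exact max_lt h1 h2
    have e2 : h₃ ≤ h := (min_le_left _ _).trans (min_le_left _ _)
    have e3 : h₃ ≤ h₂ := (min_le_left _ _).trans (min_le_right _ _)
    obtain ⟨⟨g1, g2⟩, g3⟩ := hball (mem_ball_iff_norm.2 (e1.trans_le e3))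
    have g4 : ‖(slopeL F z, slopeR F z)‖ < Real.exp (-Λ) := mem_ball_zero_iff.1 g3
    rw [Prod.norm_def, max_lt_iff] at g4
    have e4 : h ≤ h₀ := min_le_left _ _
    have e5 : h ≤ δ / 2 := min_le_right _ _
    rw [abs_lt] at h1 h2
    exact ⟨hn z (hsub (mem_closedBall_iff_norm.2 (e1.le.trans e2))), g1, g2, g4.1, g4.2,
      by linarith, by linarith [hδ.2]⟩
  refine ⟨min (min ε₁ (2 * (2 + C))⁻¹) (c₁ * t), by positivity, N ∩ Prod.fst ⁻¹' Na, hNN, c₁, hc₁,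
    (Kp + 1) * Kζ, ?_⟩
  rintro ε ⟨hε, hε'⟩ r hr
  rw [lt_min_iff, lt_min_iff] at hε'
  obtain ⟨⟨hε1, hε2⟩, hε3⟩ := hε'
  obtain ⟨l, ⟨hl1, hl2⟩, ⟨hl3, hl4⟩, ⟨hJ1, hJ2⟩, huniq⟩ := H ε ⟨hε, hε1⟩ r hr
  have hE := exp_neg_div_lt hc₁ htpos ⟨hε, hε3⟩
  set E := Real.exp (-c₁ / ε) with hEdef
  have hE0 : 0 < E := Real.exp_pos _
  have hsmall : ∀ a b : ℝ, |a| < Real.exp (-Λ) → |b| < Real.exp (-Λ) →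
      ε ^ 2 * (a + b + C) < 1 := by
    intro a b h1 h2
    have := sq_mul_le_half hC ⟨hε, hε2⟩ ((le_abs_self a).trans (h1.le.trans hΛ1))
      ((le_abs_self b).trans (h2.le.trans hΛ1))
    linarith
  have hyE : ‖expNeg l‖ ≤ E := by
    rw [hEdef, neg_div]; exact norm_expNeg_le hl3 hl4
  have hyd : expNeg l ∈ Metric.closedBall (0 : ℝ × ℝ) d :=
    mem_closedBall_zero_iff.2 (hyE.trans (hE.le.trans (min_le_left _ _)))
  set z := ζ (expNeg l) with hz
  obtain ⟨hsL, hsR⟩ : slopeL F z = Real.exp (-l.1) ∧ slopeR F z = Real.exp (-l.2) := (hds hyd).2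
  have hzE : ‖z - (α₀, β₀)‖ ≤ Kζ * E := by
    have := hlip.norm_sub_le (hds hyd).1 (hds (Metric.mem_closedBall_self hd.le)).1
    rw [hζ0, sub_zero] at this
    exact this.trans (by gcongr)
  have hzh : ‖z - (α₀, β₀)‖ < h₃ := by
    refine hzE.trans_lt ?_
    have e1 : E < h₃ / (Kζ + 1) := hE.trans_le ((min_le_right _ _).trans (min_le_left _ _))
    rw [lt_div_iff₀ (by positivity)] at e1
    linarith
  have hz1 : |z.1 - α₀| ≤ ‖z - (α₀, β₀)‖ := norm_fst_le (z - (α₀, β₀))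
  have hz2 : |z.2 - β₀| ≤ ‖z - (α₀, β₀)‖ := norm_snd_le (z - (α₀, β₀))
  obtain ⟨hnz, -, hpz, hL, hR, hpos, hlt⟩ := hmem z (hz1.trans_lt hzh) (hz2.trans_lt hzh)
  have hsL0 : 0 < slopeL F z := hsL ▸ Real.exp_pos _
  have hsR0 : 0 < slopeR F z := hsR ▸ Real.exp_pos _
  have hεz := hsmall _ _ hL hR
  obtain ⟨u, hu, hu1, hu2⟩ := hF.exists_isSimpleSolution hpos hlt hsL0 hsR0 hc hC hnz hε hεz
    (by rw [hsL, hsR]; exact hJ1) (by rw [hsL, hsR]; exact hJ2)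
  have hturn := hu.isTurningPair hF hε
  have hpE : ‖pairOf F z - (σ₀, Gibbs F σ₀ α₀)‖ ≤ Kp * (Kζ * E) := hpz.trans (by gcongr)
  have hKE : 0 ≤ Kζ * E := by positivity
  have hPN : pairOf F z ∈ N ∩ Prod.fst ⁻¹' Na := by
    refine hϱN (mem_ball_iff_norm.2 (hpE.trans_lt ?_))
    have e1 : E < ϱ / ((Kp + 1) * (Kζ + 1)) :=
      hE.trans_le ((min_le_right _ _).trans (min_le_right _ _))
    rw [lt_div_iff₀ (by positivity)] at e1
    nlinarith [mul_pos hKp hE0]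
  have hu1' : |u (-ε⁻¹) - α₀| ≤ ‖z - (α₀, β₀)‖ := hu1 ▸ hz1
  have hu2' : |u ε⁻¹ - β₀| ≤ ‖z - (α₀, β₀)‖ := hu2 ▸ hz2
  have hza : h₃ ≤ ha := min_le_right _ _
  refine ⟨pairOf F z, u, ⟨hu, ?_, hPN⟩, ?_, hturn, hpE.trans (by linarith), by nlinarith,
    by nlinarith⟩
  · refine hadm _ _ _ hPN.2 ((hu1'.trans_lt hzh).trans_le hza) ((hu2'.trans_lt hzh).trans_le hza)
      ?_ ?_ hturn
    · rw [hu1]; exact lt_deriv_of_slopeL_pos hlt hsL0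
    · rw [hu2]; exact deriv_lt_of_slopeR_pos hlt hsR0
  · intro Δ' u' hu' hΔ'
    have hturn' := hu'.isTurningPair hF hε
    obtain ⟨k1, k2⟩ := hNturn Δ' hΔ'.1 _ _ hturn'
    obtain ⟨hnz', hζz', -, hL', hR', -, -⟩ := hmem (u' (-ε⁻¹), u' ε⁻¹) k1 k2
    obtain ⟨p1, p2⟩ := hu'.slopes_pos hF hε
    have hεz' := hsmall _ _ hL' hR'
    obtain ⟨q1, q2⟩ := hu'.times hF hε rfl hc hC hnz' hεz'
    have hpair' := hturn'.eq_pairOf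
    set z' : ℝ × ℝ := (u' (-ε⁻¹), u' ε⁻¹) with hz'
    -- Positive end slopes below e^(-Λ) give logarithmic parameters above Λ, so the uniqueness of
    -- the parameters applies to any competing solution.
    set l' : ℝ × ℝ := (-Real.log (slopeL F z'), -Real.log (slopeR F z')) with hl'
    have x1 : Real.exp (-l'.1) = slopeL F z' := by rw [hl', neg_neg, Real.exp_log p1]
    have x2 : Real.exp (-l'.2) = slopeR F z' := by rw [hl', neg_neg, Real.exp_log p2]
    have x3 : expNeg l' = (slopeL F z', slopeR F z') := Prod.ext x1 x2
    have x4 : ζ (expNeg l') = z' := by rw [x3, hζz']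
    rw [abs_of_pos p1, ← x1, Real.exp_lt_exp] at hL'
    rw [abs_of_pos p2, ← x2, Real.exp_lt_exp] at hR'
    have hll := huniq l' (by linarith) (by linarith) (by rw [x4, x1, x2]; exact q1)
      (by rw [x4, x1, x2]; exact q2)
    have hzz : z' = z := by rw [← x4, hll]
    refine ⟨by rw [hpair', hzz], ?_⟩
    refine hu'.eqOn hF hε hu hzz.symm ?_ hc hC hnz hεz
    rw [hu1, hu2]

end

end

end Maxwell

theorem theorem3p1 (F : ℝ → ℝ) (αbar βbar : ℝ) (hF : Maxwell.IsFreeEnergy F αbar βbar)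
    (α₀ β₀ σ₀ b₀ : ℝ) (hM : Maxwell.IsMaxwell F α₀ β₀ σ₀) (hb₀ : b₀ = Maxwell.Gibbs F σ₀ α₀)
    (δ : ℝ) (hδ : δ ∈ Set.Ioo 0 ((β₀ - α₀) / 2)) :
    ∃ ε_δ : ℝ, 0 < ε_δ ∧ ∃ N ∈ nhds ((σ₀, b₀) : ℝ × ℝ), ∃ C : ℝ, 0 < C ∧ ∃ K : ℝ,
      ∀ ε ∈ Set.Ioo 0 ε_δ, ∀ r ∈ Set.Icc (α₀ + δ) (β₀ - δ),
        ∃ (Δ : ℝ × ℝ) (z : ℝ → ℝ),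
          -- a simple solution with admissible pair in `N`
          (Maxwell.IsSimpleSolution F ε r Δ z ∧ Maxwell.IsAdmissible F Δ ∧ Δ ∈ N) ∧
          -- it is the only simple solution with pair in `N`
          (∀ (Δ' : ℝ × ℝ) (z' : ℝ → ℝ), Maxwell.IsSimpleSolution F ε r Δ' z' → Δ' ∈ N →
            Δ' = Δ ∧ Set.EqOn z' z (Maxwell.dom ε)) ∧
          -- its end values are the turning points `z₁(Δ)`, `z₂(Δ)`
          Maxwell.IsTurningPair F Δ (z (-ε⁻¹)) (z ε⁻¹) ∧
          -- exponential estimates, uniform in `r`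
          ‖Δ - (σ₀, b₀)‖ ≤ K * Real.exp (-C / ε) ∧
          |z (-ε⁻¹) - α₀| ≤ K * Real.exp (-C / ε) ∧
          |z ε⁻¹ - β₀| ≤ K * Real.exp (-C / ε) := by
  subst hb₀
  exact hM.exists_unique_isSimpleSolution hF hδ
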